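/- Let $n\in\mathbb N$, $T>0$, $\alpha\in(0,1)$, and let $\|\cdot\|$, $\langle\cdot,\cdot\rangle$ be the Euclidean norm and inner product of $\mathbb R^n$. \textbf{Notation.} For $\beta>0$ put $(I^\beta\psi)(\tau)=\frac1{\Gamma(\beta)}\int_0^\tau\frac{\psi(\xi)}{(\tau-\xi)^{1-\beta}}\,d\xi$. For $t\in[0,T]$ let $AC^\alpha([0,t],\mathbb R^n)\subset C([0,t],\mathbb R^n)$ be the set of functions $x(\cdot)=x(0)+(I^\alpha\psi)(\cdot)$ with $\psi\in L^\infty([0,t],\mathbb R^n)$, with the uniform norm. The Caputo derivative of such $x(\cdot)$ is $({}^CD^\alpha x)(\tau)=\frac{d}{d\tau}\big(I^{1-\alpha}(x(\cdot)-x(0))\big)(\tau)$, which exists for a.e. $\tau$. Let $G_n$ be the set of pairs $(t,w(\cdot))$ with $t\in[0,T]$ and $w(\cdot)\in C([0,t],\mathbb R^n)$, with the metric $$\operatorname{dist}(p,p')=\max\{\operatorname{dist}^*(p,p'),\operatorname{dist}^*(p',p)\},\qquad \operatorname{dist}^*\big((t,w),(t',w')\big)=\max_{\tau\in[0,t]}\min_{\tau'\in[0,t']}\sqrt{|\tau-\tau'|^2+\|w(\tau)-w'(\tau')\|^2},$$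 and let $G_n^\alpha=\{(t,w(\cdot))\in G_n: w(\cdot)\in AC^\alpha([0,t],\mathbb R^n)\}$. For a function $x(\cdot)$ on $[0,T]$, $x_t(\cdot)$ is its restriction to $[0,t]$. \textbf{Assumptions.} Let $H:[0,T]\times\mathbb R^n\times\mathbb R^n\to\mathbb R$ and $\sigma:AC^\alpha([0,T],\mathbb R^n)\to\mathbb R$ satisfy: (H.1) $H$ is continuous; (H.2) $c_H>0$ is a constant such that $|H(t,x,s)-H(t,x,s')|\le c_H(1+\|x\|)\|s-s'\|$ for all $t\in[0,T]$, $x,s,s'\in\mathbb R^n$; (H.3) for every $R\ge0$ there is $\lambda_H>0$ such that $|H(t,x,s)-H(t,x',s)|\le\lambda_H(1+\|s\|)\|x-x'\|$ for all $t\in[0,T]$ and $x,x',s\in\mathbb R^n$ with $\|x\|\le R$, $\|x'\|\le R$; ($\sigma$) $\sigma$ is continuous. \textbf{Minimax solutions.} Consider the Cauchy problem for the Hamilton--Jacobi equation with coinvariant derivatives of order $\alpha$ $$\partial_t^\alpha\varphi(t,w(\cdot))+H\big(t,w(t),\nabla^\alpha\varphi(t,w(\cdot))\big)=0,\quad (t,w(\cdot))\in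 G_n^\alpha,\ t<T;\qquad \varphi(T,w(\cdot))=\sigma(w(\cdot)),\quad w(\cdot)\in AC^\alpha([0,T],\mathbb R^n).\tag{1}$$ Its generalized solutions are defined without reference to the derivatives of $\varphi$, as follows. Put $E(t,x,s)=\{(f,h)\in\mathbb R^n\times\mathbb R:\ \|f\|\le c_H(1+\|x\|),\ h=\langle s,f\rangle-H(t,x,s)\}$. For $(t_0,w_0(\cdot))\in G_n^\alpha$, $z_0\in\mathbb R$ and $s\in\mathbb R^n$, let $CH(t_0,w_0(\cdot),z_0,s)$ be the set of pairs $(x(\cdot),z(\cdot))$ with $x(\cdot)\in AC^\alpha([0,T],\mathbb R^n)$ and $z(\cdot):[0,T]\to\mathbb R$ Lipschitz continuous such that $x(t)=w_0(t)$ and $z(t)=z_0$ for $t\in[0,t_0]$, and $\big(({}^CD^\alpha x)(t),\dot z(t)\big)\in E(t,x(t),s)$ for a.e. $t\in[t_0,T]$. An \emph{upper solution} of (1) is a lower semicontinuous functional $\varphi:G_n^\alpha\to\mathbb R$ such that $\varphi(T,w(\cdot))\ge\sigma(w(\cdot))$ for all $w(\cdot)\in AC^\alpha([0,T],\mathbb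 R^n)$, and for every $(t_0,w_0(\cdot))\in G_n^\alpha$ with $t_0<T$, every $t\in(t_0,T]$, $s\in\mathbb R^n$ and $\varepsilon>0$ there is $(x(\cdot),z(\cdot))\in CH(t_0,w_0(\cdot),0,s)$ with $\varphi(t,x_t(\cdot))-z(t)\le\varphi(t_0,w_0(\cdot))+\varepsilon$. A \emph{lower solution} of (1) is an upper semicontinuous functional $\varphi:G_n^\alpha\to\mathbb R$ such that $\varphi(T,w(\cdot))\le\sigma(w(\cdot))$ for all $w(\cdot)\in AC^\alpha([0,T],\mathbb R^n)$, and for the same data there is $(x(\cdot),z(\cdot))\in CH(t_0,w_0(\cdot),0,s)$ with $\varphi(t,x_t(\cdot))-z(t)\ge\varphi(t_0,w_0(\cdot))-\varepsilon$. A \emph{minimax solution} of (1) is a functional that is both an upper and a lower solution. \textbf{Theorem.} Under (H.1)--(H.3) and ($\sigma$), there exists exactly one minimax solution $\varphi:G_n^\alpha\to\mathbb R$ of the Cauchy problem (1). -/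

import Mathlib

open Set MeasureTheory

noncomputable section

namespace FracHJ

/-- `ℝⁿ` with the Euclidean norm. -/
abbrev Vec (n : ℕ) : Type := EuclideanSpace ℝ (Fin n)

/-- Value at `τ` of a function given on `[0, t]`; only used for `τ ∈ [0, t]`
(the value outside is an irrelevant default). -/
def ev {V : Type*} [TopologicalSpace V] [Zero V] {t : ℝ} (w : C(Icc (0 : ℝ) t, V)) (τ : ℝ) : V :=
  open Classical in if h : τ ∈ Icc (0 : ℝ) t then w ⟨τ, h⟩ else 0

/-- The left-sided Riemann-Liouville fractional integral
`(I^β ψ)(τ) = Γ(β)⁻¹ ∫₀^τ ψ(ξ) (τ - ξ)^(β - 1) dξ` of order `β > 0`. -/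
def rlIntegral {n : ℕ} (β : ℝ) (ψ : ℝ → Vec n) (τ : ℝ) : Vec n :=
  (1 / Real.Gamma β) • ∫ ξ in (0 : ℝ)..τ, ((τ - ξ) ^ (β - 1)) • ψ ξ

/-- `AC^α([0, t], ℝⁿ)`: functions of the form `w(0) + I^α ψ` with `ψ ∈ L^∞([0, t], ℝⁿ)`,
as a subset of `C([0, t], ℝⁿ)`; its coercion to a type carries the topology of uniform
convergence. -/
def AC (α t : ℝ) (n : ℕ) : Set C(Icc (0 : ℝ) t, Vec n) :=
  {w | ∃ ψ : ℝ → Vec n, MemLp ψ ⊤ (volume.restrict (Icc (0 : ℝ) t)) ∧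
    ∀ τ ∈ Icc (0 : ℝ) t, ev w τ = ev w 0 + rlIntegral α ψ τ}

/-- The Caputo derivative `(^C D^α x)(τ) = d/dτ (I^{1-α}(x(·) - x(0)))(τ)`. -/
def caputo {n : ℕ} {t : ℝ} (α : ℝ) (x : C(Icc (0 : ℝ) t, Vec n)) (τ : ℝ) : Vec n :=
  deriv (fun r => rlIntegral (1 - α) (fun ξ => ev x ξ - ev x 0) r) τ

/-- The set `G_n` of pairs `(t, w(·))` with `t ∈ [0, T]` and `w(·) ∈ C([0, t], ℝⁿ)`. -/
structure PathPair (T : ℝ) (n : ℕ) where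
  t : ℝ
  ht : t ∈ Icc (0 : ℝ) T
  w : C(Icc (0 : ℝ) t, Vec n)

namespace PathPair

variable {T : ℝ} {n : ℕ}

/-- `dist*(p, q) = max_τ min_τ' √(|τ - τ'|² + ‖w(τ) - w'(τ')‖²)`. -/
def distStar (p q : PathPair T n) : ℝ :=
  ⨆ τ : Icc (0 : ℝ) p.t, ⨅ τ' : Icc (0 : ℝ) q.t,
    Real.sqrt (|(τ : ℝ) - τ'| ^ 2 + ‖p.w τ - q.w τ'‖ ^ 2)

/-- The graph of the path, as a nonempty compact subset of `ℝ × ℝⁿ` with the Euclidean metric;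
it serves to check that `max (distStar p q) (distStar q p)` is a metric. -/
def graph (p : PathPair T n) : TopologicalSpace.NonemptyCompacts (WithLp 2 (ℝ × Vec n)) where
  carrier := range fun τ : Icc (0 : ℝ) p.t => WithLp.toLp 2 ((τ : ℝ), p.w τ)
  isCompact' := isCompact_range (by fun_prop)
  nonempty' := ⟨_, ⟨⟨0, left_mem_Icc.2 p.ht.1⟩, rfl⟩⟩

theorem graph_injective : Function.Injective (graph : PathPair T n → _) := by
  have key : ∀ p q : PathPair T n, p.graph = q.graph → ∀ τ : Icc (0 : ℝ) p.t,
      ∃ h : (τ : ℝ) ∈ Icc (0 : ℝ) q.t, q.w ⟨τ, h⟩ = p.w τ := by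
    intro p q h τ
    have h1 : WithLp.toLp 2 ((τ : ℝ), p.w τ) ∈ (q.graph : Set (WithLp 2 (ℝ × Vec n))) := by
      rw [← h]; exact ⟨τ, rfl⟩
    obtain ⟨τ', h2⟩ := h1
    have h3 := congrArg WithLp.ofLp h2
    simp only [Prod.mk.injEq] at h3
    obtain ⟨h4, h5⟩ := h3
    refine ⟨h4 ▸ τ'.2, ?_⟩
    rw [← h5]; congr 1; exact Subtype.ext h4.symm
  intro p q h
  have e1 : p.t ≤ q.t := (key p q h ⟨p.t, right_mem_Icc.2 p.ht.1⟩).1.2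
  have e2 : q.t ≤ p.t := (key q p h.symm ⟨q.t, right_mem_Icc.2 q.ht.1⟩).1.2
  have e : p.t = q.t := le_antisymm e1 e2
  have k := key p q h
  obtain ⟨t, ht, w⟩ := p
  obtain ⟨t', ht', w'⟩ := q
  dsimp only at e k
  subst e
  congr 1
  ext1 τ
  exact (k τ).2.symm

theorem iSup_infDist_graph (p q : PathPair T n) :
    (⨆ x ∈ (p.graph : Set (WithLp 2 (ℝ × Vec n))),
      Metric.infEDist x (q.graph : Set (WithLp 2 (ℝ × Vec n)))).toReal = distStar p q := by
  have hr : (⨆ x ∈ (p.graph : Set (WithLp 2 (ℝ × Vec n))),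
      Metric.infEDist x (q.graph : Set (WithLp 2 (ℝ × Vec n)))) =
      ⨆ τ : Icc (0 : ℝ) p.t, Metric.infEDist (WithLp.toLp 2 ((τ : ℝ), p.w τ))
        (q.graph : Set (WithLp 2 (ℝ × Vec n))) := iSup_range
  rw [hr, ENNReal.toReal_iSup fun τ => Metric.infEDist_ne_top q.graph.nonempty]
  refine iSup_congr fun τ => ?_
  have : Metric.infDist (WithLp.toLp 2 ((τ : ℝ), p.w τ))
      (q.graph : Set (WithLp 2 (ℝ × Vec n))) = _ := Metric.infDist_eq_iInf
  rw [← Metric.infDist, this]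
  have h2 : ∀ f : WithLp 2 (ℝ × Vec n) → ℝ,
      (⨅ y : (q.graph : Set (WithLp 2 (ℝ × Vec n))), f y) =
      ⨅ τ' : Icc (0 : ℝ) q.t, f (WithLp.toLp 2 ((τ' : ℝ), q.w τ')) := by
    intro f
    exact (Function.Surjective.iInf_comp (Set.rangeFactorization_surjective
      (f := fun τ : Icc (0 : ℝ) q.t => WithLp.toLp 2 ((τ : ℝ), q.w τ)))
      (fun y => f y)).symm
  rw [h2]
  refine iInf_congr fun τ' => ?_
  rw [WithLp.prod_dist_eq_of_L2]
  simp [dist_eq_norm]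

theorem max_distStar_eq (p q : PathPair T n) :
    max (distStar p q) (distStar q p) = dist p.graph q.graph := by
  have h : dist p.graph q.graph = (Metric.hausdorffEDist
    (p.graph : Set (WithLp 2 (ℝ × Vec n))) q.graph).toReal := rfl
  have hf : Metric.hausdorffEDist
    (p.graph : Set (WithLp 2 (ℝ × Vec n))) q.graph ≠ ⊤ := edist_ne_top p.graph q.graph
  rw [h]
  rw [Metric.hausdorffEDist_def] at hf ⊢
  rw [ENNReal.toReal_max (ne_top_of_le_ne_top hf le_sup_left)
    (ne_top_of_le_ne_top hf le_sup_right), iSup_infDist_graph, iSup_infDist_graph]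

/-- `G_n` is endowed with the metric `dist = max {dist*(p, q), dist*(q, p)}`. -/
instance : MetricSpace (PathPair T n) where
  dist p q := max (distStar p q) (distStar q p)
  dist_self p := by rw [max_distStar_eq, dist_self]
  dist_comm p q := max_comm _ _
  dist_triangle p q r := by simp only [max_distStar_eq]; exact dist_triangle _ _ _
  eq_of_dist_eq_zero {p q} h := by
    rw [max_distStar_eq] at h
    exact graph_injective (dist_eq_zero.1 h)

end PathPair

/-- The set `G_n^α` of pairs `(t, w(·))` with `w(·) ∈ AC^α([0, t], ℝⁿ)`; its coercion to a type
carries the metric of `G_n`. -/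
def GAlpha (α T : ℝ) (n : ℕ) : Set (PathPair T n) := {p | p.w ∈ AC α p.t n}

/-- The restriction `x_t(·)` of `x(·)` to `[0, t]`. -/
def restr {T t : ℝ} {n : ℕ} (ht : t ∈ Icc (0 : ℝ) T) (x : C(Icc (0 : ℝ) T, Vec n)) :
    C(Icc (0 : ℝ) t, Vec n) :=
  x.comp ⟨inclusion (Icc_subset_Icc_right ht.2), continuous_inclusion _⟩

theorem ev_restr {T t : ℝ} {n : ℕ} (ht : t ∈ Icc (0 : ℝ) T) (x : C(Icc (0 : ℝ) T, Vec n))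
    {τ : ℝ} (hτ : τ ∈ Icc (0 : ℝ) t) : ev (restr ht x) τ = ev x τ := by
  have h' : τ ∈ Icc (0 : ℝ) T := ⟨hτ.1, hτ.2.trans ht.2⟩
  simp only [ev, dif_pos hτ, dif_pos h']
  rfl

theorem restr_mem {α T t : ℝ} {n : ℕ} (ht : t ∈ Icc (0 : ℝ) T) {x : C(Icc (0 : ℝ) T, Vec n)}
    (hx : x ∈ AC α T n) : restr ht x ∈ AC α t n := by
  obtain ⟨ψ, hψ, h⟩ := hx
  refine ⟨ψ, hψ.mono_measure (Measure.restrict_mono_set _ (Icc_subset_Icc_right ht.2)), ?_⟩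
  intro τ hτ
  rw [ev_restr ht x hτ, ev_restr ht x (left_mem_Icc.2 ht.1)]
  exact h τ ⟨hτ.1, hτ.2.trans ht.2⟩

/-- The point `(t, x_t(·)) ∈ G_n^α` for `x(·) ∈ AC^α([0, T], ℝⁿ)` and `t ∈ [0, T]`. -/
def hist {α T : ℝ} {n : ℕ} (x : AC α T n) (t : ℝ) (ht : t ∈ Icc (0 : ℝ) T) : GAlpha α T n :=
  ⟨⟨t, ht, restr ht x⟩, restr_mem ht x.2⟩

/-- The point `(T, w(·)) ∈ G_n^α` for `w(·) ∈ AC^α([0, T], ℝⁿ)`. -/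
def terminal {α T : ℝ} {n : ℕ} (hT : 0 < T) (w : AC α T n) : GAlpha α T n :=
  ⟨⟨T, right_mem_Icc.2 hT.le, w⟩, w.2⟩

/-- `E(t, x, s) = {(f, h) : ‖f‖ ≤ c_H (1 + ‖x‖), h = ⟨s, f⟩ - H(t, x, s)}`. -/
def charSet {n : ℕ} (H : ℝ → Vec n → Vec n → ℝ) (cH t : ℝ) (x s : Vec n) : Set (Vec n × ℝ) :=
  {fh | ‖fh.1‖ ≤ cH * (1 + ‖x‖) ∧ fh.2 = inner ℝ s fh.1 - H t x s}

/-- The set `CH(t₀, w₀(·), z₀, s)` of characteristics: pairs of `x(·) ∈ AC^α([0, T], ℝⁿ)` and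
`z(·) ∈ Lip([0, T], ℝ)` with `x = w₀`, `z = z₀` on `[0, t₀]` and
`((^C D^α x)(t), ż(t)) ∈ E(t, x(t), s)` for a.e. `t ∈ [t₀, T]`. -/
def CH {α T : ℝ} {n : ℕ} (H : ℝ → Vec n → Vec n → ℝ) (cH : ℝ) (p : GAlpha α T n) (z₀ : ℝ)
    (s : Vec n) : Set (AC α T n × C(Icc (0 : ℝ) T, ℝ)) :=
  {xz | (∃ K : NNReal, LipschitzWith K xz.2) ∧
    (∀ τ ∈ Icc (0 : ℝ) p.1.t, ev xz.1.1 τ = ev p.1.w τ ∧ ev xz.2 τ = z₀) ∧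
    ∀ᵐ t ∂(volume.restrict (Icc p.1.t T)),
      (caputo α xz.1.1 t, deriv (ev xz.2) t) ∈ charSet H cH t (ev xz.1.1 t) s}

/-- Upper solution of `∂ₜ^α φ + H(t, w(t), ∇^α φ) = 0`, `φ(T, ·) = σ`. -/
structure IsUpperSolution {α T : ℝ} {n : ℕ} (hT : 0 < T) (H : ℝ → Vec n → Vec n → ℝ) (cH : ℝ)
    (σ : AC α T n → ℝ) (φ : GAlpha α T n → ℝ) : Prop where
  lsc : LowerSemicontinuous φ
  boundary : ∀ w : AC α T n, σ w ≤ φ (terminal hT w)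
  stable : ∀ p : GAlpha α T n, p.1.t < T → ∀ t (ht : t ∈ Icc (0 : ℝ) T), p.1.t < t →
    ∀ s : Vec n, ∀ ε > 0, ∃ xz ∈ CH H cH p 0 s, φ (hist xz.1 t ht) - ev xz.2 t ≤ φ p + ε

/-- Lower solution of `∂ₜ^α φ + H(t, w(t), ∇^α φ) = 0`, `φ(T, ·) = σ`. -/
structure IsLowerSolution {α T : ℝ} {n : ℕ} (hT : 0 < T) (H : ℝ → Vec n → Vec n → ℝ) (cH : ℝ)
    (σ : AC α T n → ℝ) (φ : GAlpha α T n → ℝ) : Prop where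
  usc : UpperSemicontinuous φ
  boundary : ∀ w : AC α T n, φ (terminal hT w) ≤ σ w
  stable : ∀ p : GAlpha α T n, p.1.t < T → ∀ t (ht : t ∈ Icc (0 : ℝ) T), p.1.t < t →
    ∀ s : Vec n, ∀ ε > 0, ∃ xz ∈ CH H cH p 0 s, φ p - ε ≤ φ (hist xz.1 t ht) - ev xz.2 t

/-- A minimax solution is both an upper and a lower solution. -/
def IsMinimaxSolution {α T : ℝ} {n : ℕ} (hT : 0 < T) (H : ℝ → Vec n → Vec n → ℝ) (cH : ℝ)
    (σ : AC α T n → ℝ) (φ : GAlpha α T n → ℝ) : Prop :=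
  IsUpperSolution hT H cH σ φ ∧ IsLowerSolution hT H cH σ φ

end FracHJ

end

/-! The proof has two halves: a comparison principle and Perron's method.

Comparison. Along a characteristic, `z` is the integral of `⟨s, ^C D^α x⟩ - H(τ, x, s)`, so both
stability properties can be phrased with trajectories `x` alone (`CH_spec`, `exists_mem_CH`). Given
an upper stable `φp` at `p` and a lower stable `φm` at `q`, a pair of trajectories `x`, `y` is built
over a fine partition of time. On each step the momentum `s = -(2/ε) e^{-Kt} ρ(t)` is frozen, where
`ρ` is the fractional integral of the difference `ψ` of the Caputo derivatives of `x` and `y` after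
their initial times. Up to small errors, `φm q - φp p` is then at most `σ y - σ x` plus `1/ε` times
the integral of `e^{-Kτ}(3λ‖ρ‖² - 2⟨ρ, ψ⟩)`.

For fractional order no chain rule for `‖ρ‖²` is at hand, so this integrand has no pointwise sign.
The substitute is `exists_weight_energy`: for large `K` the quadratic form `2∫ e^{-Kt}⟨I^α ψ, ψ⟩`
dominates `Λ∫ e^{-Kt}‖I^α ψ‖²`. It follows by writing the kernel `t^{α-1}` as a mixture of
exponentials, for each of which the energy identity is elementary. With `Λ = 4λ` the integral is at
most `-λJ`, where `J` is the weighted square norm of `ρ`. Either `λJ/ε` absorbs the oscillation of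
`σ`, or `J = O(ε)`; in that case `ρ`, being equi-Hölder, is uniformly small and `σ y - σ x` is small
by compactness of the set of prolongations.

The estimate (`comparison`) is uniform for `p`, `q` near a common point and uses no semicontinuity.
On the diagonal it gives uniqueness; applied to a functional that is both upper and lower stable it
gives continuity. Passing between nearby histories requires that the prolongation with zero Caputo
derivative depend continuously on the history in the Hausdorff-type metric (`exists_delta_free`);
this rests on a maximum principle obtained from an explicit Poisson formula.

Existence. `lowerEnvelope` is the infimum of all upper stable functionals with boundary value `σ`.
It is again upper stable, and by minimality it is lower stable: a failure of lower stability would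
allow it to be lowered (`lowStable_lowerEnvelope`). That two momenta always share a trajectory
(`exists_common_traj`) makes the class nonempty and keeps the lowered functional in it. -/

noncomputable section

namespace FracHJ

/-! ### Kernels -/

theorem intervalIntegrable_sub_rpow {β : ℝ} (hβ : 0 < β) (t a b : ℝ) :
    IntervalIntegrable (fun ξ => (t - ξ) ^ (β - 1)) volume a b := by
  have h := (intervalIntegral.intervalIntegrable_rpow' (a := t - a) (b := t - b)
    (r := β - 1) (by linarith)).comp_sub_left t
  simpa using h

theorem integral_sub_rpow {β : ℝ} (hβ : 0 < β) (t a b : ℝ) :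
    ∫ ξ in a..b, (t - ξ) ^ (β - 1) = ((t - a) ^ β - (t - b) ^ β) / β := by
  rw [intervalIntegral.integral_comp_sub_left (fun x => x ^ (β - 1)) t,
    integral_rpow (Or.inl (by linarith))]
  simp

theorem integral_beta {α : ℝ} (hα : α ∈ Ioo (0 : ℝ) 1) :
    ∫ v in Ioo (0 : ℝ) 1, v ^ (α - 1) * (1 - v) ^ (-α) = Real.Gamma α * Real.Gamma (1 - α) := by
  have h := ProbabilityTheory.beta_eq_betaIntegralReal α (1 - α) hα.1 (by linarith [hα.2])
  rw [ProbabilityTheory.beta] at h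
  simp only [add_sub_cancel, Real.Gamma_one, div_one] at h
  rw [h, Complex.betaIntegral, intervalIntegral.integral_of_le zero_le_one,
    integral_Ioc_eq_integral_Ioo]
  have key : ∀ v ∈ Ioo (0 : ℝ) 1, ((v : ℂ) ^ ((α : ℂ) - 1) * (1 - (v : ℂ)) ^
      (((1 - α : ℝ) : ℂ) - 1)) = ((v ^ (α - 1) * (1 - v) ^ (-α) : ℝ) : ℂ) := by
    intro v hv
    push_cast
    rw [Complex.ofReal_cpow hv.1.le, Complex.ofReal_cpow (by linarith [hv.2])]
    push_cast
    congr 2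
    ring
  rw [setIntegral_congr_fun measurableSet_Ioo key, integral_complex_ofReal, Complex.ofReal_re]

/-- The Möbius map `f`, which sends `a` to `0`, `b` to `1` and has its pole at `t`, turns the
integral into the beta integral. This identity is what makes the Poisson kernel explicit. -/
theorem integral_moebius {α : ℝ} (hα : α ∈ Ioo (0 : ℝ) 1) {a b t : ℝ} (hab : a < b)
    (hbt : b < t) :
    ∫ τ in Ioo a b, (b - τ) ^ (-α) * (t - τ)⁻¹ * (τ - a) ^ (α - 1) =
      Real.Gamma α * Real.Gamma (1 - α) * ((t - a) ^ (α - 1) * (t - b) ^ (-α)) := by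
  have hta : 0 < t - a := by linarith
  have htb : 0 < t - b := by linarith
  have hba : 0 < b - a := by linarith
  set f : ℝ → ℝ := fun τ => (τ - a) * (t - b) / ((b - a) * (t - τ)) with hf
  set f' : ℝ → ℝ := fun τ => (t - b) * (t - a) / ((b - a) * (t - τ) ^ 2) with hf'
  have h1mf : ∀ τ ∈ Ioo a b, 1 - f τ = (b - τ) * (t - a) / ((b - a) * (t - τ)) := by
    intro τ hτ
    have : t - τ ≠ 0 := by linarith [hτ.2]
    simp only [hf]
    field_simp
    ring
  have himg : f '' Ioo a b = Ioo 0 1 := by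
    ext v
    constructor
    · rintro ⟨τ, hτ, rfl⟩
      have h1 : 0 < t - τ := by linarith [hτ.2]
      have h2 : 0 < τ - a := by linarith [hτ.1]
      have h3 : 0 < b - τ := by linarith [hτ.2]
      constructor
      · simp only [hf]; positivity
      · have := h1mf τ hτ
        have h4 : 0 < (b - τ) * (t - a) / ((b - a) * (t - τ)) := by positivity
        linarith
    · rintro ⟨h0, h1⟩
      have hd : 0 < (t - b) + v * (b - a) := by positivity
      refine ⟨(a * (t - b) + v * (b - a) * t) / ((t - b) + v * (b - a)), ⟨?_, ?_⟩, ?_⟩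
      · rw [lt_div_iff₀ hd]; nlinarith [mul_pos h0 (mul_pos hba hta)]
      · rw [div_lt_iff₀ hd]; nlinarith [mul_pos hba htb, mul_pos (sub_pos.2 h1) (mul_pos hba htb)]
      · have e : t - (a * (t - b) + v * (b - a) * t) / ((t - b) + v * (b - a))
            = (t - a) * (t - b) / ((t - b) + v * (b - a)) := by
          field_simp; ring
        have e2 : (a * (t - b) + v * (b - a) * t) / ((t - b) + v * (b - a)) - a
            = v * (b - a) * (t - a) / ((t - b) + v * (b - a)) := by
          field_simp; ring
        simp only [hf]
        rw [e, e2]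
        field_simp
  have hder : ∀ τ ∈ Ioo a b, HasDerivWithinAt f (f' τ) (Ioo a b) τ := by
    intro τ hτ
    have hne : t - τ ≠ 0 := by linarith [hτ.2]
    have h1 : HasDerivAt (fun τ : ℝ => (τ - a) * (t - b)) (1 * (t - b)) τ :=
      ((hasDerivAt_id τ).sub_const a).mul_const (t - b)
    have h2 : HasDerivAt (fun τ : ℝ => (b - a) * (t - τ)) ((b - a) * (-1)) τ :=
      ((hasDerivAt_id τ).const_sub t).const_mul (b - a)
    have h3 := h1.div h2 (by positivity)
    refine (h3.congr_deriv ?_).hasDerivWithinAt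
    simp only [hf']
    field_simp
    ring
  have hinj : InjOn f (Ioo a b) := by
    intro x hx y hy hxy
    have hx' : t - x ≠ 0 := by linarith [hx.2]
    have hy' : t - y ≠ 0 := by linarith [hy.2]
    simp only [hf] at hxy
    rw [div_eq_div_iff (by positivity) (by positivity)] at hxy
    have : (x - y) * ((t - b) * (b - a) * (t - a)) = 0 := by linarith
    rcases mul_eq_zero.1 this with h | h
    · linarith
    · exact absurd h (by positivity)
  have h := integral_image_eq_integral_abs_deriv_smul measurableSet_Ioo hder hinj
    (fun v => v ^ (α - 1) * (1 - v) ^ (-α))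
  rw [himg, integral_beta hα] at h
  rw [h, ← integral_mul_const]
  refine setIntegral_congr_fun measurableSet_Ioo fun τ hτ => ?_
  have k1 : 0 < t - τ := by linarith [hτ.2]
  have k2 : 0 < τ - a := by linarith [hτ.1]
  have k3 : 0 < b - τ := by linarith [hτ.2]
  have hpos : 0 < f' τ := by simp only [hf']; positivity
  simp only [smul_eq_mul, abs_of_pos hpos, h1mf τ hτ]
  simp only [hf, hf']
  rw [Real.div_rpow (by positivity) (by positivity), Real.div_rpow (by positivity) (by positivity),
    Real.mul_rpow k2.le htb.le, Real.mul_rpow hba.le k1.le, Real.mul_rpow k3.le hta.le,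
    Real.mul_rpow hba.le k1.le]
  simp only [Real.rpow_neg htb.le, Real.rpow_neg hta.le, Real.rpow_neg hba.le, Real.rpow_neg k1.le,
    Real.rpow_neg k3.le, Real.rpow_sub_one htb.ne', Real.rpow_sub_one hta.ne',
    Real.rpow_sub_one hba.ne', Real.rpow_sub_one k1.ne', Real.rpow_sub_one k2.ne']
  have p1 := Real.rpow_pos_of_pos htb α
  have p2 := Real.rpow_pos_of_pos hta α
  have p3 := Real.rpow_pos_of_pos hba α
  have p4 := Real.rpow_pos_of_pos k1 α
  have p5 := Real.rpow_pos_of_pos k2 α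
  have p6 := Real.rpow_pos_of_pos k3 α
  field_simp

theorem integral_beta_interval {α : ℝ} (hα : α ∈ Ioo (0 : ℝ) 1) {a b : ℝ} (hab : a < b) :
    ∫ τ in Ioo a b, (b - τ) ^ (-α) * (τ - a) ^ (α - 1) = Real.Gamma α * Real.Gamma (1 - α) := by
  have hba : 0 < b - a := by linarith
  set f : ℝ → ℝ := fun τ => (τ - a) / (b - a) with hf
  have himg : f '' Ioo a b = Ioo 0 1 := by
    ext v
    constructor
    · rintro ⟨τ, hτ, rfl⟩
      refine ⟨div_pos (by linarith [hτ.1]) hba, (div_lt_one hba).2 (by linarith [hτ.2])⟩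
    · rintro ⟨h0, h1⟩
      refine ⟨a + v * (b - a), ⟨by nlinarith, by nlinarith⟩, ?_⟩
      simp only [hf]; field_simp; ring
  have hder : ∀ τ ∈ Ioo a b, HasDerivWithinAt f (1 / (b - a)) (Ioo a b) τ := fun τ hτ =>
    (((hasDerivAt_id τ).sub_const a).div_const (b - a)).hasDerivWithinAt
  have hinj : InjOn f (Ioo a b) := by
    intro x hx y hy hxy
    simp only [hf] at hxy
    rw [div_left_inj' hba.ne'] at hxy
    linarith
  have h := integral_image_eq_integral_abs_deriv_smul measurableSet_Ioo hder hinj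
    (fun v => v ^ (α - 1) * (1 - v) ^ (-α))
  rw [himg, integral_beta hα] at h
  rw [h]
  refine setIntegral_congr_fun measurableSet_Ioo fun τ hτ => ?_
  have k2 : 0 < τ - a := by linarith [hτ.1]
  have k3 : 0 < b - τ := by linarith [hτ.2]
  have e : 1 - f τ = (b - τ) / (b - a) := by simp only [hf]; field_simp; ring
  simp only [smul_eq_mul, abs_of_pos (one_div_pos.2 hba), e]
  simp only [hf]
  rw [Real.div_rpow k2.le hba.le, Real.div_rpow k3.le hba.le]
  simp only [Real.rpow_neg hba.le, Real.rpow_neg k3.le, 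
    Real.rpow_sub_one hba.ne', Real.rpow_sub_one k2.ne']
  have p3 := Real.rpow_pos_of_pos hba α
  have p5 := Real.rpow_pos_of_pos k2 α
  have p6 := Real.rpow_pos_of_pos k3 α
  field_simp

end FracHJ

end

/-! ### Fractional calculus: Hölder bounds, composition, Poisson formula. -/

noncomputable section

namespace FracHJ

/-! ### Fractional integrals of bounded measurable functions -/

/-- A measurable function bounded by `C` everywhere. -/
structure IsControl {n : ℕ} (C : ℝ) (ψ : ℝ → Vec n) : Prop where
  measurable : Measurable ψ
  norm_le : ∀ t, ‖ψ t‖ ≤ C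

variable {n : ℕ} {α β C : ℝ} {ψ ψ' : ℝ → Vec n}

theorem IsControl.nonneg (h : IsControl C ψ) : 0 ≤ C := (norm_nonneg _).trans (h.norm_le 0)

theorem IsControl.indicator (h : IsControl C ψ) {s : Set ℝ} (hs : MeasurableSet s) :
    IsControl C (s.indicator ψ) :=
  ⟨h.measurable.indicator hs, fun t => (norm_indicator_le_norm_self ψ t).trans (h.norm_le t)⟩

theorem IsControl.sub {C' : ℝ} (h : IsControl C ψ) (h' : IsControl C' ψ') :
    IsControl (C + C') (fun t => ψ t - ψ' t) :=
  ⟨h.measurable.sub h'.measurable,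
    fun t => (norm_sub_le _ _).trans (add_le_add (h.norm_le t) (h'.norm_le t))⟩

theorem IsControl.add {C' : ℝ} (h : IsControl C ψ) (h' : IsControl C' ψ') :
    IsControl (C + C') (fun t => ψ t + ψ' t) :=
  ⟨h.measurable.add h'.measurable,
    fun t => (norm_add_le _ _).trans (add_le_add (h.norm_le t) (h'.norm_le t))⟩

theorem IsControl.intervalIntegrable (h : IsControl C ψ) (a b : ℝ) :
    IntervalIntegrable ψ volume a b := by
  refine (intervalIntegrable_const (c := C)).mono_fun h.measurable.aestronglyMeasurable ?_
  filter_upwards with t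
  rw [Real.norm_of_nonneg h.nonneg]
  exact h.norm_le t

theorem IsControl.intervalIntegrable_kernel (h : IsControl C ψ) (hβ : 0 < β) (t a b : ℝ) :
    IntervalIntegrable (fun ξ => ((t - ξ) ^ (β - 1)) • ψ ξ) volume a b := by
  refine ((intervalIntegrable_sub_rpow hβ t a b).norm.mul_const C).mono_fun ?_ ?_
  · exact (Measurable.smul (f := fun ξ : ℝ => (t - ξ) ^ (β - 1)) (by fun_prop) h.measurable).aestronglyMeasurable
  · filter_upwards with ξ
    rw [norm_smul, norm_mul, norm_norm, Real.norm_of_nonneg h.nonneg]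
    gcongr
    exact h.norm_le ξ

theorem rlIntegral_zero_right : rlIntegral β ψ 0 = 0 := by simp [rlIntegral]

theorem rlIntegral_congr_ae {t : ℝ} (ht : 0 ≤ t) (h : ∀ᵐ ξ, ξ ∈ Ioc 0 t → ψ ξ = ψ' ξ) :
    rlIntegral β ψ t = rlIntegral β ψ' t := by
  unfold rlIntegral
  congr 1
  refine intervalIntegral.integral_congr_ae ?_
  filter_upwards [h] with ξ hξ h'
  rw [uIoc_of_le ht] at h'
  rw [hξ h']

theorem rlIntegral_sub {C' : ℝ} (h : IsControl C ψ) (h' : IsControl C' ψ') (hβ : 0 < β) (t : ℝ) :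
    rlIntegral β (fun ξ => ψ ξ - ψ' ξ) t = rlIntegral β ψ t - rlIntegral β ψ' t := by
  unfold rlIntegral
  simp only [smul_sub]
  rw [intervalIntegral.integral_sub (h.intervalIntegrable_kernel hβ t 0 t)
    (h'.intervalIntegrable_kernel hβ t 0 t), smul_sub]

theorem rlIntegral_add {C' : ℝ} (h : IsControl C ψ) (h' : IsControl C' ψ') (hβ : 0 < β) (t : ℝ) :
    rlIntegral β (fun ξ => ψ ξ + ψ' ξ) t = rlIntegral β ψ t + rlIntegral β ψ' t := by
  unfold rlIntegral
  simp only [smul_add]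
  rw [intervalIntegral.integral_add (h.intervalIntegrable_kernel hβ t 0 t)
    (h'.intervalIntegrable_kernel hβ t 0 t), smul_add]

/-- The kernel integrates to `((t - a)^β - (t - b)^β) / β`, and subadditivity of the power `β ≤ 1`
removes the dependence on `t`. -/
theorem norm_integral_kernel_le (h : IsControl C ψ) (hβ : β ∈ Ioc (0 : ℝ) 1) {t a b : ℝ}
    (hab : a ≤ b) (hbt : b ≤ t) :
    ‖∫ ξ in a..b, ((t - ξ) ^ (β - 1)) • ψ ξ‖ ≤ C * ((b - a) ^ β / β) := by
  have h1 : ‖∫ ξ in a..b, ((t - ξ) ^ (β - 1)) • ψ ξ‖ ≤ ∫ ξ in a..b, C * (t - ξ) ^ (β - 1) := by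
    refine intervalIntegral.norm_integral_le_of_norm_le hab ?_
      ((intervalIntegrable_sub_rpow hβ.1 t a b).const_mul C)
    filter_upwards with ξ hξ
    have : 0 ≤ (t - ξ) ^ (β - 1) := Real.rpow_nonneg (by linarith [hξ.2]) _
    rw [norm_smul, Real.norm_of_nonneg this, mul_comm]
    gcongr
    exact h.norm_le ξ
  refine h1.trans ?_
  rw [intervalIntegral.integral_const_mul, integral_sub_rpow hβ.1]
  have h2 := Real.rpow_add_le_add_rpow (sub_nonneg.2 hab) (sub_nonneg.2 hbt) hβ.1.le hβ.2
  have h3 : b - a + (t - b) = t - a := by ring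
  rw [h3] at h2
  have := h.nonneg
  have := hβ.1
  gcongr
  linarith

theorem norm_rlIntegral_le (h : IsControl C ψ) (hβ : β ∈ Ioc (0 : ℝ) 1) {t : ℝ} (ht : 0 ≤ t) :
    ‖rlIntegral β ψ t‖ ≤ C * t ^ β / Real.Gamma (β + 1) := by
  have hΓ := Real.Gamma_pos_of_pos hβ.1
  have hb := hβ.1
  rw [rlIntegral, norm_smul, Real.Gamma_add_one hb.ne', Real.norm_of_nonneg (by positivity)]
  have := norm_integral_kernel_le h hβ ht le_rfl
  rw [sub_zero] at this
  calc _ ≤ 1 / Real.Gamma β * (C * (t ^ β / β)) := by gcongr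
    _ = _ := by field_simp

/-- Estimate of the fractional integral of a function that vanishes outside `(a, b]`. -/
theorem norm_rlIntegral_le_of_support (h : IsControl C ψ) (hβ : β ∈ Ioc (0 : ℝ) 1) {t a b : ℝ}
    (ht : 0 ≤ t) (ha : 0 ≤ a) (hab : a ≤ b)
    (hψ : ∀ᵐ ξ, ξ ∈ Ioc 0 t → ξ ∉ Ioc a b → ψ ξ = 0) :
    ‖rlIntegral β ψ t‖ ≤ C * (b - a) ^ β / Real.Gamma (β + 1) := by
  have hΓ := Real.Gamma_pos_of_pos hβ.1
  have hb := hβ.1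
  have hC := h.nonneg
  have hba : 0 ≤ b - a := by linarith
  have key : ‖∫ ξ in (0 : ℝ)..t, ((t - ξ) ^ (β - 1)) • ψ ξ‖ ≤ C * ((b - a) ^ β / β) := by
    rcases le_total t a with hta | hat
    · rw [intervalIntegral.integral_zero_ae]
      · simpa using by positivity
      · filter_upwards [hψ] with ξ hξ h'
        rw [uIoc_of_le ht] at h'
        rw [hξ h' fun h'' => absurd h''.1 (not_lt.2 (h'.2.trans hta)), smul_zero]
    · have hm : a ≤ min t b := le_min hat hab
      rw [← intervalIntegral.integral_add_adjacent_intervals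
        (h.intervalIntegrable_kernel hβ.1 t 0 a) (h.intervalIntegrable_kernel hβ.1 t a t),
        ← intervalIntegral.integral_add_adjacent_intervals
        (h.intervalIntegrable_kernel hβ.1 t a (min t b))
        (h.intervalIntegrable_kernel hβ.1 t (min t b) t)]
      rw [intervalIntegral.integral_zero_ae (a := 0), intervalIntegral.integral_zero_ae (b := t),
        zero_add, add_zero]
      · refine (norm_integral_kernel_le h hβ hm (min_le_left _ _)).trans ?_
        gcongr
        exact min_le_right _ _
      · filter_upwards [hψ] with ξ hξ h'
        rw [uIoc_of_le (min_le_left _ _)] at h'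
        rw [hξ ⟨by linarith [h'.1], h'.2⟩, smul_zero]
        rintro ⟨_, h3⟩
        exact absurd (le_min h'.2 h3) (not_le.2 h'.1)
      · filter_upwards [hψ] with ξ hξ h'
        rw [uIoc_of_le ha] at h'
        rw [hξ ⟨h'.1, h'.2.trans hat⟩ fun h'' => absurd h''.1 (not_lt.2 h'.2), smul_zero]
  rw [rlIntegral, norm_smul, Real.Gamma_add_one hb.ne', Real.norm_of_nonneg (by positivity)]
  calc _ ≤ 1 / Real.Gamma β * (C * ((b - a) ^ β / β)) := by gcongr
    _ = _ := by field_simp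

/-- The increment splits into the new piece over `[s, t]` and the change of kernel on `[0, s]`. The
kernel decreases in time, so the second piece integrates exactly and is bounded by the same quantity
as the first; hence the factor 2. -/
theorem norm_rlIntegral_sub_le_of_le (h : IsControl C ψ) (hβ : β ∈ Ioc (0 : ℝ) 1) {s t : ℝ}
    (hs : 0 ≤ s) (hst : s ≤ t) :
    ‖rlIntegral β ψ t - rlIntegral β ψ s‖ ≤ 2 * C / Real.Gamma (β + 1) * (t - s) ^ β := by
  have hΓ := Real.Gamma_pos_of_pos hβ.1
  have hb := hβ.1
  have hC := h.nonneg
  have e : rlIntegral β ψ t - rlIntegral β ψ s = (1 / Real.Gamma β) •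
      ((∫ ξ in s..t, ((t - ξ) ^ (β - 1)) • ψ ξ) +
        ∫ ξ in (0 : ℝ)..s, ((t - ξ) ^ (β - 1) - (s - ξ) ^ (β - 1)) • ψ ξ) := by
    simp only [sub_smul]
    rw [intervalIntegral.integral_sub (h.intervalIntegrable_kernel hβ.1 t 0 s)
      (h.intervalIntegrable_kernel hβ.1 s 0 s), rlIntegral, rlIntegral,
      ← intervalIntegral.integral_add_adjacent_intervals
        (h.intervalIntegrable_kernel hβ.1 t 0 s) (h.intervalIntegrable_kernel hβ.1 t s t),
      ← smul_sub]
    congr 1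
    abel
  have h1 := norm_integral_kernel_le h hβ hst (le_refl t)
  have h2 : ‖∫ ξ in (0 : ℝ)..s, ((t - ξ) ^ (β - 1) - (s - ξ) ^ (β - 1)) • ψ ξ‖ ≤
      C * ((t - s) ^ β / β) := by
    have hintegral := (intervalIntegrable_sub_rpow hβ.1 s 0 s).sub
      (intervalIntegrable_sub_rpow hβ.1 t 0 s)
    refine (intervalIntegral.norm_integral_le_of_norm_le hs ?_ (hintegral.const_mul C)).trans ?_
    · have : ∀ᵐ ξ : ℝ, ξ ≠ s := by simp [ae_iff, measure_singleton]
      filter_upwards [this] with ξ hne hξ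
      have hlt : 0 < s - ξ := sub_pos.2 (lt_of_le_of_ne hξ.2 hne)
      have : (t - ξ) ^ (β - 1) ≤ (s - ξ) ^ (β - 1) :=
        Real.rpow_le_rpow_of_nonpos hlt (by linarith) (by linarith [hβ.2])
      rw [norm_smul, norm_sub_rev, Real.norm_of_nonneg (by linarith), mul_comm]
      have h3 : 0 ≤ (s - ξ) ^ (β - 1) - (t - ξ) ^ (β - 1) := by linarith
      gcongr
      exact h.norm_le ξ
    · rw [intervalIntegral.integral_const_mul, intervalIntegral.integral_sub
        (intervalIntegrable_sub_rpow hβ.1 s 0 s) (intervalIntegrable_sub_rpow hβ.1 t 0 s),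
        integral_sub_rpow hβ.1, integral_sub_rpow hβ.1, sub_self, Real.zero_rpow hb.ne',
        ← sub_div]
      gcongr
      have : s ^ β ≤ t ^ β := by gcongr
      simp only [sub_zero]
      linarith
  rw [e, norm_smul, Real.Gamma_add_one hb.ne', Real.norm_of_nonneg (by positivity)]
  calc _ ≤ 1 / Real.Gamma β * (C * ((t - s) ^ β / β) + C * ((t - s) ^ β / β)) := by
        gcongr
        exact (norm_add_le _ _).trans (add_le_add h1 h2)
    _ = _ := by field_simp; ring

theorem norm_rlIntegral_sub_le (h : IsControl C ψ) (hβ : β ∈ Ioc (0 : ℝ) 1) {s t : ℝ}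
    (hs : 0 ≤ s) (ht : 0 ≤ t) :
    ‖rlIntegral β ψ t - rlIntegral β ψ s‖ ≤ 2 * C / Real.Gamma (β + 1) * |t - s| ^ β := by
  rcases le_total s t with hst | hst
  · rw [abs_of_nonneg (sub_nonneg.2 hst)]
    exact norm_rlIntegral_sub_le_of_le h hβ hs hst
  · rw [abs_sub_comm, abs_of_nonneg (sub_nonneg.2 hst), norm_sub_rev]
    exact norm_rlIntegral_sub_le_of_le h hβ ht hst

theorem continuousOn_rlIntegral (h : IsControl C ψ) (hβ : β ∈ Ioc (0 : ℝ) 1) :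
    ContinuousOn (rlIntegral β ψ) (Ici 0) := by
  intro s hs
  rw [ContinuousWithinAt, tendsto_iff_norm_sub_tendsto_zero]
  refine squeeze_zero' (Filter.Eventually.of_forall fun _ => norm_nonneg _)
    (g := fun t => 2 * C / Real.Gamma (β + 1) * |t - s| ^ β) ?_ ?_
  · filter_upwards [self_mem_nhdsWithin] with t ht
    exact norm_rlIntegral_sub_le h hβ hs ht
  · have : Continuous fun t : ℝ => 2 * C / Real.Gamma (β + 1) * |t - s| ^ β :=
      continuous_const.mul ((continuous_abs.comp (continuous_id.sub continuous_const)).rpow_const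
        fun _ => Or.inr hβ.1.le)
    have h2 := (this.tendsto s).mono_left (nhdsWithin_le_nhds (s := Ici 0))
    simpa [Real.zero_rpow hβ.1.ne'] using h2

/-! ### Composition of fractional integrals -/

/-- The extra weight `q` lets one application of Fubini serve twice: `q = 1` gives the composition
rule, `q τ = (t - τ)⁻¹` the Poisson formula. -/
theorem fubini_triangle (h : IsControl C ψ) (hα : α ∈ Ioo (0 : ℝ) 1) {b Q : ℝ} {q : ℝ → ℝ}
    (hq : Measurable q) (hQ : ∀ τ ∈ Ioo 0 b, |q τ| ≤ Q) :
    ∫ τ in Ioo 0 b, ((b - τ) ^ (-α) * q τ) • ∫ ξ in Ioo 0 τ, ((τ - ξ) ^ (α - 1)) • ψ ξ =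
      ∫ ξ in Ioo 0 b, (∫ τ in Ioo ξ b, (b - τ) ^ (-α) * q τ * (τ - ξ) ^ (α - 1)) • ψ ξ := by
  rcases le_or_gt b 0 with hb | hb
  · simp [Ioo_eq_empty (not_lt.2 hb)]
  have hQ0 : 0 ≤ Q := (abs_nonneg _).trans (hQ (b / 2) ⟨by linarith, by linarith⟩)
  have hC := h.nonneg
  have ha := hα.1
  set F : ℝ × ℝ → Vec n := {x : ℝ × ℝ | x.2 < x.1}.indicator
    fun x => ((b - x.1) ^ (-α) * q x.1 * (x.1 - x.2) ^ (α - 1)) • ψ x.2 with hF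
  have hFm : Measurable F := by
    refine Measurable.indicator ?_ (measurableSet_lt measurable_snd measurable_fst)
    have : Measurable fun x : ℝ × ℝ => q x.1 := hq.comp measurable_fst
    exact Measurable.smul (f := fun x : ℝ × ℝ => (b - x.1) ^ (-α) * q x.1 * (x.1 - x.2) ^ (α - 1))
      (by fun_prop) (h.measurable.comp measurable_snd)
  have hslice : ∀ τ, (fun ξ => F (τ, ξ)) = (Iio τ).indicator
      fun ξ => ((b - τ) ^ (-α) * q τ) • (((τ - ξ) ^ (α - 1)) • ψ ξ) := by
    intro τ
    ext1 ξ
    simp only [hF, indicator, mem_ofPred_eq, mem_Iio, smul_smul]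
  have hset : ∀ τ ∈ Ioo 0 b, Ioo 0 b ∩ Iio τ = Ioo 0 τ := by
    intro τ hτ
    rw [Ioo_inter_Iio, min_eq_right hτ.2.le]
  have hker : ∀ τ, IntegrableOn (fun ξ => ((τ - ξ) ^ (α - 1)) • ψ ξ) (Ioo 0 τ) := fun τ =>
    (h.intervalIntegrable_kernel ha τ 0 τ).1.mono_set Ioo_subset_Ioc_self
  have hintegral : Integrable F ((volume.restrict (Ioo 0 b)).prod (volume.restrict (Ioo 0 b))) := by
    rw [integrable_prod_iff hFm.aestronglyMeasurable]
    constructor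
    · refine ae_restrict_of_forall_mem measurableSet_Ioo fun τ hτ => ?_
      rw [hslice, ← IntegrableOn, integrableOn_indicator_iff measurableSet_Iio, inter_comm,
        hset τ hτ]
      exact (hker τ).smul ((b - τ) ^ (-α) * q τ)
    · have hb1 : IntegrableOn (fun τ => (b - τ) ^ (-α) * (Q * (C * (b ^ α / α)))) (Ioo 0 b) := by
        have := (intervalIntegrable_sub_rpow (β := 1 - α) (by linarith [hα.2]) b 0 b).1.mono_set
          Ioo_subset_Ioc_self
        simp only [sub_sub_cancel_left] at this
        exact this.mul_const _
      refine Integrable.mono' hb1 ?_ ?_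
      · exact hFm.norm.aestronglyMeasurable.integral_prod_right'
      · refine ae_restrict_of_forall_mem measurableSet_Ioo fun τ hτ => ?_
        have e1 : ∀ ξ, ‖F (τ, ξ)‖ = (Iio τ).indicator (fun ξ => ‖(b - τ) ^ (-α) * q τ‖ *
            ‖((τ - ξ) ^ (α - 1)) • ψ ξ‖) ξ := by
          intro ξ
          have := congrFun (hslice τ) ξ
          rw [this, norm_indicator_eq_indicator_norm]
          simp only [norm_smul _ (_ • _)]
        rw [Real.norm_of_nonneg (by positivity)]
        simp only [e1]
        rw [setIntegral_indicator measurableSet_Iio, hset τ hτ, integral_const_mul, norm_mul,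
          Real.norm_of_nonneg (Real.rpow_nonneg (by linarith [hτ.2]) _), mul_assoc]
        have hk : ∫ ξ in Ioo 0 τ, ‖((τ - ξ) ^ (α - 1)) • ψ ξ‖ ≤ C * (b ^ α / α) := by
          calc ∫ ξ in Ioo 0 τ, ‖((τ - ξ) ^ (α - 1)) • ψ ξ‖
              ≤ ∫ ξ in Ioo 0 τ, C * (τ - ξ) ^ (α - 1) := by
                refine setIntegral_mono_on (hker τ).norm
                  (((intervalIntegrable_sub_rpow ha τ 0 τ).1.mono_set
                    Ioo_subset_Ioc_self).const_mul C) measurableSet_Ioo fun ξ hξ => ?_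
                rw [norm_smul, Real.norm_of_nonneg (Real.rpow_nonneg (by linarith [hξ.2]) _),
                  mul_comm]
                have : 0 ≤ (τ - ξ) ^ (α - 1) := Real.rpow_nonneg (by linarith [hξ.2]) _
                gcongr
                exact h.norm_le ξ
            _ = C * (τ ^ α / α) := by
                rw [integral_const_mul, ← integral_Ioc_eq_integral_Ioo,
                  ← intervalIntegral.integral_of_le hτ.1.le, integral_sub_rpow ha, sub_self,
                  Real.zero_rpow ha.ne', sub_zero, sub_zero]
            _ ≤ _ := by
                have := hτ.1.le
                have := hτ.2.le
                gcongr
        have hbτ : 0 ≤ (b - τ) ^ (-α) := Real.rpow_nonneg (by linarith [hτ.2]) _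
        have hq' : ‖q τ‖ ≤ Q := hQ τ hτ
        gcongr
  have hsw := integral_integral_swap (f := fun τ ξ => F (τ, ξ)) hintegral
  have hL : ∫ τ in Ioo 0 b, ∫ ξ in Ioo 0 b, F (τ, ξ) =
      ∫ τ in Ioo 0 b, ((b - τ) ^ (-α) * q τ) • ∫ ξ in Ioo 0 τ, ((τ - ξ) ^ (α - 1)) • ψ ξ := by
    refine setIntegral_congr_fun measurableSet_Ioo fun τ hτ => ?_
    have : ∫ ξ in Ioo 0 b, F (τ, ξ) = ∫ ξ in Ioo 0 b, (fun ξ => F (τ, ξ)) ξ := rfl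
    rw [this, hslice, setIntegral_indicator measurableSet_Iio, hset τ hτ, integral_smul]
  have hR : ∫ ξ in Ioo 0 b, ∫ τ in Ioo 0 b, F (τ, ξ) =
      ∫ ξ in Ioo 0 b, (∫ τ in Ioo ξ b, (b - τ) ^ (-α) * q τ * (τ - ξ) ^ (α - 1)) • ψ ξ := by
    refine setIntegral_congr_fun measurableSet_Ioo fun ξ hξ => ?_
    have e : (fun τ => F (τ, ξ)) = (Ioi ξ).indicator
        fun τ => ((b - τ) ^ (-α) * q τ * (τ - ξ) ^ (α - 1)) • ψ ξ := by
      ext1 τ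
      simp only [hF, indicator, mem_ofPred_eq, mem_Ioi]
    have : ∫ τ in Ioo 0 b, F (τ, ξ) = ∫ τ in Ioo 0 b, (fun τ => F (τ, ξ)) τ := rfl
    rw [this, e, setIntegral_indicator measurableSet_Ioi, Ioo_inter_Ioi, max_eq_right hξ.1.le,
      integral_smul_const]
  rw [← hL, ← hR, hsw]

theorem rlIntegral_eq_Ioo {τ : ℝ} (hτ : 0 ≤ τ) :
    rlIntegral β ψ τ = (1 / Real.Gamma β) • ∫ ξ in Ioo 0 τ, ((τ - ξ) ^ (β - 1)) • ψ ξ := by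
  rw [rlIntegral, intervalIntegral.integral_of_le hτ, integral_Ioc_eq_integral_Ioo]

theorem integral_rlIntegral (h : IsControl C ψ) (hα : α ∈ Ioo (0 : ℝ) 1) {b Q : ℝ} {q : ℝ → ℝ}
    (hq : Measurable q) (hQ : ∀ τ ∈ Ioo 0 b, |q τ| ≤ Q) :
    ∫ τ in Ioo 0 b, ((b - τ) ^ (-α) * q τ) • rlIntegral α ψ τ = (1 / Real.Gamma α) •
      ∫ ξ in Ioo 0 b, (∫ τ in Ioo ξ b, (b - τ) ^ (-α) * q τ * (τ - ξ) ^ (α - 1)) • ψ ξ := by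
  rw [← fubini_triangle h hα hq hQ, ← integral_smul]
  refine setIntegral_congr_fun measurableSet_Ioo fun τ hτ => ?_
  rw [rlIntegral_eq_Ioo hτ.1.le, smul_comm]

/-- After Fubini the inner integral is the beta integral, which cancels the two Gamma factors. This
is how the Caputo derivative recovers `ψ` from `I^α ψ`. -/
theorem rlIntegral_rlIntegral (h : IsControl C ψ) (hα : α ∈ Ioo (0 : ℝ) 1) {b : ℝ} (hb : 0 ≤ b) :
    rlIntegral (1 - α) (rlIntegral α ψ) b = ∫ ξ in (0 : ℝ)..b, ψ ξ := by
  have hΓ := (Real.Gamma_pos_of_pos hα.1).ne'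
  have hΓ' := (Real.Gamma_pos_of_pos (sub_pos.2 hα.2)).ne'
  have h1 := integral_rlIntegral h hα (b := b) (q := fun _ => 1) measurable_const
    (Q := 1) (by simp)
  simp only [mul_one] at h1
  rw [rlIntegral_eq_Ioo hb]
  simp only [sub_sub_cancel_left]
  rw [h1, intervalIntegral.integral_of_le hb, integral_Ioc_eq_integral_Ioo, smul_smul,
    ← integral_smul]
  refine setIntegral_congr_fun measurableSet_Ioo fun ξ hξ => ?_
  rw [integral_beta_interval hα hξ.2, smul_smul]
  convert one_smul ℝ _
  field_simp

/-! ### The Poisson formula and the maximum principle -/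

/-- The kernel that expresses a function with zero Caputo derivative on `(b, ∞)` at the point
`t > b` through its values on `(0, b)`. -/
def poissonKernel (α b t τ : ℝ) : ℝ :=
  (t - b) ^ α / (Real.Gamma α * Real.Gamma (1 - α)) * ((b - τ) ^ (-α) * (t - τ)⁻¹)

theorem poissonKernel_nonneg (hα : α ∈ Ioo (0 : ℝ) 1) {b t τ : ℝ} (hbt : b < t) (hτ : τ < b) :
    0 ≤ poissonKernel α b t τ := by
  have hΓ := Real.Gamma_pos_of_pos hα.1
  have hΓ' := Real.Gamma_pos_of_pos (sub_pos.2 hα.2)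
  have : 0 < t - b := by linarith
  have : 0 < t - τ := by linarith
  have : 0 < b - τ := by linarith
  unfold poissonKernel
  positivity

theorem inv_sub_le {b t τ : ℝ} (hbt : b < t) (hτ : τ < b) : |(t - τ)⁻¹| ≤ (t - b)⁻¹ := by
  have : 0 < t - b := by linarith
  rw [abs_of_nonneg (inv_nonneg.2 (by linarith))]
  gcongr

theorem integrableOn_poissonKernel (hα : α ∈ Ioo (0 : ℝ) 1) {b t : ℝ} (hbt : b < t) :
    IntegrableOn (poissonKernel α b t) (Ioo 0 b) := by
  have h1 := (intervalIntegrable_sub_rpow (β := 1 - α) (by linarith [hα.2]) b 0 b).1.mono_set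
    Ioo_subset_Ioc_self
  simp only [sub_sub_cancel_left] at h1
  refine Integrable.const_mul ?_ _
  refine Integrable.mono' (h1.norm.mul_const (t - b)⁻¹) (by fun_prop) ?_
  refine ae_restrict_of_forall_mem measurableSet_Ioo fun τ hτ => ?_
  rw [norm_mul]
  gcongr
  exact inv_sub_le hbt hτ.2

/-- By `integral_moebius`, for each `ξ < b` the kernel `(t - ξ)^(α - 1)` is the average of `(τ -
ξ)^(α - 1)` against the Poisson kernel; integrating against `ψ` gives the formula. -/
theorem rlIntegral_eq_poisson (h : IsControl C ψ) (hα : α ∈ Ioo (0 : ℝ) 1) {b t : ℝ} (hb : 0 ≤ b)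
    (hbt : b < t) (hψ : ∀ ξ ∈ Ioc b t, ψ ξ = 0) :
    rlIntegral α ψ t = ∫ τ in Ioo 0 b, poissonKernel α b t τ • rlIntegral α ψ τ := by
  have hΓ := (Real.Gamma_pos_of_pos hα.1).ne'
  have hΓ' := (Real.Gamma_pos_of_pos (sub_pos.2 hα.2)).ne'
  have htb : 0 < t - b := by linarith
  have hp := Real.rpow_pos_of_pos htb α
  have h1 := integral_rlIntegral h hα (b := b) (q := fun τ => (t - τ)⁻¹) (by fun_prop)
    (Q := (t - b)⁻¹) fun τ hτ => inv_sub_le hbt hτ.2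
  simp only [poissonKernel, mul_smul _ (_ * _)]
  rw [integral_smul, h1, smul_comm, ← integral_smul, rlIntegral,
    ← intervalIntegral.integral_add_adjacent_intervals
      (h.intervalIntegrable_kernel hα.1 t 0 b) (h.intervalIntegrable_kernel hα.1 t b t),
    intervalIntegral.integral_zero_ae (a := b), add_zero, intervalIntegral.integral_of_le hb,
    integral_Ioc_eq_integral_Ioo]
  · congr 1
    refine setIntegral_congr_fun measurableSet_Ioo fun ξ hξ => ?_
    rw [integral_moebius hα hξ.2 hbt, smul_smul, Real.rpow_neg htb.le]
    congr 1
    field_simp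
  · filter_upwards with ξ hξ
    rw [uIoc_of_le hbt.le] at hξ
    rw [hψ ξ hξ, smul_zero]

/-- The kernel reproduces `τ^(α - 1)` exactly. Since this power decreases, the mass times `b^(α -
1)` is at most `t^(α - 1) ≤ b^(α - 1)`. -/
theorem integral_poissonKernel_le_one (hα : α ∈ Ioo (0 : ℝ) 1) {b t : ℝ} (hb : 0 < b)
    (hbt : b < t) : ∫ τ in Ioo 0 b, poissonKernel α b t τ ≤ 1 := by
  have hΓ := Real.Gamma_pos_of_pos hα.1
  have hΓ' := Real.Gamma_pos_of_pos (sub_pos.2 hα.2)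
  have htb : 0 < t - b := by linarith
  have ht : 0 < t := by linarith
  have hp := Real.rpow_pos_of_pos htb α
  have h1 := integral_moebius hα hb hbt
  simp only [sub_zero] at h1
  have hpos : 0 < Real.Gamma α * Real.Gamma (1 - α) * (t ^ (α - 1) * (t - b) ^ (-α)) := by
    positivity
  -- A non-integrable function has integral `0` by convention, so the positive value just computed
  -- proves integrability.
  have hintegral : IntegrableOn (fun τ => (b - τ) ^ (-α) * (t - τ)⁻¹ * τ ^ (α - 1)) (Ioo 0 b) := by
    by_contra hc
    rw [integral_undef hc] at h1
    exact hpos.ne h1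
  have h2 : (∫ τ in Ioo 0 b, poissonKernel α b t τ) * b ^ (α - 1) ≤ t ^ (α - 1) := by
    rw [← integral_mul_const]
    calc ∫ τ in Ioo 0 b, poissonKernel α b t τ * b ^ (α - 1)
        ≤ ∫ τ in Ioo 0 b, (t - b) ^ α / (Real.Gamma α * Real.Gamma (1 - α)) *
            ((b - τ) ^ (-α) * (t - τ)⁻¹ * τ ^ (α - 1)) := by
          refine setIntegral_mono_on ((integrableOn_poissonKernel hα hbt).mul_const _)
            (hintegral.const_mul _) measurableSet_Ioo fun τ hτ => ?_
          have h3 : b ^ (α - 1) ≤ τ ^ (α - 1) :=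
            Real.rpow_le_rpow_of_nonpos hτ.1 hτ.2.le (by linarith [hα.2])
          have := mul_le_mul_of_nonneg_left h3 (poissonKernel_nonneg hα hbt hτ.2)
          refine this.trans (le_of_eq ?_)
          simp only [poissonKernel]; ring
      _ = t ^ (α - 1) := by
          rw [integral_const_mul, h1, Real.rpow_neg htb.le]
          field_simp
  have h3 : t ^ (α - 1) ≤ b ^ (α - 1) :=
    Real.rpow_le_rpow_of_nonpos hb hbt.le (by linarith [hα.2])
  have hbp := Real.rpow_pos_of_pos hb (α - 1)
  have h4 := h2.trans h3
  nlinarith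

/-- Maximum principle: a function with zero Caputo derivative after `b` does not exceed in norm its
values on `[0, b]`. -/
theorem norm_le_of_control_eq_zero (h : IsControl C ψ) (hα : α ∈ Ioo (0 : ℝ) 1) {b T M : ℝ}
    (hb : 0 ≤ b) (hψ : ∀ ξ ∈ Ioc b T, ψ ξ = 0) (v : Vec n)
    (hM : ∀ τ ∈ Icc 0 b, ‖v + rlIntegral α ψ τ‖ ≤ M) {t : ℝ} (ht : t ∈ Icc 0 T) :
    ‖v + rlIntegral α ψ t‖ ≤ M := by
  rcases le_or_gt t b with htb | hbt
  · exact hM t ⟨ht.1, htb⟩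
  have hv : ‖v‖ ≤ M := by
    have := hM 0 ⟨le_rfl, hb⟩
    rwa [rlIntegral_zero_right, add_zero] at this
  have hP := rlIntegral_eq_poisson h hα hb hbt fun ξ hξ => hψ ξ ⟨hξ.1, hξ.2.trans ht.2⟩
  rcases hb.eq_or_lt with rfl | hb0
  · rw [hP]
    simpa using hv
  set m := ∫ τ in Ioo 0 b, poissonKernel α b t τ with hm
  have hm1 : m ≤ 1 := integral_poissonKernel_le_one hα hb0 hbt
  have hi := integrableOn_poissonKernel hα hbt
  have hi2 : IntegrableOn (fun τ => poissonKernel α b t τ • rlIntegral α ψ τ) (Ioo 0 b) := by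
    refine Integrable.mono' (hi.norm.mul_const (M + ‖v‖)) ?_ ?_
    · refine hi.aestronglyMeasurable.smul ?_
      exact ((continuousOn_rlIntegral h ⟨hα.1, hα.2.le⟩).mono
        fun x hx => hx.1.le).aestronglyMeasurable measurableSet_Ioo
    · refine ae_restrict_of_forall_mem measurableSet_Ioo fun τ hτ => ?_
      rw [norm_smul]
      gcongr
      calc ‖rlIntegral α ψ τ‖ = ‖(v + rlIntegral α ψ τ) - v‖ := by simp
        _ ≤ _ := (norm_sub_le _ _).trans (by gcongr; exact hM τ ⟨hτ.1.le, hτ.2.le⟩)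
  -- The missing mass `1 - m ≥ 0` is put on `v`, the value at time `0`, so the value at `t` becomes
  -- a convex combination of earlier ones.
  have e : v + rlIntegral α ψ t =
      (1 - m) • v + ∫ τ in Ioo 0 b, poissonKernel α b t τ • (v + rlIntegral α ψ τ) := by
    simp only [smul_add]
    rw [integral_add (hi.smul_const v) hi2, integral_smul_const, ← hm, ← hP, sub_smul, one_smul]
    abel
  have h5 : ‖∫ τ in Ioo 0 b, poissonKernel α b t τ • (v + rlIntegral α ψ τ)‖ ≤ m * M := by
    rw [hm, ← integral_mul_const]
    refine norm_integral_le_of_norm_le (hi.mul_const M) ?_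
    refine ae_restrict_of_forall_mem measurableSet_Ioo fun τ hτ => ?_
    have h6 := poissonKernel_nonneg hα hbt hτ.2
    rw [norm_smul, Real.norm_of_nonneg h6]
    gcongr
    exact hM τ ⟨hτ.1.le, hτ.2.le⟩
  calc ‖v + rlIntegral α ψ t‖ ≤ (1 - m) * ‖v‖ + m * M := by
        rw [e]
        refine (norm_add_le _ _).trans (add_le_add ?_ h5)
        rw [norm_smul, Real.norm_of_nonneg (by linarith)]
    _ ≤ (1 - m) * M + m * M := by
        have : 0 ≤ 1 - m := by linarith
        gcongr
    _ = M := by ring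

end FracHJ

end

noncomputable section

namespace FracHJ

/-! ### Weighted positivity of the fractional integral -/

variable {n : ℕ} {α β C : ℝ} {ψ ψ' : ℝ → Vec n}

/-- Convolution of `ψ` with the exponential kernel `e^{-μ t}`. -/
def expConv (ψ : ℝ → Vec n) (μ t : ℝ) : Vec n :=
  ∫ τ in Ioc 0 t, Real.exp (-(μ * (t - τ))) • ψ τ

theorem IsControl.integrableOn_smul (h : IsControl C ψ) {g : ℝ → ℝ} (hg : Continuous g) (a b : ℝ) :
    IntegrableOn (fun τ => g τ • ψ τ) (Ioc a b) := by
  refine Integrable.mono' ((hg.norm.integrableOn_Ioc (μ := volume) (a := a) (b := b)).mul_const C)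
    ((hg.measurable.smul h.measurable).aestronglyMeasurable) ?_
  filter_upwards with τ
  rw [norm_smul]
  gcongr
  exact h.norm_le τ

/-- The factor `(1 + μ)⁻¹` combines boundedness for small `μ` with the decay `1/μ` for large `μ`; it
makes the mixture over `μ^(-α) dμ` absolutely convergent. -/
theorem norm_expConv_le (h : IsControl C ψ) {μ t T : ℝ} (hμ : 0 < μ) (ht : t ∈ Icc 0 T) :
    ‖expConv ψ μ t‖ ≤ C * (T + 1) * (1 + μ)⁻¹ := by
  have hC := h.nonneg
  have hcont : Continuous fun τ => Real.exp (-(μ * (t - τ))) := by fun_prop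
  have h1 : ‖expConv ψ μ t‖ ≤ C * ∫ τ in Ioc 0 t, Real.exp (-(μ * (t - τ))) := by
    rw [← integral_const_mul]
    refine norm_integral_le_of_norm_le (hcont.integrableOn_Ioc.const_mul C) ?_
    filter_upwards with τ
    rw [norm_smul, Real.norm_of_nonneg (Real.exp_pos _).le, mul_comm]
    gcongr
    exact h.norm_le τ
  have e : ∫ τ in Ioc 0 t, Real.exp (-(μ * (t - τ))) = (1 - Real.exp (-(μ * t))) / μ := by
    rw [← intervalIntegral.integral_of_le ht.1]
    have : ∀ τ ∈ uIcc 0 t, HasDerivAt (fun τ => Real.exp (-(μ * (t - τ))) / μ)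
        (Real.exp (-(μ * (t - τ)))) τ := by
      intro τ _
      have h2 : HasDerivAt (fun τ => -(μ * (t - τ))) (-(μ * (-1))) τ :=
        (((hasDerivAt_id τ).const_sub t).const_mul μ).neg
      refine (h2.exp.div_const μ).congr_deriv ?_
      field_simp
    rw [intervalIntegral.integral_eq_sub_of_hasDerivAt this (hcont.intervalIntegrable _ _)]
    simp [sub_div]
  rw [e] at h1
  have h3 : (1 - Real.exp (-(μ * t))) / μ ≤ (T + 1) * (1 + μ)⁻¹ := by
    have h4 := Real.add_one_le_exp (-(μ * t))
    have h5 := Real.exp_pos (-(μ * t))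
    rw [← div_eq_mul_inv, div_le_div_iff₀ hμ (by linarith)]
    nlinarith [ht.2, ht.1]
  calc _ ≤ _ := h1
    _ ≤ C * ((T + 1) * (1 + μ)⁻¹) := by gcongr
    _ = _ := by ring

theorem measurable_expConv (h : IsControl C ψ) :
    Measurable fun x : ℝ × ℝ => expConv ψ x.1 x.2 := by
  have hm : Measurable fun y : (ℝ × ℝ) × ℝ => {y : (ℝ × ℝ) × ℝ | 0 < y.2 ∧ y.2 ≤ y.1.2}.indicator
      (fun y => Real.exp (-(y.1.1 * (y.1.2 - y.2))) • ψ y.2) y := by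
    refine Measurable.indicator ?_ ?_
    · exact Measurable.smul (f := fun y : (ℝ × ℝ) × ℝ => Real.exp (-(y.1.1 * (y.1.2 - y.2))))
        (by fun_prop) (h.measurable.comp measurable_snd)
    · exact (measurableSet_lt measurable_const measurable_snd).inter
        (measurableSet_le measurable_snd (by fun_prop))
  have := (hm.stronglyMeasurable.integral_prod_right' (ν := (volume : Measure ℝ))).measurable
  convert this using 2 with x
  rw [expConv, ← integral_indicator measurableSet_Ioc]
  rfl

theorem integrableOn_rpow_mul_inv (hα : α ∈ Ioo (0 : ℝ) 1) :
    IntegrableOn (fun μ : ℝ => μ ^ (-α) * (1 + μ)⁻¹) (Ioi 0) := by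
  rw [← Ioc_union_Ioi_eq_Ioi (zero_le_one (α := ℝ)), integrableOn_union]
  constructor
  · refine Integrable.mono' ((intervalIntegral.intervalIntegrable_rpow' (a := 0) (b := 1)
      (r := -α) (by linarith [hα.2])).1) (by fun_prop) ?_
    refine ae_restrict_of_forall_mem measurableSet_Ioc fun μ hμ => ?_
    have : (1 + μ)⁻¹ ≤ 1 := inv_le_one_of_one_le₀ (by linarith [hμ.1])
    have h0 : 0 ≤ μ ^ (-α) := Real.rpow_nonneg hμ.1.le _
    have h1 : 0 ≤ (1 + μ)⁻¹ := inv_nonneg.2 (by linarith [hμ.1])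
    rw [Real.norm_of_nonneg (by positivity)]
    exact mul_le_of_le_one_right h0 this
  · refine Integrable.mono' (integrableOn_Ioi_rpow_of_lt (a := -α - 1) (c := 1)
      (by linarith [hα.1]) one_pos) (by fun_prop) ?_
    refine ae_restrict_of_forall_mem measurableSet_Ioi fun μ hμ => ?_
    have hμ0 : 0 < μ := lt_trans one_pos hμ
    have h0 : 0 ≤ μ ^ (-α) := Real.rpow_nonneg hμ0.le _
    have h1 : 0 ≤ (1 + μ)⁻¹ := inv_nonneg.2 (by linarith)
    rw [Real.norm_of_nonneg (by positivity), Real.rpow_sub_one hμ0.ne', div_eq_mul_inv]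
    gcongr
    linarith

/-- Representation of the fractional integral as a mixture of exponential convolutions. -/
theorem integral_expConv (h : IsControl C ψ) (hα : α ∈ Ioo (0 : ℝ) 1) {t : ℝ} (ht : 0 ≤ t) :
    ∫ μ in Ioi (0 : ℝ), μ ^ (-α) • expConv ψ μ t =
      (Real.Gamma α * Real.Gamma (1 - α)) • rlIntegral α ψ t := by
  have hΓ := Real.Gamma_pos_of_pos hα.1
  have hΓ' := Real.Gamma_pos_of_pos (sub_pos.2 hα.2)
  have hC := h.nonneg
  set F : ℝ × ℝ → Vec n := fun x => (x.2 ^ (-α) * Real.exp (-(x.2 * (t - x.1)))) • ψ x.1 with hF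
  have hFm : Measurable F :=
    Measurable.smul (f := fun x : ℝ × ℝ => x.2 ^ (-α) * Real.exp (-(x.2 * (t - x.1))))
      (by fun_prop) (h.measurable.comp measurable_fst)
  have hgam : ∀ τ, τ < t → ∫ μ in Ioi (0 : ℝ), μ ^ (-α) * Real.exp (-(μ * (t - τ))) =
      Real.Gamma (1 - α) * (t - τ) ^ (α - 1) := by
    intro τ hτ
    have := Real.integral_rpow_mul_exp_neg_mul_Ioi (a := 1 - α) (r := t - τ) (by linarith [hα.2])
      (by linarith)
    simp only [sub_sub_cancel_left, mul_comm (t - τ)] at this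
    rw [this, mul_comm, one_div, Real.inv_rpow (by linarith), ← Real.rpow_neg (by linarith)]
    congr 2
    ring
  have hgi : ∀ τ, τ < t →
      IntegrableOn (fun μ : ℝ => μ ^ (-α) * Real.exp (-(μ * (t - τ)))) (Ioi 0) := by
    intro τ hτ
    by_contra hc
    have h1 := hgam τ hτ
    rw [integral_undef hc] at h1
    have : 0 < t - τ := by linarith
    have : 0 < Real.Gamma (1 - α) * (t - τ) ^ (α - 1) := by positivity
    linarith
  have hintegral : Integrable F ((volume.restrict (Ioo 0 t)).prod (volume.restrict (Ioi 0))) := by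
    rw [integrable_prod_iff hFm.aestronglyMeasurable]
    constructor
    · exact ae_restrict_of_forall_mem measurableSet_Ioo fun τ hτ =>
        (hgi τ hτ.2).smul_const (ψ τ)
    · refine Integrable.mono' (((intervalIntegrable_sub_rpow hα.1 t 0 t).1.mono_set
        Ioo_subset_Ioc_self).const_mul (Real.Gamma (1 - α) * C))
        hFm.norm.aestronglyMeasurable.integral_prod_right' ?_
      refine ae_restrict_of_forall_mem measurableSet_Ioo fun τ hτ => ?_
      have e : ∫ μ in Ioi (0 : ℝ), ‖F (τ, μ)‖ =
          (∫ μ in Ioi (0 : ℝ), μ ^ (-α) * Real.exp (-(μ * (t - τ)))) * ‖ψ τ‖ := by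
        rw [← integral_mul_const]
        refine setIntegral_congr_fun measurableSet_Ioi fun μ hμ => ?_
        have : 0 ≤ μ ^ (-α) := Real.rpow_nonneg (le_of_lt hμ) _
        simp only [hF]
        rw [norm_smul, Real.norm_of_nonneg (by positivity)]
      rw [e, hgam τ hτ.2]
      have : 0 ≤ (t - τ) ^ (α - 1) := Real.rpow_nonneg (by linarith [hτ.2]) _
      rw [Real.norm_of_nonneg (by positivity)]
      calc _ ≤ Real.Gamma (1 - α) * (t - τ) ^ (α - 1) * C := by gcongr; exact h.norm_le τ
        _ = _ := by ring
  have hsw := integral_integral_swap (f := fun τ μ => F (τ, μ)) hintegral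
  have hL : ∫ τ in Ioo 0 t, ∫ μ in Ioi (0 : ℝ), F (τ, μ) =
      Real.Gamma (1 - α) • ∫ τ in Ioo 0 t, ((t - τ) ^ (α - 1)) • ψ τ := by
    rw [← integral_smul]
    refine setIntegral_congr_fun measurableSet_Ioo fun τ hτ => ?_
    simp only [hF]
    rw [integral_smul_const, hgam τ hτ.2, smul_smul]
  have hR : ∫ μ in Ioi (0 : ℝ), ∫ τ in Ioo 0 t, F (τ, μ) =
      ∫ μ in Ioi (0 : ℝ), μ ^ (-α) • expConv ψ μ t := by
    refine setIntegral_congr_fun measurableSet_Ioi fun μ hμ => ?_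
    simp only [hF, mul_smul]
    rw [integral_smul, expConv, integral_Ioc_eq_integral_Ioo]
  rw [← hR, ← hsw, hL, rlIntegral_eq_Ioo ht, smul_smul]
  congr 1
  field_simp

theorem integrable_expConv_inner (h : IsControl C ψ) (hα : α ∈ Ioo (0 : ℝ) 1) {T G : ℝ}
    {g : ℝ → Vec n} (hg : AEStronglyMeasurable g (volume.restrict (Ioc 0 T)))
    (hG : ∀ t ∈ Ioc 0 T, ‖g t‖ ≤ G) :
    Integrable (fun x : ℝ × ℝ => x.1 ^ (-α) * inner ℝ (expConv ψ x.1 x.2) (g x.2))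
      ((volume.restrict (Ioi 0)).prod (volume.restrict (Ioc 0 T))) := by
  have hC := h.nonneg
  have h1 := (integrableOn_rpow_mul_inv hα).mul_prod (ν := volume.restrict (Ioc 0 T))
    (integrable_const (C * (T + 1) * G))
  refine Integrable.mono' h1 ?_ ?_
  · refine AEStronglyMeasurable.mul (Measurable.aestronglyMeasurable (by fun_prop)) ?_
    exact (measurable_expConv h).aestronglyMeasurable.inner hg.comp_snd
  · rw [Measure.prod_restrict]
    refine ae_restrict_of_forall_mem (measurableSet_Ioi.prod measurableSet_Ioc) fun x hx => ?_
    have hx1 : 0 < x.1 := hx.1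
    have h2 := norm_expConv_le h hx1 ⟨hx.2.1.le, hx.2.2⟩
    have h3 := norm_inner_le_norm (𝕜 := ℝ) (expConv ψ x.1 x.2) (g x.2)
    have h4 : 0 ≤ x.1 ^ (-α) := Real.rpow_nonneg hx1.le _
    have h5 := hG x.2 hx.2
    rw [norm_mul, Real.norm_of_nonneg h4]
    calc x.1 ^ (-α) * ‖inner ℝ (expConv ψ x.1 x.2) (g x.2)‖
        ≤ x.1 ^ (-α) * ((C * (T + 1) * (1 + x.1)⁻¹) * G) := by
          gcongr
          exact h3.trans (mul_le_mul h2 h5 (norm_nonneg _) ((norm_nonneg _).trans h2))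
      _ = _ := by ring

theorem integrableOn_expConv (h : IsControl C ψ) (hα : α ∈ Ioo (0 : ℝ) 1) {t : ℝ} (ht : 0 ≤ t) :
    IntegrableOn (fun μ : ℝ => μ ^ (-α) • expConv ψ μ t) (Ioi 0) := by
  refine Integrable.mono' ((integrableOn_rpow_mul_inv hα).const_mul (C * (t + 1))) ?_ ?_
  · refine AEStronglyMeasurable.smul (f := fun μ : ℝ => μ ^ (-α))
      (Measurable.aestronglyMeasurable (by fun_prop)) ?_
    exact ((measurable_expConv h).comp (measurable_id.prodMk measurable_const)).aestronglyMeasurable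
  · refine ae_restrict_of_forall_mem measurableSet_Ioi fun μ hμ => ?_
    have h4 : 0 ≤ μ ^ (-α) := Real.rpow_nonneg (le_of_lt hμ) _
    rw [norm_smul, Real.norm_of_nonneg h4]
    calc _ ≤ μ ^ (-α) * (C * (t + 1) * (1 + μ)⁻¹) := by
          gcongr
          exact norm_expConv_le h hμ ⟨ht, le_rfl⟩
      _ = _ := by ring

theorem integral_integral_expConv_inner (h : IsControl C ψ) (hα : α ∈ Ioo (0 : ℝ) 1) {T G : ℝ}
    {g : ℝ → Vec n} (hg : AEStronglyMeasurable g (volume.restrict (Ioc 0 T)))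
    (hG : ∀ t ∈ Ioc 0 T, ‖g t‖ ≤ G) :
    ∫ μ in Ioi (0 : ℝ), μ ^ (-α) * ∫ t in Ioc 0 T, inner ℝ (expConv ψ μ t) (g t) =
      Real.Gamma α * Real.Gamma (1 - α) * ∫ t in Ioc 0 T, inner ℝ (rlIntegral α ψ t) (g t) := by
  have hsw := integral_integral_swap
    (f := fun μ t => μ ^ (-α) * inner ℝ (expConv ψ μ t) (g t))
    (integrable_expConv_inner h hα hg hG)
  simp only [integral_const_mul] at hsw
  rw [hsw, ← integral_const_mul]
  refine setIntegral_congr_fun measurableSet_Ioc fun t ht => ?_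
  have h1 : ∀ μ : ℝ, μ ^ (-α) * inner ℝ (expConv ψ μ t) (g t) =
      inner ℝ (g t) (μ ^ (-α) • expConv ψ μ t) := by
    intro μ
    rw [real_inner_smul_right, real_inner_comm]
  simp only [h1]
  rw [integral_inner (integrableOn_expConv h hα ht.1.le), integral_expConv h hα ht.1.le,
    real_inner_smul_right, real_inner_comm]

/-- Energy inequality for a single exponential kernel. -/
theorem expConv_energy (h : IsControl C ψ) {T K μ : ℝ} (hT : 0 ≤ T) :
    ∫ t in (0 : ℝ)..T, (K + 2 * μ) * (Real.exp (-(K * t)) * ‖expConv ψ μ t‖ ^ 2) ≤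
      ∫ t in (0 : ℝ)..T, 2 * (Real.exp (-(K * t)) * inner ℝ (expConv ψ μ t) (ψ t)) := by
  have hC := h.nonneg
  -- Variation of constants: `expConv ψ μ` solves `r' = -μ r + ψ`, `r 0 = 0`, so `e^{μt} r` is the
  -- plain primitive `P` of `p`.
  set p : ℝ → Vec n := fun τ => Real.exp (μ * τ) • ψ τ with hp
  have hpi : ∀ a b, IntervalIntegrable p volume a b := fun a b =>
    ⟨h.integrableOn_smul (by fun_prop) a b, h.integrableOn_smul (by fun_prop) b a⟩
  set P : ℝ → Vec n := fun t => ∫ τ in (0 : ℝ)..t, p τ with hP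
  have hr : ∀ t, 0 ≤ t → expConv ψ μ t = Real.exp (-(μ * t)) • P t := by
    intro t ht
    simp only [hP]
    rw [expConv, intervalIntegral.integral_of_le ht, ← integral_smul]
    refine setIntegral_congr_fun measurableSet_Ioc fun τ hτ => ?_
    simp only [hp]
    rw [smul_smul, ← Real.exp_add]
    congr 2
    ring
  obtain ⟨L, hL0, hL⟩ : ∃ L : ℝ, 0 ≤ L ∧ ∀ τ ∈ Icc 0 T, ‖p τ‖ ≤ L := by
    refine ⟨Real.exp (|μ| * T) * C, by positivity, fun τ hτ => ?_⟩
    simp only [hp]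
    rw [norm_smul, Real.norm_of_nonneg (Real.exp_pos _).le]
    have : μ * τ ≤ |μ| * T :=
      mul_le_mul (le_abs_self μ) hτ.2 hτ.1 (abs_nonneg μ)
    gcongr
    exact h.norm_le τ
  have hPL : ∀ s ∈ Icc 0 T, ∀ t ∈ Icc 0 T, ‖P t - P s‖ ≤ L * |t - s| := by
    intro s hs t ht
    simp only [hP]
    rw [intervalIntegral.integral_interval_sub_left (hpi _ _) (hpi _ _)]
    refine intervalIntegral.norm_integral_le_of_norm_le_const fun τ hτ => hL τ ?_
    have := uIoc_subset_uIcc hτ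
    exact (uIcc_subset_Icc hs ht) this
  have hPb : ∀ t ∈ Icc 0 T, ‖P t‖ ≤ L * T := by
    intro t ht
    have h1 := hPL 0 ⟨le_rfl, hT⟩ t ht
    have h0 : P 0 = 0 := by simp [hP]
    rw [h0, sub_zero, sub_zero, abs_of_nonneg ht.1] at h1
    exact h1.trans (by gcongr; exact ht.2)
  -- `ψ` is only measurable, so `P` is merely Lipschitz, and the integration by parts is done for
  -- absolutely continuous functions.
  have hac2 : AbsolutelyContinuousOnInterval (fun t => ‖P t‖ ^ 2) 0 T := by
    refine LipschitzOnWith.absolutelyContinuousOnInterval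
      (K := Real.toNNReal (2 * (L * T) * L)) ?_
    rw [uIcc_of_le hT]
    refine LipschitzOnWith.of_dist_le_mul fun t ht s hs => ?_
    rw [Real.coe_toNNReal _ (by positivity), Real.dist_eq, Real.dist_eq, sq_sub_sq, abs_mul,
      mul_assoc]
    have h1 : |‖P t‖ + ‖P s‖| ≤ 2 * (L * T) := by
      rw [abs_of_nonneg (by positivity)]
      linarith [hPb t ht, hPb s hs]
    have h2 : |‖P t‖ - ‖P s‖| ≤ L * |t - s| :=
      (abs_norm_sub_norm_le _ _).trans (hPL s hs t ht)
    gcongr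
  have hac1 : AbsolutelyContinuousOnInterval (fun t => Real.exp (-((K + 2 * μ) * t))) 0 T := by
    refine ContDiffOn.absolutelyContinuousOnInterval ?_
    fun_prop
  have hibp := hac1.integral_deriv_mul_eq_sub hac2
  have hP0 : P 0 = 0 := by simp [hP]
  have hintegrable : IntervalIntegrable
      (fun t => (K + 2 * μ) * (Real.exp (-(K * t)) * ‖expConv ψ μ t‖ ^ 2)) volume 0 T := by
    have hcont : ContinuousOn (fun t => (K + 2 * μ) * (Real.exp (-(K * t)) *
        ‖Real.exp (-(μ * t)) • P t‖ ^ 2)) (uIcc 0 T) := by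
      have : Continuous P := intervalIntegral.continuous_primitive hpi 0
      exact Continuous.continuousOn (by fun_prop)
    refine hcont.intervalIntegrable.congr ?_
    intro t ht
    rw [uIoc_of_le hT] at ht
    simp only [hr t ht.1.le]
  have hint2 : IntervalIntegrable
      (fun t => 2 * (Real.exp (-(K * t)) * inner ℝ (expConv ψ μ t) (ψ t))) volume 0 T := by
    have hcont : Continuous (fun t => Real.exp (-(K * t)) • Real.exp (-(μ * t)) • P t) := by
      have : Continuous P := intervalIntegral.continuous_primitive hpi 0
      fun_prop
    refine (IntervalIntegrable.const_mul (f := fun t => inner ℝ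
      (Real.exp (-(K * t)) • Real.exp (-(μ * t)) • P t) (ψ t)) ?_ 2).congr ?_
    · rw [intervalIntegrable_iff, uIoc_of_le hT]
      refine Integrable.mono' ((hcont.norm.integrableOn_Ioc (μ := volume)
        (a := 0) (b := T)).mul_const C)
        (hcont.aestronglyMeasurable.inner h.measurable.aestronglyMeasurable) ?_
      filter_upwards with t
      exact (norm_inner_le_norm _ _).trans (by gcongr; exact h.norm_le t)
    · intro t ht
      rw [uIoc_of_le hT] at ht
      simp only [hr t ht.1.le]
      rw [real_inner_smul_left]
  -- The integrand is the derivative of `e^{-Kt}‖r‖²` with `r = expConv ψ μ`. What remains is the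
  -- endpoint value at `T`, which is nonnegative and gets dropped.
  have hae : ∫ t in (0 : ℝ)..T, (2 * (Real.exp (-(K * t)) * inner ℝ (expConv ψ μ t) (ψ t)) -
      (K + 2 * μ) * (Real.exp (-(K * t)) * ‖expConv ψ μ t‖ ^ 2)) =
      Real.exp (-((K + 2 * μ) * T)) * ‖P T‖ ^ 2 := by
    have e : Real.exp (-((K + 2 * μ) * T)) * ‖P T‖ ^ 2 = Real.exp (-((K + 2 * μ) * T)) * ‖P T‖ ^ 2
      - Real.exp (-((K + 2 * μ) * 0)) * ‖P 0‖ ^ 2 := by simp [hP0]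
    rw [e, ← hibp]
    refine intervalIntegral.integral_congr_ae ?_
    filter_upwards [(hpi 0 T).ae_hasDerivAt_integral] with t ht ht'
    have htc : t ∈ uIcc 0 T := uIoc_subset_uIcc ht'
    rw [uIoc_of_le hT] at ht'
    have hd := (ht htc 0 left_mem_uIcc).norm_sq
    have hd1 : HasDerivAt (fun t => Real.exp (-((K + 2 * μ) * t)))
        (Real.exp (-((K + 2 * μ) * t)) * (-((K + 2 * μ) * 1))) t :=
      (((hasDerivAt_id t).const_mul (K + 2 * μ)).neg).exp
    have hd2 : deriv (fun t => ‖P t‖ ^ 2) t = 2 * inner ℝ (P t) (p t) := hd.deriv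
    rw [hd1.deriv, hd2, hr t ht'.1.le, norm_smul, real_inner_smul_left,
      Real.norm_of_nonneg (Real.exp_pos _).le]
    simp only [hp]
    rw [real_inner_smul_right]
    have e1 : Real.exp (-((K + 2 * μ) * t)) =
        Real.exp (-(K * t)) * (Real.exp (-(μ * t)) * Real.exp (-(μ * t))) := by
      rw [← Real.exp_add, ← Real.exp_add]; congr 1; ring
    have e2 : Real.exp (-(μ * t)) * Real.exp (μ * t) = 1 := by
      rw [← Real.exp_add]; simp
    rw [e1]
    linear_combination (-2 * Real.exp (-(K * t)) * Real.exp (-(μ * t)) *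
      inner ℝ (P t) (ψ t)) * e2
  rw [intervalIntegral.integral_sub hint2 hintegrable] at hae
  have : 0 ≤ Real.exp (-((K + 2 * μ) * T)) * ‖P T‖ ^ 2 := by positivity
  linarith

/-- Dominated convergence as `K → ∞`. The smallness of this integral is the reason why a strong
exponential weight makes the positivity constant as large as desired. -/
theorem exists_integral_rpow_div_le (hα : α ∈ Ioo (0 : ℝ) 1) {η : ℝ} (hη : 0 < η) :
    ∃ K : ℝ, 1 ≤ K ∧ ∫ μ in Ioi (0 : ℝ), μ ^ (-α) * (K + 2 * μ)⁻¹ ≤ η := by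
  have hlim : Filter.Tendsto (fun K : ℝ => ∫ μ in Ioi (0 : ℝ), μ ^ (-α) * (K + 2 * μ)⁻¹)
      Filter.atTop (nhds (∫ μ in Ioi (0 : ℝ), (0 : ℝ))) := by
    refine tendsto_integral_filter_of_dominated_convergence
      (fun μ : ℝ => μ ^ (-α) * (1 + μ)⁻¹) ?_ ?_ (integrableOn_rpow_mul_inv hα) ?_
    · exact Filter.Eventually.of_forall fun K => by fun_prop
    · filter_upwards [Filter.eventually_ge_atTop 1] with K hK
      refine ae_restrict_of_forall_mem measurableSet_Ioi fun μ hμ => ?_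
      have hμ0 : 0 < μ := hμ
      rw [Real.norm_of_nonneg (by positivity)]
      gcongr
      linarith
    · refine ae_restrict_of_forall_mem measurableSet_Ioi fun μ hμ => ?_
      have h1 : Filter.Tendsto (fun K : ℝ => (K + 2 * μ)⁻¹) Filter.atTop (nhds 0) :=
        tendsto_inv_atTop_zero.comp (Filter.tendsto_atTop_add_const_right _ _ Filter.tendsto_id)
      simpa using h1.const_mul (μ ^ (-α))
  rw [integral_zero] at hlim
  obtain ⟨K, hK1, hK2⟩ := ((hlim.eventually (gt_mem_nhds hη)).and
    (Filter.eventually_ge_atTop 1)).exists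
  exact ⟨K, hK2, hK1.le⟩

/-- The fractional integral is strictly positive with respect to a rapidly decaying weight. -/
theorem exists_weight_energy (n : ℕ) (hα : α ∈ Ioo (0 : ℝ) 1) {Λ : ℝ} (hΛ : 0 < Λ) :
    ∃ K : ℝ, 0 ≤ K ∧ ∀ (T : ℝ), 0 ≤ T → ∀ (C : ℝ) (ψ : ℝ → Vec n), IsControl C ψ →
      Λ * ∫ t in (0 : ℝ)..T, Real.exp (-(K * t)) * ‖rlIntegral α ψ t‖ ^ 2 ≤
        2 * ∫ t in (0 : ℝ)..T, Real.exp (-(K * t)) * inner ℝ (rlIntegral α ψ t) (ψ t) := by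
  have hΓ := Real.Gamma_pos_of_pos hα.1
  have hΓ' := Real.Gamma_pos_of_pos (sub_pos.2 hα.2)
  set c := Real.Gamma α * Real.Gamma (1 - α) with hc
  have hc0 : 0 < c := by positivity
  -- The bound `c / Λ` makes the quadratic loss in Young's inequality below half of the linear gain
  -- `2 Λ c S`.
  obtain ⟨K, hK1, hK⟩ := exists_integral_rpow_div_le hα (η := c / Λ) (by positivity)
  refine ⟨K, by linarith, fun T hT C ψ h => ?_⟩
  have hC := h.nonneg
  set ρ : ℝ → Vec n := rlIntegral α ψ with hρ
  have hρc : ContinuousOn ρ (Icc 0 T) :=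
    (continuousOn_rlIntegral h ⟨hα.1, hα.2.le⟩).mono Icc_subset_Ici_self
  obtain ⟨R, hR⟩ := isCompact_Icc.exists_bound_of_continuousOn hρc
  have hwc : Continuous fun t : ℝ => Real.exp (-(K * t)) := by fun_prop
  have hw1 : ∀ t ∈ Ioc 0 T, Real.exp (-(K * t)) ≤ 1 := fun t ht => by
    rw [Real.exp_le_one_iff]
    have := mul_nonneg (by linarith : 0 ≤ K) ht.1.le
    linarith
  set g₁ : ℝ → Vec n := fun t => Real.exp (-(K * t)) • ψ t with hg₁
  set g₂ : ℝ → Vec n := fun t => Real.exp (-(K * t)) • ρ t with hg₂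
  have hg₁m : AEStronglyMeasurable g₁ (volume.restrict (Ioc 0 T)) :=
    (hwc.measurable.smul h.measurable).aestronglyMeasurable
  have hg₂m : AEStronglyMeasurable g₂ (volume.restrict (Ioc 0 T)) :=
    ((hwc.continuousOn.smul hρc).mono Ioc_subset_Icc_self).aestronglyMeasurable measurableSet_Ioc
  have hg₁b : ∀ t ∈ Ioc 0 T, ‖g₁ t‖ ≤ C := fun t ht => by
    simp only [hg₁]
    rw [norm_smul, Real.norm_of_nonneg (Real.exp_pos _).le]
    exact (mul_le_of_le_one_left (norm_nonneg _) (hw1 t ht)).trans (h.norm_le t)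
  have hg₂b : ∀ t ∈ Ioc 0 T, ‖g₂ t‖ ≤ R := fun t ht => by
    simp only [hg₂]
    rw [norm_smul, Real.norm_of_nonneg (Real.exp_pos _).le]
    exact (mul_le_of_le_one_left (norm_nonneg _) (hw1 t ht)).trans (hR t (Ioc_subset_Icc_self ht))
  have hI₁ := integrable_expConv_inner h hα hg₁m hg₁b
  have hI₂ := integrable_expConv_inner h hα hg₂m hg₂b
  have hE₁ := integral_integral_expConv_inner h hα hg₁m hg₁b
  have hE₂ := integral_integral_expConv_inner h hα hg₂m hg₂b
  have hJ₁ := hI₁.integral_prod_left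
  have hJ₂ := hI₂.integral_prod_left
  simp only [integral_const_mul] at hJ₁ hJ₂
  set S := ∫ t in Ioc 0 T, Real.exp (-(K * t)) * ‖ρ t‖ ^ 2 with hS
  have hSi : IntegrableOn (fun t => Real.exp (-(K * t)) * ‖ρ t‖ ^ 2) (Ioc 0 T) :=
    ((hwc.continuousOn.mul (hρc.norm.pow 2)).integrableOn_Icc).mono_set Ioc_subset_Icc_self
  have hS0 : 0 ≤ S := integral_nonneg fun t => by positivity
  have hκi : IntegrableOn (fun μ : ℝ => μ ^ (-α) * (K + 2 * μ)⁻¹) (Ioi 0) := by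
    refine Integrable.mono' (integrableOn_rpow_mul_inv hα) (by fun_prop) ?_
    refine ae_restrict_of_forall_mem measurableSet_Ioi fun μ hμ => ?_
    have hμ0 : 0 < μ := hμ
    rw [Real.norm_of_nonneg (by positivity)]
    gcongr
    linarith
  -- Fixed `μ`: the energy inequality bounds `(K + 2μ)‖r‖²` from above, and `0 ≤ ‖(K + 2μ) r - Λ
  -- ρ‖²` bounds it from below by terms linear in `r`. Linearity lets the integration over `μ`
  -- rebuild `ρ` from `r`.
  have hpt : ∀ μ ∈ Ioi (0 : ℝ), 2 * Λ * (μ ^ (-α) * ∫ t in Ioc 0 T, inner ℝ (expConv ψ μ t) (g₂ t))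
      - Λ ^ 2 * S * (μ ^ (-α) * (K + 2 * μ)⁻¹) ≤
      2 * (μ ^ (-α) * ∫ t in Ioc 0 T, inner ℝ (expConv ψ μ t) (g₁ t)) := by
    intro μ hμ
    have hμ0 : 0 < μ := hμ
    have hκ : 0 < K + 2 * μ := by linarith
    have hen := expConv_energy (K := K) (μ := μ) h hT
    rw [intervalIntegral.integral_of_le hT, intervalIntegral.integral_of_le hT] at hen
    have hm : Measurable fun t => expConv ψ μ t :=
      (measurable_expConv h).comp (measurable_const.prodMk measurable_id)
    have hb : ∀ t ∈ Ioc 0 T, ‖expConv ψ μ t‖ ≤ C * (T + 1) * (1 + μ)⁻¹ := fun t ht =>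
      norm_expConv_le h hμ0 ⟨ht.1.le, ht.2⟩
    set B := C * (T + 1) * (1 + μ)⁻¹ with hB
    have hi2 : IntegrableOn (fun t => inner ℝ (expConv ψ μ t) (g₂ t)) (Ioc 0 T) := by
      refine Integrable.mono' (integrable_const (B * R)) (hm.aestronglyMeasurable.inner hg₂m) ?_
      refine ae_restrict_of_forall_mem measurableSet_Ioc fun t ht => ?_
      exact (norm_inner_le_norm _ _).trans
        (mul_le_mul (hb t ht) (hg₂b t ht) (norm_nonneg _) ((norm_nonneg _).trans (hb t ht)))
    have hi3 : IntegrableOn (fun t => (K + 2 * μ) * (Real.exp (-(K * t)) * ‖expConv ψ μ t‖ ^ 2))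
        (Ioc 0 T) := by
      refine Integrable.const_mul ?_ _
      refine Integrable.mono' (integrable_const (1 * B ^ 2)) (by fun_prop) ?_
      refine ae_restrict_of_forall_mem measurableSet_Ioc fun t ht => ?_
      rw [Real.norm_of_nonneg (by positivity)]
      have := hw1 t ht
      have := hb t ht
      gcongr
    have hcmp : ∫ t in Ioc 0 T, (2 * Λ * inner ℝ (expConv ψ μ t) (g₂ t) -
        Λ ^ 2 * (K + 2 * μ)⁻¹ * (Real.exp (-(K * t)) * ‖ρ t‖ ^ 2)) ≤
        ∫ t in Ioc 0 T, (K + 2 * μ) * (Real.exp (-(K * t)) * ‖expConv ψ μ t‖ ^ 2) := by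
      refine setIntegral_mono_on ((hi2.const_mul _).sub (hSi.const_mul _)) hi3 measurableSet_Ioc
        fun t ht => ?_
      simp only [hg₂]
      rw [real_inner_smul_right]
      have h1 : 0 ≤ ‖(K + 2 * μ) • expConv ψ μ t - Λ • ρ t‖ ^ 2 := by positivity
      rw [norm_sub_sq_real, norm_smul, norm_smul, real_inner_smul_left, real_inner_smul_right,
        Real.norm_of_nonneg hκ.le, Real.norm_of_nonneg hΛ.le] at h1
      have h2 := mul_nonneg (mul_nonneg (Real.exp_pos (-(K * t))).le (inv_nonneg.2 hκ.le)) h1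
      have e : (K + 2 * μ)⁻¹ * (K + 2 * μ) = 1 := inv_mul_cancel₀ hκ.ne'
      have e' : Real.exp (-(K * t)) * (K + 2 * μ)⁻¹ * (((K + 2 * μ) * ‖expConv ψ μ t‖) ^ 2 -
          2 * ((K + 2 * μ) * (Λ * inner ℝ (expConv ψ μ t) (ρ t))) + (Λ * ‖ρ t‖) ^ 2) =
          (K + 2 * μ) * (Real.exp (-(K * t)) * ‖expConv ψ μ t‖ ^ 2) -
          2 * Λ * (Real.exp (-(K * t)) * inner ℝ (expConv ψ μ t) (ρ t)) +
          Λ ^ 2 * (K + 2 * μ)⁻¹ * (Real.exp (-(K * t)) * ‖ρ t‖ ^ 2) := by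
        linear_combination (Real.exp (-(K * t)) * (K + 2 * μ) * ‖expConv ψ μ t‖ ^ 2 -
          2 * Real.exp (-(K * t)) * Λ * inner ℝ (expConv ψ μ t) (ρ t)) * e
      rw [e'] at h2
      linarith
    rw [integral_sub (hi2.const_mul _) (hSi.const_mul _), integral_const_mul,
      integral_const_mul, ← hS] at hcmp
    have e1 : ∫ t in Ioc 0 T, 2 * (Real.exp (-(K * t)) * inner ℝ (expConv ψ μ t) (ψ t)) =
        2 * ∫ t in Ioc 0 T, inner ℝ (expConv ψ μ t) (g₁ t) := by
      rw [integral_const_mul]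
      simp only [hg₁, real_inner_smul_right]
    rw [e1] at hen
    have h4 : 0 ≤ μ ^ (-α) := Real.rpow_nonneg hμ0.le _
    have := mul_le_mul_of_nonneg_left (hcmp.trans hen) h4
    linarith
  have hfin := setIntegral_mono_on ((hJ₂.const_mul (2 * Λ)).sub (hκi.const_mul (Λ ^ 2 * S)))
    (hJ₁.const_mul 2) measurableSet_Ioi hpt
  simp only [Pi.sub_apply] at hfin
  rw [integral_sub (hJ₂.const_mul (2 * Λ)) (hκi.const_mul (Λ ^ 2 * S)), integral_const_mul,
    integral_const_mul, integral_const_mul, hE₁, hE₂, ← hc] at hfin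
  have e2 : ∫ t in Ioc 0 T, inner ℝ (rlIntegral α ψ t) (g₂ t) = S := by
    rw [hS]
    refine setIntegral_congr_fun measurableSet_Ioc fun t ht => ?_
    simp only [hg₂]
    rw [real_inner_smul_right, ← hρ, real_inner_self_eq_norm_sq]
  have e3 : ∫ t in Ioc 0 T, inner ℝ (rlIntegral α ψ t) (g₁ t) =
      ∫ t in Ioc 0 T, Real.exp (-(K * t)) * inner ℝ (ρ t) (ψ t) := by
    simp only [hg₁, real_inner_smul_right, hρ]
  rw [e2, e3] at hfin
  rw [intervalIntegral.integral_of_le hT, intervalIntegral.integral_of_le hT, ← hS]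
  have h7 : Λ ^ 2 * S * (∫ μ in Ioi (0 : ℝ), μ ^ (-α) * (K + 2 * μ)⁻¹) ≤ Λ * S * c := by
    calc _ ≤ Λ ^ 2 * S * (c / Λ) := by gcongr
      _ = _ := by field_simp
  have h8 : c * (Λ * S) ≤ c * (2 * ∫ t in Ioc 0 T, Real.exp (-(K * t)) * inner ℝ (ρ t) (ψ t)) := by
    linarith
  exact le_of_mul_le_mul_left h8 hc0

end FracHJ

end

/-! ### The path space: representation by controls, prolongation, Grönwall bound. -/

noncomputable section

namespace FracHJ

/-! ### Functions with bounded Caputo derivative -/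

variable {n : ℕ} {α β C T : ℝ} {ψ ψ' : ℝ → Vec n}

theorem ev_of_mem {V : Type*} [TopologicalSpace V] [Zero V] {t : ℝ} (w : C(Icc (0 : ℝ) t, V))
    {τ : ℝ} (h : τ ∈ Icc 0 t) : ev w τ = w ⟨τ, h⟩ := by
  simp only [ev, dif_pos h]

theorem continuousOn_ev {V : Type*} [TopologicalSpace V] [Zero V] {t : ℝ}
    (w : C(Icc (0 : ℝ) t, V)) : ContinuousOn (ev w) (Icc 0 t) := by
  rw [continuousOn_iff_continuous_domRestrict]
  convert w.continuous using 1
  ext1 τ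
  exact ev_of_mem w τ.2

theorem ext_ev {V : Type*} [TopologicalSpace V] [Zero V] {t : ℝ} {w w' : C(Icc (0 : ℝ) t, V)}
    (h : ∀ τ ∈ Icc (0 : ℝ) t, ev w τ = ev w' τ) : w = w' := by
  ext1 τ
  have := h τ τ.2
  rwa [ev_of_mem w τ.2, ev_of_mem w' τ.2] at this

/-- When the bound holds almost everywhere, this modification on a null set makes it hold everywhere
without changing any fractional integral. -/
theorem isControl_ite (hm : Measurable ψ) (hC : 0 ≤ C) :
    IsControl C fun t => if ‖ψ t‖ ≤ C then ψ t else 0 := by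
  refine ⟨Measurable.ite (measurableSet_le hm.norm measurable_const) hm measurable_const,
    fun t => ?_⟩
  split_ifs with h
  · exact h
  · simpa using hC

theorem IsControl.memLp (h : IsControl C ψ) (s : Set ℝ) : MemLp ψ ⊤ (volume.restrict s) :=
  memLp_top_of_bound h.measurable.aestronglyMeasurable C
    (Filter.Eventually.of_forall h.norm_le)

/-- An element of `AC^α` is represented by a bounded measurable function. -/
theorem exists_control {t : ℝ} {x : C(Icc (0 : ℝ) t, Vec n)} (hx : x ∈ AC α t n) :
    ∃ C, ∃ ψ : ℝ → Vec n, IsControl C ψ ∧ (∀ ξ, ξ ∉ Icc 0 t → ψ ξ = 0) ∧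
      ∀ τ ∈ Icc (0 : ℝ) t, ev x τ = ev x 0 + rlIntegral α ψ τ := by
  obtain ⟨ψ, hψ, h⟩ := hx
  set C := (eLpNorm ψ ⊤ (volume.restrict (Icc (0 : ℝ) t))).toReal with hC
  set ψ₁ := hψ.1.mk ψ with hψ₁
  have hm : Measurable ψ₁ := hψ.1.stronglyMeasurable_mk.measurable
  have hb : ∀ᵐ ξ ∂(volume.restrict (Icc (0 : ℝ) t)), ‖ψ ξ‖ ≤ C := by
    filter_upwards [ae_le_eLpNormEssSup (f := ψ) (μ := volume.restrict (Icc (0 : ℝ) t))] with ξ hξ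
    rw [← eLpNorm_exponent_top] at hξ
    have := ENNReal.toReal_mono hψ.2.ne hξ
    rwa [toReal_enorm] at this
  refine ⟨C, (Icc 0 t).indicator fun ξ => if ‖ψ₁ ξ‖ ≤ C then ψ₁ ξ else 0,
    (isControl_ite hm ENNReal.toReal_nonneg).indicator measurableSet_Icc, fun ξ hξ => ?_,
    fun τ hτ => ?_⟩
  · rw [indicator_of_notMem hξ]
  · rw [h τ hτ]
    congr 1
    refine rlIntegral_congr_ae hτ.1 ?_
    have h1 := hψ.1.ae_eq_mk
    have h2 := (ae_restrict_iff' measurableSet_Icc).1 (hb.and h1)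
    filter_upwards [h2] with ξ hξ hξ'
    have hmem : ξ ∈ Icc 0 t := ⟨hξ'.1.le, hξ'.2.trans hτ.2⟩
    obtain ⟨h3, h4⟩ := hξ hmem
    have heq : ψ ξ = ψ₁ ξ := h4
    rw [indicator_of_mem hmem, if_pos (by rw [← heq]; exact h3), heq]

/-- The function `v + I^α ψ` as an element of `AC^α`. -/
theorem exists_ac_of_control (hα : α ∈ Ioo (0 : ℝ) 1) (hT : 0 ≤ T) (v : Vec n)
    (h : IsControl C ψ) :
    ∃ x : AC α T n, ∀ τ ∈ Icc (0 : ℝ) T, ev x.1 τ = v + rlIntegral α ψ τ := by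
  have hc : ContinuousOn (fun τ => v + rlIntegral α ψ τ) (Icc 0 T) :=
    continuousOn_const.add ((continuousOn_rlIntegral h ⟨hα.1, hα.2.le⟩).mono Icc_subset_Ici_self)
  set x : C(Icc (0 : ℝ) T, Vec n) := ⟨_, continuousOn_iff_continuous_domRestrict.1 hc⟩ with hx
  have hev : ∀ τ ∈ Icc (0 : ℝ) T, ev x τ = v + rlIntegral α ψ τ := fun τ hτ => by
    rw [ev_of_mem x hτ]; rfl
  refine ⟨⟨x, ψ, h.memLp _, fun τ hτ => ?_⟩, hev⟩
  rw [hev τ hτ, hev 0 ⟨le_rfl, hT⟩, rlIntegral_zero_right, add_zero]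

theorem measurable_caputo {t : ℝ} (x : C(Icc (0 : ℝ) t, Vec n)) : Measurable (caputo α x) :=
  measurable_deriv _

theorem rlIntegral_ev_sub {t : ℝ} {x : C(Icc (0 : ℝ) t, Vec n)} (hα : α ∈ Ioo (0 : ℝ) 1)
    (h : IsControl C ψ) (hx : ∀ τ ∈ Icc (0 : ℝ) t, ev x τ = ev x 0 + rlIntegral α ψ τ) {r : ℝ}
    (hr : r ∈ Icc 0 t) :
    rlIntegral (1 - α) (fun ξ => ev x ξ - ev x 0) r = ∫ ξ in (0 : ℝ)..r, ψ ξ := by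
  rw [← rlIntegral_rlIntegral h hα hr.1]
  refine rlIntegral_congr_ae hr.1 ?_
  filter_upwards with ξ hξ
  rw [hx ξ ⟨hξ.1.le, hξ.2.trans hr.2⟩, add_sub_cancel_left]

theorem ae_mem_Ioo_of_mem_Icc (a b : ℝ) : ∀ᵐ τ : ℝ, τ ∈ Icc a b → τ ∈ Ioo a b := by
  have h1 : ∀ᵐ τ : ℝ, τ ≠ a := by simp [ae_iff, measure_singleton]
  have h2 : ∀ᵐ τ : ℝ, τ ≠ b := by simp [ae_iff, measure_singleton]
  filter_upwards [h1, h2] with τ h1 h2 h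
  exact ⟨lt_of_le_of_ne h.1 (Ne.symm h1), lt_of_le_of_ne h.2 h2⟩

/-- By the composition rule the function being differentiated is the primitive of `ψ`; Lebesgue's
differentiation theorem does the rest. -/
theorem caputo_ae_eq {t : ℝ} {x : C(Icc (0 : ℝ) t, Vec n)} (hα : α ∈ Ioo (0 : ℝ) 1)
    (ht : 0 ≤ t) (h : IsControl C ψ)
    (hx : ∀ τ ∈ Icc (0 : ℝ) t, ev x τ = ev x 0 + rlIntegral α ψ τ) :
    ∀ᵐ τ, τ ∈ Icc 0 t → caputo α x τ = ψ τ := by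
  filter_upwards [(h.intervalIntegrable 0 t).ae_hasDerivAt_integral, ae_mem_Ioo_of_mem_Icc 0 t]
    with τ h1 h2 hτ
  rw [uIcc_of_le ht] at h1
  have h3 := h1 hτ 0 ⟨le_rfl, ht⟩
  refine HasDerivAt.deriv (h3.congr_of_eventuallyEq ?_)
  filter_upwards [Ioo_mem_nhds (h2 hτ).1 (h2 hτ).2] with r hr
  exact rlIntegral_ev_sub hα h hx ⟨hr.1.le, hr.2.le⟩

/-- The Caputo derivative depends on the whole past, so agreement is required from time `0`. The
endpoint `b` is excluded because `deriv` looks at both sides. -/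
theorem caputo_congr {t t' b : ℝ} {x : C(Icc (0 : ℝ) t, Vec n)} {y : C(Icc (0 : ℝ) t', Vec n)}
    (h : ∀ τ ∈ Icc 0 b, ev x τ = ev y τ) {τ : ℝ} (hτ : τ ∈ Ioo 0 b) :
    caputo α x τ = caputo α y τ := by
  refine Filter.EventuallyEq.deriv_eq ?_
  filter_upwards [Ioo_mem_nhds hτ.1 hτ.2] with r hr
  refine rlIntegral_congr_ae hr.1.le ?_
  filter_upwards with ξ hξ
  rw [h ξ ⟨hξ.1.le, hξ.2.trans hr.2.le⟩, h 0 ⟨le_rfl, hτ.1.le.trans hτ.2.le⟩]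

/-- Two elements of `AC^α` that coincide on `[0, b]` and whose Caputo derivatives differ by the
control `f` afterwards. -/
theorem ev_eq_add_rlIntegral (hα : α ∈ Ioo (0 : ℝ) 1) (hT : 0 ≤ T) {x y : AC α T n} {b : ℝ}
    (hb : 0 ≤ b)
    (hxy : ∀ τ ∈ Icc 0 b, τ ≤ T → ev x.1 τ = ev y.1 τ) {f : ℝ → Vec n}
    (hf0 : ∀ᵐ τ, τ ∈ Icc 0 T → τ ≤ b → f τ = 0)
    (hf : ∀ᵐ τ, τ ∈ Icc 0 T → b < τ → caputo α x.1 τ - caputo α y.1 τ = f τ) {τ : ℝ}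
    (hτ : τ ∈ Icc 0 T) : ev x.1 τ = ev y.1 τ + rlIntegral α f τ := by
  obtain ⟨Cx, ψx, hx, -, hxr⟩ := exists_control x.2
  obtain ⟨Cy, ψy, hy, -, hyr⟩ := exists_control y.2
  rw [hxr τ hτ, hyr τ hτ, hxy 0 ⟨le_rfl, hb⟩ hT, add_assoc]
  congr 1
  have : rlIntegral α f τ = rlIntegral α (fun ξ => ψx ξ - ψy ξ) τ := by
    refine rlIntegral_congr_ae hτ.1 ?_
    filter_upwards [hf0, hf, caputo_ae_eq hα hT hx hxr, caputo_ae_eq hα hT hy hyr,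
      ae_mem_Ioo_of_mem_Icc 0 (min b T)] with ξ h1 h2 h3 h4 h5 hξ
    have hξT : ξ ∈ Icc 0 T := ⟨hξ.1.le, hξ.2.trans hτ.2⟩
    rcases le_or_gt ξ b with hle | hlt
    · rw [h1 hξT hle, ← h3 hξT, ← h4 hξT, caputo_congr (b := min b T) (x := x.1) (y := y.1)
        (fun s hs => hxy s ⟨hs.1, hs.2.trans (min_le_left _ _)⟩ (hs.2.trans (min_le_right _ _)))
        (h5 ⟨hξT.1, le_min hle hξT.2⟩), sub_self]
    · rw [← h2 hξT hlt, h3 hξT, h4 hξT]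
  rw [this, rlIntegral_sub hx hy hα.1]
  abel

/-! ### Prolongation of histories -/

/-- A history is prolonged by an arbitrary bounded measurable Caputo derivative. -/
theorem exists_prolongation (hα : α ∈ Ioo (0 : ℝ) 1) (p : GAlpha α T n) {f : ℝ → Vec n}
    (hf : IsControl C f) :
    ∃ x : AC α T n, (∀ τ ∈ Icc (0 : ℝ) p.1.t, ev x.1 τ = ev p.1.w τ) ∧
      ∀ᵐ τ, τ ∈ Icc p.1.t T → caputo α x.1 τ = f τ := by
  have hT : 0 ≤ T := p.1.ht.1.trans p.1.ht.2
  obtain ⟨C₀, ψ, hψ, hψ0, hw⟩ := exists_control p.2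
  have hf' := hf.indicator (measurableSet_Ioi (a := p.1.t))
  obtain ⟨x, hx⟩ := exists_ac_of_control hα hT (ev p.1.w 0) (hψ.add hf')
  refine ⟨x, fun τ hτ => ?_, ?_⟩
  · rw [hx τ ⟨hτ.1, hτ.2.trans p.1.ht.2⟩, hw τ hτ]
    congr 1
    refine rlIntegral_congr_ae hτ.1 ?_
    filter_upwards with ξ hξ
    rw [indicator_of_notMem (by simpa using hξ.2.trans hτ.2), add_zero]
  · have hx' : ∀ τ ∈ Icc (0 : ℝ) T, ev x.1 τ = ev x.1 0 +
        rlIntegral α (fun t => ψ t + (Ioi p.1.t).indicator f t) τ := by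
      intro τ hτ
      rw [hx τ hτ, hx 0 ⟨le_rfl, hT⟩, rlIntegral_zero_right, add_zero]
    filter_upwards [caputo_ae_eq hα hT (hψ.add hf') hx', ae_mem_Ioo_of_mem_Icc p.1.t T]
      with τ h1 h2 hτ
    have h3 := (h2 hτ).1
    rw [h1 ⟨p.1.ht.1.trans hτ.1, hτ.2⟩, hψ0 τ fun h => absurd h.2 (not_le.2 h3), zero_add,
      indicator_of_mem (mem_Ioi.2 h3)]

theorem exists_free (hα : α ∈ Ioo (0 : ℝ) 1) (p : GAlpha α T n) :
    ∃ x : AC α T n, (∀ τ ∈ Icc (0 : ℝ) p.1.t, ev x.1 τ = ev p.1.w τ) ∧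
      ∀ᵐ τ, τ ∈ Icc p.1.t T → caputo α x.1 τ = 0 :=
  exists_prolongation hα p (f := fun _ => 0) (C := 0) ⟨measurable_const, by simp⟩

/-- The prolongation of a history with zero Caputo derivative. -/
def free (hα : α ∈ Ioo (0 : ℝ) 1) (p : GAlpha α T n) : AC α T n := (exists_free hα p).choose

theorem free_eq (hα : α ∈ Ioo (0 : ℝ) 1) (p : GAlpha α T n) {τ : ℝ} (hτ : τ ∈ Icc 0 p.1.t) :
    ev (free hα p).1 τ = ev p.1.w τ := (exists_free hα p).choose_spec.1 τ hτ

theorem caputo_free (hα : α ∈ Ioo (0 : ℝ) 1) (p : GAlpha α T n) :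
    ∀ᵐ τ, τ ∈ Icc p.1.t T → caputo α (free hα p).1 τ = 0 := (exists_free hα p).choose_spec.2

/-- The Caputo derivative of `x` after the time `b`, with the values exceeding `C` removed. -/
def cutCaputo (C b : ℝ) (x : AC α T n) (τ : ℝ) : Vec n :=
  if ‖(Ioc b T).indicator (caputo α x.1) τ‖ ≤ C then (Ioc b T).indicator (caputo α x.1) τ else 0

theorem isControl_cutCaputo (hC : 0 ≤ C) (b : ℝ) (x : AC α T n) :
    IsControl C (cutCaputo C b x) :=
  isControl_ite ((measurable_caputo x.1).indicator measurableSet_Ioc) hC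

theorem cutCaputo_eq_zero {b : ℝ} {x : AC α T n} {τ : ℝ} (hτ : τ ∉ Ioc b T) :
    cutCaputo C b x τ = 0 := by
  simp [cutCaputo, indicator_of_notMem hτ]

theorem cutCaputo_eq {b : ℝ} {x : AC α T n} {τ : ℝ} (hτ : τ ∈ Ioc b T)
    (h : ‖caputo α x.1 τ‖ ≤ C) : cutCaputo C b x τ = caputo α x.1 τ := by
  simp [cutCaputo, indicator_of_mem hτ, h]

/-- `x` prolongs the history `p` with a Caputo derivative bounded by `C`. -/
def Prolongs (C : ℝ) (p : GAlpha α T n) (x : AC α T n) : Prop :=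
  (∀ τ ∈ Icc (0 : ℝ) p.1.t, ev x.1 τ = ev p.1.w τ) ∧
    ∀ᵐ τ, τ ∈ Icc p.1.t T → ‖caputo α x.1 τ‖ ≤ C

/-- The memory of the history is carried entirely by the free prolongation; the remainder is the
fractional integral of a control supported after the initial time. All later estimates use this
splitting. -/
theorem Prolongs.ev_eq (hα : α ∈ Ioo (0 : ℝ) 1) {p : GAlpha α T n} {x : AC α T n}
    (h : Prolongs C p x) {τ : ℝ} (hτ : τ ∈ Icc 0 T) :
    ev x.1 τ = ev (free hα p).1 τ + rlIntegral α (cutCaputo C p.1.t x) τ := by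
  refine ev_eq_add_rlIntegral hα (p.1.ht.1.trans p.1.ht.2) p.1.ht.1
    (fun τ hτ _ => by rw [h.1 τ hτ, free_eq hα p hτ]) ?_ ?_ hτ
  · filter_upwards with τ _ hτ'
    exact cutCaputo_eq_zero fun h => absurd h.1 (not_lt.2 hτ')
  · filter_upwards [h.2, caputo_free hα p] with τ h1 h2 hτ hb
    have : τ ∈ Icc p.1.t T := ⟨hb.le, hτ.2⟩
    rw [h2 this, sub_zero, cutCaputo_eq ⟨hb, hτ.2⟩ (h1 this)]

/-! ### Weighted estimates -/

theorem integral_kernel_exp_le (hβ : 0 < β) {K t : ℝ} (hK : 0 < K) (ht : 0 ≤ t) :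
    IntervalIntegrable (fun ξ => (t - ξ) ^ (β - 1) * Real.exp (K * ξ)) volume 0 t ∧
      ∫ ξ in (0 : ℝ)..t, (t - ξ) ^ (β - 1) * Real.exp (K * ξ) ≤
        Real.Gamma β * K ^ (-β) * Real.exp (K * t) := by
  constructor
  · exact (intervalIntegrable_sub_rpow hβ t 0 t).mul_continuousOn (by fun_prop)
  have e : ∀ ξ, (t - ξ) ^ (β - 1) * Real.exp (K * ξ) =
      (fun u => u ^ (β - 1) * Real.exp (-(K * u)) * Real.exp (K * t)) (t - ξ) := by
    intro ξ
    simp only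
    rw [mul_assoc, ← Real.exp_add]
    congr 2
    ring
  simp only [e]
  rw [intervalIntegral.integral_comp_sub_left
    (fun u => u ^ (β - 1) * Real.exp (-(K * u)) * Real.exp (K * t)) t, sub_self, sub_zero,
    intervalIntegral.integral_mul_const]
  have h1 := Real.integral_rpow_mul_exp_neg_mul_Ioi hβ hK
  have hΓ := Real.Gamma_pos_of_pos hβ
  rw [one_div, Real.inv_rpow hK.le, ← Real.rpow_neg hK.le] at h1
  have hi : IntegrableOn (fun u : ℝ => u ^ (β - 1) * Real.exp (-(K * u))) (Ioi 0) := by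
    by_contra hc
    rw [integral_undef hc] at h1
    have : 0 < K ^ (-β) * Real.Gamma β := by positivity
    linarith
  gcongr
  rw [mul_comm, ← h1, intervalIntegral.integral_of_le ht]
  refine setIntegral_mono_set hi ?_ (Filter.Eventually.of_forall Ioc_subset_Ioi_self)
  refine ae_restrict_of_forall_mem measurableSet_Ioi fun u hu => ?_
  have : 0 ≤ u ^ (β - 1) := Real.rpow_nonneg (le_of_lt hu) _
  simp only [Pi.zero_apply]
  positivity

/-- Extending the kernel integral to the half-line gives a Gamma integral. In the norm weighted by
`e^{-Kt}` the fractional integral thus has norm at most `K^{-β}`, which can be made small. -/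
theorem norm_rlIntegral_le_exp (hβ : 0 < β) {K S t : ℝ} (hK : 0 < K) (hS : 0 ≤ S) (ht : 0 ≤ t)
    (h : ∀ᵐ ξ, ξ ∈ Ioc 0 t → ‖ψ ξ‖ ≤ S * Real.exp (K * ξ)) :
    ‖rlIntegral β ψ t‖ ≤ S * K ^ (-β) * Real.exp (K * t) := by
  have hΓ := Real.Gamma_pos_of_pos hβ
  obtain ⟨h1, h2⟩ := integral_kernel_exp_le hβ hK ht
  rw [rlIntegral, norm_smul, Real.norm_of_nonneg (by positivity)]
  have h3 : ‖∫ ξ in (0 : ℝ)..t, ((t - ξ) ^ (β - 1)) • ψ ξ‖ ≤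
      ∫ ξ in (0 : ℝ)..t, S * ((t - ξ) ^ (β - 1) * Real.exp (K * ξ)) := by
    refine intervalIntegral.norm_integral_le_of_norm_le ht ?_ (h1.const_mul S)
    filter_upwards [h] with ξ hξ hξ'
    have h4 : 0 ≤ (t - ξ) ^ (β - 1) := Real.rpow_nonneg (by linarith [hξ'.2]) _
    rw [norm_smul, Real.norm_of_nonneg h4]
    calc _ ≤ (t - ξ) ^ (β - 1) * (S * Real.exp (K * ξ)) := by gcongr; exact hξ hξ'
      _ = _ := by ring
  rw [intervalIntegral.integral_const_mul] at h3
  calc _ ≤ 1 / Real.Gamma β * (S * (Real.Gamma β * K ^ (-β) * Real.exp (K * t))) := by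
        gcongr
        exact h3.trans (by gcongr)
    _ = _ := by field_simp

theorem exists_rpow_neg_le (hβ : 0 < β) {η : ℝ} (hη : 0 < η) : ∃ K : ℝ, 0 < K ∧ K ^ (-β) ≤ η := by
  obtain ⟨K, h1, h2⟩ := (((tendsto_rpow_neg_atTop hβ).eventually (gt_mem_nhds hη)).and
    (Filter.eventually_gt_atTop 0)).exists
  exact ⟨K, h2, h1.le⟩

/-- Fractional Grönwall inequality. -/
theorem exists_gronwall_bound (hα : α ∈ Ioo (0 : ℝ) 1) (hT : 0 ≤ T) {c : ℝ} (hc : 0 < c) :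
    ∃ M : ℝ, 1 ≤ M ∧ ∀ (A : ℝ) (a x f : ℝ → Vec n), 0 ≤ A → ContinuousOn x (Icc 0 T) →
      (∀ t ∈ Icc 0 T, ‖a t‖ ≤ A) → (∀ t ∈ Icc 0 T, x t = a t + rlIntegral α f t) →
      (∀ᵐ t, t ∈ Icc 0 T → ‖f t‖ ≤ c * (1 + ‖x t‖)) → ∀ t ∈ Icc 0 T, ‖x t‖ ≤ M * (1 + A) := by
  -- With this weight the integral term contributes at most `S / 2` to the weighted maximum `S` and
  -- is absorbed. `K`, hence the final constant, depends only on `c`, `α` and `T`.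
  obtain ⟨K, hK, hKc⟩ := exists_rpow_neg_le (β := α) hα.1 (η := 1 / (2 * c)) (by positivity)
  refine ⟨2 * Real.exp (K * T), ?_, fun A a x f hA hx ha hxa hf t ht => ?_⟩
  · have := Real.one_le_exp (mul_nonneg hK.le hT)
    linarith
  have hcont : ContinuousOn (fun t => Real.exp (-(K * t)) * (1 + ‖x t‖)) (Icc 0 T) := by
    fun_prop
  obtain ⟨s, hs, hmax⟩ := isCompact_Icc.exists_isMaxOn ⟨0, ⟨le_rfl, hT⟩⟩ hcont
  set S := Real.exp (-(K * s)) * (1 + ‖x s‖) with hS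
  have hS0 : 0 ≤ S := by positivity
  have hle : ∀ t ∈ Icc 0 T, 1 + ‖x t‖ ≤ S * Real.exp (K * t) := by
    intro t ht
    have h1 : Real.exp (-(K * t)) * (1 + ‖x t‖) ≤ S := hmax ht
    rw [Real.exp_neg, inv_mul_eq_div, div_le_iff₀ (Real.exp_pos _)] at h1
    exact h1
  have h2 : ‖rlIntegral α f s‖ ≤ (c * S) * K ^ (-α) * Real.exp (K * s) := by
    refine norm_rlIntegral_le_exp hα.1 hK (by positivity) hs.1 ?_
    filter_upwards [hf] with ξ hξ hξ'
    have hm : ξ ∈ Icc 0 T := ⟨hξ'.1.le, hξ'.2.trans hs.2⟩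
    calc _ ≤ _ := hξ hm
      _ ≤ c * (S * Real.exp (K * ξ)) := by gcongr; exact hle ξ hm
      _ = _ := by ring
  have h3 : ‖x s‖ ≤ A + S / 2 * Real.exp (K * s) := by
    rw [hxa s hs]
    refine (norm_add_le _ _).trans (add_le_add (ha s hs) (h2.trans ?_))
    gcongr
    calc c * S * K ^ (-α) ≤ c * S * (1 / (2 * c)) := by gcongr
      _ = S / 2 := by field_simp
  have h4 : S ≤ 2 * (1 + A) := by
    have e : Real.exp (-(K * s)) * Real.exp (K * s) = 1 := by rw [← Real.exp_add]; simp
    have h5 : S ≤ Real.exp (-(K * s)) * (1 + (A + S / 2 * Real.exp (K * s))) := by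
      rw [hS]; gcongr
    have h6 : Real.exp (-(K * s)) ≤ 1 := by
      rw [Real.exp_le_one_iff]
      have := mul_nonneg hK.le hs.1
      linarith
    have h7 : Real.exp (-(K * s)) * (1 + A) ≤ 1 + A := mul_le_of_le_one_left (by linarith) h6
    nlinarith
  have h8 := hle t ht
  calc ‖x t‖ ≤ S * Real.exp (K * t) := by linarith
    _ ≤ 2 * (1 + A) * Real.exp (K * T) := by
        gcongr
        exact ht.2
    _ = _ := by ring

end FracHJ

end

noncomputable section

namespace FracHJ

variable {n : ℕ} {α β C T : ℝ} {ψ ψ' : ℝ → Vec n}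

/-! ### Continuity of the free prolongation -/

theorem exists_close_of_dist_lt {p q : PathPair T n} {δ : ℝ} (h : dist p q < δ) {τ : ℝ}
    (hτ : τ ∈ Icc 0 p.t) :
    ∃ τ' ∈ Icc 0 q.t, |τ - τ'| < δ ∧ ‖ev p.w τ - ev q.w τ'‖ < δ := by
  have h1 : Metric.hausdorffDist (p.graph : Set (WithLp 2 (ℝ × Vec n))) q.graph < δ := by
    have : dist p q = dist p.graph q.graph := PathPair.max_distStar_eq p q
    rw [this] at h
    exact h
  have hmem : WithLp.toLp 2 (τ, p.w ⟨τ, hτ⟩) ∈ (p.graph : Set (WithLp 2 (ℝ × Vec n))) :=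
    ⟨⟨τ, hτ⟩, rfl⟩
  obtain ⟨y, ⟨τ', rfl⟩, h2⟩ := Metric.exists_dist_lt_of_hausdorffDist_lt hmem h1
    (edist_ne_top p.graph q.graph)
  rw [WithLp.prod_dist_eq_of_L2] at h2
  refine ⟨τ', τ'.2, ?_, ?_⟩
  · refine lt_of_le_of_lt ?_ h2
    rw [← Real.dist_eq]
    exact Real.le_sqrt_of_sq_le (le_add_of_nonneg_right (by positivity))
  · refine lt_of_le_of_lt ?_ h2
    rw [ev_of_mem p.w hτ, ev_of_mem q.w τ'.2, ← dist_eq_norm]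
    exact Real.le_sqrt_of_sq_le (le_add_of_nonneg_left (by positivity))

theorem abs_t_sub_lt_of_dist_lt {p q : PathPair T n} {δ : ℝ} (h : dist p q < δ) :
    |p.t - q.t| < δ := by
  obtain ⟨τ, hτ, h1, -⟩ := exists_close_of_dist_lt h (right_mem_Icc.2 p.ht.1)
  obtain ⟨τ', hτ', h2, -⟩ := exists_close_of_dist_lt (by rwa [dist_comm]) (right_mem_Icc.2 q.ht.1)
  rw [abs_lt] at *
  constructor <;> linarith [hτ.2, hτ'.2]

theorem ev_control (x : AC α T n) : ∃ C, ∃ ψ : ℝ → Vec n, IsControl C ψ ∧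
    ∀ τ ∈ Icc (0 : ℝ) T, ev x.1 τ = ev x.1 0 + rlIntegral α ψ τ := by
  obtain ⟨C, ψ, h, -, h'⟩ := exists_control x.2
  exact ⟨C, ψ, h, h'⟩

/-- Closeness in the metric of `G_n` says nothing about the Caputo derivatives of the histories, so
their fractional integrals cannot be compared directly. The maximum principle needs only the values
of the paths and transfers their closeness to later times. -/
theorem exists_delta_free (hα : α ∈ Ioo (0 : ℝ) 1) (p₀ : GAlpha α T n) {η : ℝ} (hη : 0 < η) :
    ∃ δ > 0, ∀ p : GAlpha α T n, dist p p₀ < δ → |p.1.t - p₀.1.t| < η ∧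
      ∀ τ ∈ Icc 0 T, ‖ev (free hα p).1 τ - ev (free hα p₀).1 τ‖ ≤ η := by
  have hT : 0 ≤ T := p₀.1.ht.1.trans p₀.1.ht.2
  have hΓ := Real.Gamma_pos_of_pos (by linarith [hα.1] : 0 < α + 1)
  obtain ⟨C₀, ψ₀, hψ₀, hr₀⟩ := ev_control (free hα p₀)
  have hC₀ := hψ₀.nonneg
  have hc₀ := caputo_ae_eq hα hT hψ₀ hr₀
  have huc := isCompact_Icc.uniformContinuousOn_of_continuous (continuousOn_ev (free hα p₀).1)
  rw [Metric.uniformContinuousOn_iff] at huc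
  obtain ⟨δ₁, hδ₁, huc⟩ := huc (η / 4) (by linarith)
  have hlim : Filter.Tendsto (fun δ : ℝ => C₀ * δ ^ α / Real.Gamma (α + 1)) (nhds 0) (nhds 0) := by
    have : Continuous fun δ : ℝ => C₀ * δ ^ α / Real.Gamma (α + 1) := by
      refine (continuous_const.mul (continuous_id.rpow_const fun _ => Or.inr hα.1.le)).div_const _
    simpa [Real.zero_rpow hα.1.ne'] using this.tendsto 0
  obtain ⟨δ₂, hδ₂, hlim⟩ := Metric.eventually_nhds_iff.1
    (hlim.eventually (gt_mem_nhds (by linarith : (0 : ℝ) < η / 2)))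
  refine ⟨min (min δ₁ (δ₂ / 2)) (η / 4), by positivity, fun p hp => ?_⟩
  set δ := min (min δ₁ (δ₂ / 2)) (η / 4) with hδ
  have hδ1 : δ ≤ δ₁ := (min_le_left _ _).trans (min_le_left _ _)
  have hδ2 : δ ≤ δ₂ / 2 := (min_le_left _ _).trans (min_le_right _ _)
  have hδ3 : δ ≤ η / 4 := min_le_right _ _
  have hp' : dist p.1 p₀.1 < δ := hp
  have ht := abs_t_sub_lt_of_dist_lt hp'
  refine ⟨by linarith, fun τ hτ => ?_⟩
  have hδ0 : 0 ≤ δ := by positivity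
  have hsmall : C₀ * δ ^ α / Real.Gamma (α + 1) ≤ η / 2 := by
    refine (hlim ?_).le
    rw [Real.dist_eq, sub_zero, abs_of_nonneg hδ0]
    linarith
  -- The metric compares `s` with some nearby time `s'`; uniform continuity of the fixed path `free
  -- hα p₀` brings `s'` back to `s`.
  have hclose : ∀ s ∈ Icc 0 p.1.t, ‖ev (free hα p).1 s - ev (free hα p₀).1 s‖ ≤ η / 2 := by
    intro s hs
    obtain ⟨s', hs', h1, h2⟩ := exists_close_of_dist_lt hp' hs
    rw [free_eq hα p hs]
    have h3 := huc s ⟨hs.1, hs.2.trans p.1.ht.2⟩ s' ⟨hs'.1, hs'.2.trans p₀.1.ht.2⟩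
      (by rw [Real.dist_eq]; linarith)
    rw [dist_comm, dist_eq_norm, free_eq hα p₀ hs'] at h3
    calc _ = ‖(ev p.1.w s - ev p₀.1.w s') + (ev p₀.1.w s' - ev (free hα p₀).1 s)‖ := by
          congr 1; abel
      _ ≤ _ := (norm_add_le _ _).trans (by linarith)
  obtain ⟨C₁, ψ₁, hψ₁, hr₁⟩ := ev_control (free hα p)
  have hc₁ := caputo_ae_eq hα hT hψ₁ hr₁
  have hpt := p.1.ht
  set v := ev (free hα p).1 0 - ev (free hα p₀).1 0 with hv
  -- The difference of controls is cut at `p.1.t`. The part `χ` vanishes afterwards, so the maximum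
  -- principle applies to it. Almost everywhere on `(0, T]` the part `θ` is zero outside the short
  -- interval between `p.1.t` and `p₀.1.t`, and it is bounded by the constant `C₀` of the fixed
  -- point.
  set χ : ℝ → Vec n := (Iic p.1.t).indicator fun t => ψ₁ t - ψ₀ t with hχ
  set θ : ℝ → Vec n := (Ioi p.1.t).indicator ψ₀ with hθ
  have hχc : IsControl (C₁ + C₀) χ := (hψ₁.sub hψ₀).indicator measurableSet_Iic
  have hθc : IsControl C₀ θ := hψ₀.indicator measurableSet_Ioi
  have hdec : ∀ s ∈ Icc 0 T, ev (free hα p).1 s - ev (free hα p₀).1 s =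
      (v + rlIntegral α χ s) - rlIntegral α θ s := by
    intro s hs
    have h1 : rlIntegral α (fun t => ψ₁ t - ψ₀ t) s = rlIntegral α (fun t => χ t - θ t) s := by
      refine rlIntegral_congr_ae hs.1 ?_
      filter_upwards [hc₁, caputo_free hα p] with ξ h1 h2 hξ
      have hξT : ξ ∈ Icc 0 T := ⟨hξ.1.le, hξ.2.trans hs.2⟩
      rcases le_or_gt ξ p.1.t with hle | hlt
      · simp only [hχ, hθ]
        rw [indicator_of_mem (mem_Iic.2 hle), indicator_of_notMem (by simpa using hle), sub_zero]
      · simp only [hχ, hθ]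
        rw [indicator_of_mem (mem_Ioi.2 hlt), indicator_of_notMem (by simpa using hlt),
          ← h1 hξT, h2 ⟨hlt.le, hξT.2⟩]
    rw [rlIntegral_sub hψ₁ hψ₀ hα.1, rlIntegral_sub hχc hθc hα.1] at h1
    rw [hr₁ s hs, hr₀ s hs, add_sub_add_comm, h1, add_sub_assoc]
  have hθ0 : ∀ s ∈ Icc 0 p.1.t, rlIntegral α θ s = 0 := by
    intro s hs
    have : rlIntegral α θ s = rlIntegral α (fun _ => (0 : Vec n)) s := by
      refine rlIntegral_congr_ae hs.1 ?_
      filter_upwards with ξ hξ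
      simp only [hθ]
      rw [indicator_of_notMem (by simpa using hξ.2.trans hs.2)]
    rw [this]
    simp [rlIntegral]
  have hχb : ‖v + rlIntegral α χ τ‖ ≤ η / 2 := by
    refine norm_le_of_control_eq_zero hχc hα hpt.1 (T := T) (fun ξ hξ => ?_) v (fun s hs => ?_) hτ
    · simp only [hχ]
      rw [indicator_of_notMem (by simpa using hξ.1)]
    · have h1 := hdec s ⟨hs.1, hs.2.trans hpt.2⟩
      rw [hθ0 s hs, sub_zero] at h1
      rw [← h1]
      exact hclose s hs
  have hθb : ‖rlIntegral α θ τ‖ ≤ η / 2 := by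
    refine (norm_rlIntegral_le_of_support hθc ⟨hα.1, hα.2.le⟩ hτ.1 hpt.1
      (le_max_left p.1.t p₀.1.t) ?_).trans (le_trans ?_ hsmall)
    · filter_upwards [hc₀, caputo_free hα p₀] with ξ h1 h2 hξ hξ'
      have hξT : ξ ∈ Icc 0 T := ⟨hξ.1.le, hξ.2.trans hτ.2⟩
      simp only [hθ]
      rcases le_or_gt ξ p.1.t with hle | hlt
      · rw [indicator_of_notMem (by simpa using hle)]
      · have h3 : p₀.1.t < ξ := by
          by_contra hcon
          exact hξ' ⟨hlt, le_max_of_le_right (not_lt.1 hcon)⟩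
        rw [indicator_of_mem (mem_Ioi.2 hlt), ← h1 hξT, h2 ⟨h3.le, hξT.2⟩]
    · have h1 : max p.1.t p₀.1.t - p.1.t ≤ δ := by
        rw [abs_lt] at ht
        rcases max_cases p.1.t p₀.1.t with h | h <;> linarith
      have h2 : 0 ≤ max p.1.t p₀.1.t - p.1.t := sub_nonneg.2 (le_max_left _ _)
      have := hα.1.le
      gcongr
  rw [hdec τ hτ]
  exact (norm_sub_le _ _).trans (by linarith)

/-! ### Compactness of the set of prolongations -/

/-- Rademacher in one variable: `F` and the primitive of its truncated derivative are absolutely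
continuous with equal derivatives almost everywhere, so they differ by a constant. -/
theorem exists_control_of_lipschitz (hT : 0 ≤ T) (hC : 0 ≤ C) {F : ℝ → Vec n}
    (hF : ∀ r ∈ Icc 0 T, ∀ s ∈ Icc 0 T, ‖F r - F s‖ ≤ C * |r - s|) :
    ∃ g : ℝ → Vec n, IsControl C g ∧ ∀ r ∈ Icc 0 T, F r - F 0 = ∫ ξ in (0 : ℝ)..r, g ξ := by
  set g : ℝ → Vec n := fun t => if ‖deriv F t‖ ≤ C then deriv F t else 0 with hg
  have hgc : IsControl C g := isControl_ite (measurable_deriv F) hC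
  refine ⟨g, hgc, ?_⟩
  have hlip : LipschitzOnWith (Real.toNNReal C) F (Icc 0 T) :=
    LipschitzOnWith.of_dist_le_mul fun r hr s hs => by
      rw [Real.coe_toNNReal _ hC, dist_eq_norm, Real.dist_eq]
      exact hF r hr s hs
  have hac : AbsolutelyContinuousOnInterval F 0 T :=
    LipschitzOnWith.absolutelyContinuousOnInterval (by rwa [uIcc_of_le hT])
  have hac2 : AbsolutelyContinuousOnInterval (fun r => ∫ ξ in (0 : ℝ)..r, g ξ) 0 T := by
    refine LipschitzOnWith.absolutelyContinuousOnInterval (K := Real.toNNReal C)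
      (LipschitzOnWith.of_dist_le_mul fun r hr s hs => ?_)
    rw [Real.coe_toNNReal _ hC, dist_eq_norm, Real.dist_eq,
      intervalIntegral.integral_interval_sub_left (hgc.intervalIntegrable _ _)
        (hgc.intervalIntegrable _ _)]
    exact intervalIntegral.norm_integral_le_of_norm_le_const fun ξ _ => hgc.norm_le ξ
  have hdiff := hac.boundedVariationOn.ae_differentiableAt_of_mem_uIcc
  obtain ⟨c, hc⟩ := (hac.sub hac2).const_of_ae_hasDerivAt_zero (by
    filter_upwards [hdiff, (hgc.intervalIntegrable 0 T).ae_hasDerivAt_integral,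
      ae_mem_Ioo_of_mem_Icc 0 T] with t h1 h2 h3 ht
    have h4 := (h1 ht).hasDerivAt
    have h5 := h2 ht 0 left_mem_uIcc
    rw [uIcc_of_le hT] at ht
    have h6 : ‖deriv F t‖ ≤ C := by
      have := norm_deriv_le_of_lipschitzOn (Icc_mem_nhds (h3 ht).1 (h3 ht).2) hlip
      rwa [Real.coe_toNNReal _ hC] at this
    have h7 : g t = deriv F t := by simp only [hg]; rw [if_pos h6]
    have := h4.sub h5
    rwa [h7, sub_self] at this)
  rw [uIcc_of_le hT] at hc
  intro r hr
  have h1 := hc r hr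
  have h2 := hc 0 ⟨le_rfl, hT⟩
  simp only [Pi.sub_apply, intervalIntegral.integral_same, sub_zero] at h1 h2
  rw [h2, ← h1]
  abel

/-- A continuous function on `[0, T]` extended by constants. -/
def extend (hT : 0 ≤ T) (x : C(Icc (0 : ℝ) T, Vec n)) (τ : ℝ) : Vec n := x (projIcc 0 T hT τ)

theorem continuous_extend (hT : 0 ≤ T) (x : C(Icc (0 : ℝ) T, Vec n)) : Continuous (extend hT x) :=
  x.continuous.comp continuous_projIcc

theorem isControl_extend (hT : 0 ≤ T) (x : C(Icc (0 : ℝ) T, Vec n)) :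
    IsControl ‖x‖ (extend hT x) :=
  ⟨(continuous_extend hT x).measurable, fun _ => x.norm_coe_le_norm _⟩

theorem extend_eq (hT : 0 ≤ T) (x : C(Icc (0 : ℝ) T, Vec n)) {τ : ℝ} (hτ : τ ∈ Icc 0 T) :
    extend hT x τ = ev x τ := by
  rw [extend, projIcc_of_mem hT hτ, ev_of_mem x hτ]

/-- Injectivity of the fractional integral: the complementary integral of order `1 - α` turns it
into the ordinary primitive, which is then differentiated. -/
theorem eq_zero_of_rlIntegral_eq_zero (hα : α ∈ Ioo (0 : ℝ) 1) (h : IsControl C ψ)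
    (hc : ContinuousOn ψ (Icc 0 T)) (h0 : ∀ r ∈ Icc 0 T, rlIntegral α ψ r = 0) {τ : ℝ}
    (hτ : τ ∈ Ioo 0 T) : ψ τ = 0 := by
  have h1 : ∀ r ∈ Icc 0 T, ∫ ξ in (0 : ℝ)..r, ψ ξ = 0 := by
    intro r hr
    rw [← rlIntegral_rlIntegral h hα hr.1]
    have : rlIntegral (1 - α) (rlIntegral α ψ) r = rlIntegral (1 - α) (fun _ => (0 : Vec n)) r := by
      refine rlIntegral_congr_ae hr.1 ?_
      filter_upwards with ξ hξ
      exact h0 ξ ⟨hξ.1.le, hξ.2.trans hr.2⟩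
    rw [this]
    simp [rlIntegral]
  have hca : ContinuousAt ψ τ := hc.continuousAt (Icc_mem_nhds hτ.1 hτ.2)
  have h2 : HasDerivAt (fun r => ∫ ξ in (0 : ℝ)..r, ψ ξ) (ψ τ) τ :=
    intervalIntegral.integral_hasDerivAt_right (h.intervalIntegrable _ _)
      (h.measurable.stronglyMeasurable.stronglyMeasurableAtFilter) hca
  have h3 : HasDerivAt (fun r => ∫ ξ in (0 : ℝ)..r, ψ ξ) 0 τ := by
    refine (hasDerivAt_const τ (0 : Vec n)).congr_of_eventuallyEq ?_
    filter_upwards [Ioo_mem_nhds hτ.1 hτ.2] with r hr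
    exact h1 r ⟨hr.1.le, hr.2.le⟩
  exact h2.unique h3

/-- A bound on the Caputo derivative is not visibly closed under uniform limits. After subtracting
the free prolongation and applying `I^{1-α}` it becomes the `C`-Lipschitz condition, which is; the
limit control is then the derivative of the resulting function. -/
theorem prolongs_of_approx (hα : α ∈ Ioo (0 : ℝ) 1) (hC : 0 ≤ C) (hT : 0 < T) {p : GAlpha α T n}
    {x : C(Icc (0 : ℝ) T, Vec n)}
    (happ : ∀ ε > 0, ∃ y : AC α T n, Prolongs C p y ∧ dist x y.1 < ε) :
    ∃ hx : x ∈ AC α T n, Prolongs C p ⟨x, hx⟩ := by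
  have hT0 := hT.le
  have hβ : 1 - α ∈ Ioc (0 : ℝ) 1 := ⟨by linarith [hα.2], by linarith [hα.1]⟩
  have hΓ := Real.Gamma_pos_of_pos (by linarith [hα.2] : 0 < 1 - α + 1)
  have h0T : (0 : ℝ) ∈ Icc 0 T := ⟨le_rfl, hT0⟩
  set a := free hα p with ha
  have hd : ∀ (y : AC α T n) (τ : ℝ), ‖extend hT0 x τ - extend hT0 y.1 τ‖ ≤ dist x y.1 := by
    intro y τ
    rw [← dist_eq_norm]
    exact ContinuousMap.dist_apply_le_dist _
  have hxw : ∀ τ ∈ Icc 0 p.1.t, ev x τ = ev p.1.w τ := by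
    intro τ hτ
    have hτT : τ ∈ Icc 0 T := ⟨hτ.1, hτ.2.trans p.1.ht.2⟩
    refine eq_of_forall_dist_le fun ε hε => ?_
    obtain ⟨y, hy, hxy⟩ := happ ε hε
    have h1 := hd y τ
    rw [extend_eq hT0 x hτT, extend_eq hT0 y.1 hτT, hy.1 τ hτ] at h1
    rw [dist_eq_norm]
    linarith
  have hx0 : ev x 0 = ev a.1 0 := by
    rw [hxw 0 ⟨le_rfl, p.1.ht.1⟩, ha, free_eq hα p ⟨le_rfl, p.1.ht.1⟩]
  set d : ℝ → Vec n := fun τ => extend hT0 x τ - extend hT0 a.1 τ with hdd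
  have hdc : IsControl (‖x‖ + ‖a.1‖) d := (isControl_extend hT0 x).sub (isControl_extend hT0 a.1)
  set F : ℝ → Vec n := rlIntegral (1 - α) d with hF
  have hFlip : ∀ r ∈ Icc 0 T, ∀ s ∈ Icc 0 T, ‖F r - F s‖ ≤ C * |r - s| := by
    intro r hr s hs
    refine le_of_forall_pos_le_add fun ε hε => ?_
    set κ := T ^ (1 - α) / Real.Gamma (1 - α + 1) with hκ
    have hκ0 : 0 < κ := by positivity
    obtain ⟨y, hy, hxy⟩ := happ (ε / (2 * κ)) (by positivity)
    set f := cutCaputo C p.1.t y with hf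
    have hfc : IsControl C f := isControl_cutCaputo hC _ _
    have hFy : ∀ r ∈ Icc 0 T, ‖F r - ∫ ξ in (0 : ℝ)..r, f ξ‖ ≤ ε / 2 := by
      intro r hr
      have h1 : ∫ ξ in (0 : ℝ)..r, f ξ =
          rlIntegral (1 - α) (fun τ => extend hT0 y.1 τ - extend hT0 a.1 τ) r := by
        rw [← rlIntegral_rlIntegral hfc hα hr.1]
        refine rlIntegral_congr_ae hr.1 ?_
        filter_upwards with ξ hξ
        have hξT : ξ ∈ Icc 0 T := ⟨hξ.1.le, hξ.2.trans hr.2⟩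
        rw [extend_eq hT0 _ hξT, extend_eq hT0 _ hξT, hy.ev_eq hα hξT, ← ha, add_sub_cancel_left]
      rw [h1, hF, ← rlIntegral_sub hdc ((isControl_extend hT0 y.1).sub (isControl_extend hT0 a.1))
        hβ.1]
      have h2 : IsControl (ε / (2 * κ))
          (fun ξ => d ξ - (extend hT0 y.1 ξ - extend hT0 a.1 ξ)) := by
        refine ⟨(hdc.measurable.sub ((isControl_extend hT0 y.1).sub
          (isControl_extend hT0 a.1)).measurable), fun τ => ?_⟩
        simp only [hdd, sub_sub_sub_cancel_right]
        exact (hd y τ).trans hxy.le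
      refine (norm_rlIntegral_le h2 hβ hr.1).trans ?_
      calc ε / (2 * κ) * r ^ (1 - α) / Real.Gamma (1 - α + 1)
          ≤ ε / (2 * κ) * T ^ (1 - α) / Real.Gamma (1 - α + 1) := by
            have := hβ.1.le
            have := hr.1
            have := hr.2
            gcongr
        _ = ε / (2 * κ) * κ := by rw [hκ]; ring
        _ = ε / 2 := by field_simp
    have h3 : ‖(∫ ξ in (0 : ℝ)..r, f ξ) - ∫ ξ in (0 : ℝ)..s, f ξ‖ ≤ C * |r - s| := by
      rw [intervalIntegral.integral_interval_sub_left (hfc.intervalIntegrable _ _)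
        (hfc.intervalIntegrable _ _)]
      exact intervalIntegral.norm_integral_le_of_norm_le_const fun ξ _ => hfc.norm_le ξ
    have h4 := hFy r hr
    have h5 := hFy s hs
    calc ‖F r - F s‖ = ‖(F r - ∫ ξ in (0 : ℝ)..r, f ξ) +
          ((∫ ξ in (0 : ℝ)..r, f ξ) - ∫ ξ in (0 : ℝ)..s, f ξ) -
          (F s - ∫ ξ in (0 : ℝ)..s, f ξ)‖ := by congr 1; abel
      _ ≤ ε / 2 + C * |r - s| + ε / 2 :=
          (norm_sub_le _ _).trans (add_le_add ((norm_add_le _ _).trans (add_le_add h4 h3)) h5)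
      _ = _ := by ring
  obtain ⟨g, hg, hgF⟩ := exists_control_of_lipschitz hT0 hC hFlip
  have hrl := continuousOn_rlIntegral hg ⟨hα.1, hα.2.le⟩
  obtain ⟨xg, hxg⟩ := exists_ac_of_control hα hT0 (0 : Vec n) hg
  simp only [zero_add] at hxg
  have hec : IsControl (‖x‖ + ‖a.1‖ + ‖xg.1‖) (fun τ => d τ - extend hT0 xg.1 τ) :=
    hdc.sub (isControl_extend hT0 xg.1)
  have hecc : Continuous (fun τ => d τ - extend hT0 xg.1 τ) :=
    ((continuous_extend hT0 x).sub (continuous_extend hT0 a.1)).sub (continuous_extend hT0 xg.1)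
  -- Here `d` and `xg = I^α g` have the same integral of order `1 - α`, so injectivity identifies
  -- them.
  have hzero : ∀ r ∈ Icc 0 T, rlIntegral (1 - α) (fun τ => d τ - extend hT0 xg.1 τ) r = 0 := by
    intro r hr
    rw [rlIntegral_sub hdc (isControl_extend hT0 xg.1) hβ.1]
    have h1 : rlIntegral (1 - α) (extend hT0 xg.1) r = ∫ ξ in (0 : ℝ)..r, g ξ := by
      rw [← rlIntegral_rlIntegral hg hα hr.1]
      refine rlIntegral_congr_ae hr.1 ?_
      filter_upwards with ξ hξ
      have hξT : ξ ∈ Icc 0 T := ⟨hξ.1.le, hξ.2.trans hr.2⟩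
      rw [extend_eq hT0 _ hξT, hxg ξ hξT]
    rw [h1, ← hgF r hr, hF, rlIntegral_zero_right, sub_zero, sub_self]
  have heq : ∀ τ ∈ Ioo 0 T, d τ - extend hT0 xg.1 τ = 0 := fun τ hτ =>
    eq_zero_of_rlIntegral_eq_zero (α := 1 - α) ⟨by linarith [hα.2], by linarith [hα.1]⟩ hec
      hecc.continuousOn hzero hτ
  have heq' : ∀ τ ∈ Icc 0 T, d τ - extend hT0 xg.1 τ = 0 := by
    have hcl : IsClosed {τ | d τ - extend hT0 xg.1 τ = 0} := isClosed_eq hecc continuous_const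
    have := hcl.closure_subset_iff.2 (show Ioo 0 T ⊆ _ from heq)
    rw [closure_Ioo hT.ne] at this
    exact this
  have hxa : ∀ τ ∈ Icc 0 T, ev x τ = ev a.1 τ + rlIntegral α g τ := by
    intro τ hτ
    have h1 := heq' τ hτ
    simp only [hdd] at h1
    rw [extend_eq hT0 _ hτ, extend_eq hT0 _ hτ, extend_eq hT0 _ hτ, hxg τ hτ, sub_eq_zero] at h1
    rw [← h1]
    abel
  obtain ⟨Ca, ψa, hψa, hra⟩ := ev_control a
  have hrep : ∀ τ ∈ Icc 0 T, ev x τ = ev x 0 + rlIntegral α (fun ξ => ψa ξ + g ξ) τ := by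
    intro τ hτ
    rw [hxa τ hτ, hra τ hτ, hx0, rlIntegral_add hψa hg hα.1, add_assoc]
  refine ⟨⟨_, (hψa.add hg).memLp _, hrep⟩, hxw, ?_⟩
  filter_upwards [caputo_ae_eq hα hT0 (hψa.add hg) hrep, caputo_ae_eq hα hT0 hψa hra,
    caputo_free hα p] with τ h1 h2 h3 hτ
  have hτT : τ ∈ Icc 0 T := ⟨p.1.ht.1.trans hτ.1, hτ.2⟩
  rw [h1 hτT, ← h2 hτT, h3 hτ, zero_add]
  exact hg.norm_le τ

/-- Arzelà–Ascoli: prolongations differ from one fixed path by fractional integrals with a common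
bound and a common Hölder constant. -/
theorem isCompact_prolongs (hα : α ∈ Ioo (0 : ℝ) 1) (hC : 0 ≤ C) (hT : 0 < T)
    (p : GAlpha α T n) : IsCompact {x : AC α T n | Prolongs C p x} := by
  have hΓ := Real.Gamma_pos_of_pos (by linarith [hα.1] : 0 < α + 1)
  rw [Subtype.isCompact_iff]
  set A : Set C(Icc (0 : ℝ) T, Vec n) := Subtype.val '' {x : AC α T n | Prolongs C p x} with hA
  have hclosed : IsClosed A := by
    refine isClosed_of_closure_subset fun x hx => ?_
    rw [Metric.mem_closure_iff] at hx
    obtain ⟨h1, h2⟩ := prolongs_of_approx (x := x) hα hC hT (p := p) fun ε hε => by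
      obtain ⟨_, ⟨y, hy, rfl⟩, hd⟩ := hx ε hε
      exact ⟨y, hy, hd⟩
    exact ⟨⟨x, h1⟩, h2, rfl⟩
  set e := ContinuousMap.isometryEquivBoundedOfCompact (Icc (0 : ℝ) T) (Vec n) with he
  have hcomp : IsCompact (e '' A) := by
    refine BoundedContinuousFunction.arzela_ascoli₂
      (Metric.closedBall 0 (‖(free hα p).1‖ + C * T ^ α / Real.Gamma (α + 1)))
      (isCompact_closedBall _ _) _ (e.toHomeomorph.isClosedMap A hclosed) ?_ ?_
    · rintro _ τ ⟨_, ⟨y, hy, rfl⟩, rfl⟩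
      have hyp : Prolongs C p y := hy
      rw [mem_closedBall_zero_iff]
      have h1 : (e y.1) τ = ev y.1 τ := (ev_of_mem y.1 τ.2).symm
      rw [h1, hyp.ev_eq hα τ.2]
      refine (norm_add_le _ _).trans (add_le_add ?_ ?_)
      · rw [ev_of_mem _ τ.2]
        exact ContinuousMap.norm_coe_le_norm _ _
      · refine (norm_rlIntegral_le (isControl_cutCaputo hC _ _) ⟨hα.1, hα.2.le⟩ τ.2.1).trans ?_
        have := τ.2.1
        have := τ.2.2
        have := hα.1.le
        gcongr
    · intro τ₀
      rw [Metric.equicontinuousAt_iff]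
      intro ε hε
      have hcont : ContinuousAt (fun τ : Icc (0 : ℝ) T => ‖(free hα p).1 τ₀ - (free hα p).1 τ‖ +
          2 * C / Real.Gamma (α + 1) * |(τ₀ : ℝ) - τ| ^ α) τ₀ := by
        refine ContinuousAt.add (by fun_prop) (continuousAt_const.mul ?_)
        exact ContinuousAt.rpow_const (by fun_prop) (Or.inr hα.1.le)
      have hlim := hcont.tendsto
      simp only [sub_self, norm_zero, abs_zero, Real.zero_rpow hα.1.ne', mul_zero, add_zero]
        at hlim
      obtain ⟨δ, hδ, hlt⟩ := Metric.eventually_nhds_iff.1 (hlim.eventually (gt_mem_nhds hε))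
      refine ⟨δ, hδ, fun τ hτ => ?_⟩
      rintro ⟨_, _, ⟨y, hy, rfl⟩, rfl⟩
      have hyp : Prolongs C p y := hy
      refine lt_of_le_of_lt ?_ (hlt hτ)
      have h1 : ∀ τ : Icc (0 : ℝ) T, (e y.1) τ = (free hα p).1 τ +
          rlIntegral α (cutCaputo C p.1.t y) τ := by
        intro τ
        have : (e y.1) τ = ev y.1 τ := (ev_of_mem y.1 τ.2).symm
        rw [this, hyp.ev_eq hα τ.2, ev_of_mem _ τ.2]
      simp only
      rw [h1, h1, dist_eq_norm, add_sub_add_comm]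
      exact (norm_add_le _ _).trans (add_le_add le_rfl (norm_rlIntegral_sub_le
        (isControl_cutCaputo hC _ _) ⟨hα.1, hα.2.le⟩ τ.2.1 τ₀.2.1))
  have := e.toHomeomorph.isCompact_image.1 hcomp
  exact this

end FracHJ

end

/-! ### Dynamics: trajectories, a priori bounds, Picard iteration. -/

noncomputable section

namespace FracHJ

variable {n : ℕ} {α C T cH : ℝ} {H : ℝ → Vec n → Vec n → ℝ}

/-! ### Trajectories and characteristics -/

/-- The conditions imposed on the Hamiltonian. -/
structure IsHamiltonian (T cH : ℝ) (H : ℝ → Vec n → Vec n → ℝ) : Prop where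
  cont : ContinuousOn (fun q : ℝ × Vec n × Vec n => H q.1 q.2.1 q.2.2) (Icc (0 : ℝ) T ×ˢ univ)
  pos : 0 < cH
  lip_momentum : ∀ t ∈ Icc (0 : ℝ) T, ∀ x s s' : Vec n,
    |H t x s - H t x s'| ≤ cH * (1 + ‖x‖) * ‖s - s'‖
  lip_state : ∀ R : ℝ, 0 ≤ R → ∃ lam : ℝ, 0 < lam ∧ ∀ t ∈ Icc (0 : ℝ) T, ∀ x x' s : Vec n,
    ‖x‖ ≤ R → ‖x'‖ ≤ R → |H t x s - H t x' s| ≤ lam * (1 + ‖s‖) * ‖x - x'‖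

theorem IsHamiltonian.continuousOn_comp (hH : IsHamiltonian T cH H) {x : ℝ → Vec n}
    (hx : ContinuousOn x (Icc 0 T)) (s : Vec n) :
    ContinuousOn (fun τ => H τ (x τ) s) (Icc 0 T) :=
  hH.cont.comp (f := fun τ => (τ, x τ, s)) (by fun_prop) fun τ hτ => ⟨hτ, mem_univ _⟩

/-- The `x`-components of the characteristics issuing from `p`. -/
def Traj (cH : ℝ) (p : GAlpha α T n) : Set (AC α T n) :=
  {x | (∀ τ ∈ Icc (0 : ℝ) p.1.t, ev x.1 τ = ev p.1.w τ) ∧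
    ∀ᵐ τ, τ ∈ Icc p.1.t T → ‖caputo α x.1 τ‖ ≤ cH * (1 + ‖ev x.1 τ‖)}

/-- The integrand of the `z`-component of a characteristic. -/
def zRate (H : ℝ → Vec n → Vec n → ℝ) (s : Vec n) (x : AC α T n) (τ : ℝ) : ℝ :=
  inner ℝ s (caputo α x.1 τ) - H τ (ev x.1 τ) s

/-- The increment of the `z`-component of a characteristic. -/
def zInt (H : ℝ → Vec n → Vec n → ℝ) (s : Vec n) (x : AC α T n) (a b : ℝ) : ℝ :=
  ∫ τ in a..b, zRate H s x τ

theorem exists_zRate_bound (hα : α ∈ Ioo (0 : ℝ) 1) (hT : 0 ≤ T) (hH : IsHamiltonian T cH H)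
    (s : Vec n) (x : AC α T n) :
    ∃ B, 0 ≤ B ∧ ∀ᵐ τ, τ ∈ Icc 0 T → |zRate H s x τ| ≤ B := by
  obtain ⟨C, ψ, hψ, hr⟩ := ev_control x
  obtain ⟨B, hB⟩ := isCompact_Icc.exists_bound_of_continuousOn
    (hH.continuousOn_comp (continuousOn_ev x.1) s)
  have hC := hψ.nonneg
  have hB0 : 0 ≤ B := (norm_nonneg _).trans (hB 0 ⟨le_rfl, hT⟩)
  refine ⟨‖s‖ * C + B, by positivity, ?_⟩
  filter_upwards [caputo_ae_eq hα hT hψ hr] with τ h hτ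
  have h1 := abs_real_inner_le_norm s (caputo α x.1 τ)
  have h2 : ‖caputo α x.1 τ‖ ≤ C := by rw [h hτ]; exact hψ.norm_le τ
  have h3 := hB τ hτ
  rw [Real.norm_eq_abs] at h3
  refine (abs_sub _ _).trans (add_le_add (h1.trans ?_) h3)
  gcongr

theorem aestronglyMeasurable_zRate (hH : IsHamiltonian T cH H) (s : Vec n) (x : AC α T n) :
    AEStronglyMeasurable (zRate H s x) (volume.restrict (Icc 0 T)) := by
  refine AEStronglyMeasurable.sub ?_ ?_
  · exact (aestronglyMeasurable_const.inner (measurable_caputo x.1).aestronglyMeasurable)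
  · exact (hH.continuousOn_comp (continuousOn_ev x.1) s).aestronglyMeasurable measurableSet_Icc

theorem integrableOn_zRate (hα : α ∈ Ioo (0 : ℝ) 1) (hT : 0 ≤ T) (hH : IsHamiltonian T cH H)
    (s : Vec n) (x : AC α T n) : IntegrableOn (zRate H s x) (Icc 0 T) := by
  obtain ⟨B, -, hB⟩ := exists_zRate_bound hα hT hH s x
  refine Integrable.mono' (integrable_const B) (aestronglyMeasurable_zRate hH s x) ?_
  exact (ae_restrict_iff' measurableSet_Icc).2 hB

theorem intervalIntegrable_zRate (hα : α ∈ Ioo (0 : ℝ) 1) (hH : IsHamiltonian T cH H)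
    (s : Vec n) (x : AC α T n) {a b : ℝ} (ha : a ∈ Icc 0 T) (hb : b ∈ Icc 0 T) :
    IntervalIntegrable (zRate H s x) volume a b := by
  rw [intervalIntegrable_iff]
  exact (integrableOn_zRate hα (ha.1.trans ha.2) hH s x).mono_set
    (uIoc_subset_uIcc.trans (uIcc_subset_Icc ha hb))

theorem zInt_add (hα : α ∈ Ioo (0 : ℝ) 1) (hH : IsHamiltonian T cH H)
    (s : Vec n) (x : AC α T n) {a b c : ℝ} (ha : a ∈ Icc 0 T) (hb : b ∈ Icc 0 T)
    (hc : c ∈ Icc 0 T) : zInt H s x a b + zInt H s x b c = zInt H s x a c :=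
  intervalIntegral.integral_add_adjacent_intervals (intervalIntegrable_zRate hα hH s x ha hb)
    (intervalIntegrable_zRate hα hH s x hb hc)

/-- The Lipschitz condition on `z` makes it the integral of its derivative, so `z` is determined by
`x` and can be eliminated. `exists_mem_CH` is the converse. -/
theorem CH_spec {p : GAlpha α T n} {s : Vec n} {xz : AC α T n × C(Icc (0 : ℝ) T, ℝ)}
    (h : xz ∈ CH H cH p 0 s) :
    xz.1 ∈ Traj cH p ∧ ∀ t ∈ Icc p.1.t T, ev xz.2 t = zInt H s xz.1 p.1.t t := by
  obtain ⟨⟨K, hK⟩, hstart, hae⟩ := h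
  rw [ae_restrict_iff' measurableSet_Icc] at hae
  refine ⟨⟨fun τ hτ => (hstart τ hτ).1, ?_⟩, fun t ht => ?_⟩
  · filter_upwards [hae] with τ hτ hτ'
    exact (hτ hτ').1
  have hlip : LipschitzOnWith K (ev xz.2) (Icc 0 T) := by
    intro a ha b hb
    rw [ev_of_mem _ ha, ev_of_mem _ hb]
    exact hK ⟨a, ha⟩ ⟨b, hb⟩
  have hsub : uIcc p.1.t t ⊆ Icc 0 T := by
    rw [uIcc_of_le ht.1]
    exact Icc_subset_Icc p.1.ht.1 ht.2
  have hac : AbsolutelyContinuousOnInterval (ev xz.2) p.1.t t :=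
    (hlip.mono hsub).absolutelyContinuousOnInterval
  have h1 := hac.integral_deriv_eq_sub
  rw [(hstart p.1.t ⟨p.1.ht.1, le_rfl⟩).2, sub_zero] at h1
  rw [← h1, zInt]
  refine intervalIntegral.integral_congr_ae ?_
  filter_upwards [hae] with τ hτ hτ'
  rw [uIoc_of_le ht.1] at hτ'
  exact (hτ ⟨hτ'.1.le, hτ'.2.trans ht.2⟩).2

theorem exists_mem_CH (hα : α ∈ Ioo (0 : ℝ) 1) (hH : IsHamiltonian T cH H) {p : GAlpha α T n}
    (s : Vec n) {x : AC α T n} (hx : x ∈ Traj cH p) :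
    ∃ z : C(Icc (0 : ℝ) T, ℝ), (x, z) ∈ CH H cH p 0 s := by
  have hT : 0 ≤ T := p.1.ht.1.trans p.1.ht.2
  obtain ⟨B, hB0, hB⟩ := exists_zRate_bound hα hT hH s x
  set g : ℝ → ℝ := (Ioc p.1.t T).indicator (zRate H s x) with hg
  have hgi : Integrable g := by
    rw [hg, integrable_indicator_iff measurableSet_Ioc]
    exact (integrableOn_zRate hα hT hH s x).mono_set
      (Ioc_subset_Icc_self.trans (Icc_subset_Icc_left p.1.ht.1))
  have hgB : ∀ᵐ τ, |g τ| ≤ B := by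
    filter_upwards [hB] with τ hτ
    by_cases hm : τ ∈ Ioc p.1.t T
    · rw [hg, indicator_of_mem hm]
      exact hτ ⟨p.1.ht.1.trans hm.1.le, hm.2⟩
    · rw [hg, indicator_of_notMem hm]
      simpa using hB0
  set Z : ℝ → ℝ := fun t => ∫ τ in p.1.t..t, g τ with hZ
  have hlip : ∀ a b, dist (Z a) (Z b) ≤ B * dist a b := by
    intro a b
    rw [Real.dist_eq, Real.dist_eq, hZ]
    simp only
    rw [intervalIntegral.integral_interval_sub_left hgi.intervalIntegrable
      hgi.intervalIntegrable, ← Real.norm_eq_abs]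
    refine intervalIntegral.norm_integral_le_of_norm_le_const_ae ?_
    filter_upwards [hgB] with τ hτ _
    exact hτ
  have hlip' : LipschitzWith (Real.toNNReal B) Z :=
    LipschitzWith.of_dist_le_mul fun a b => by rw [Real.coe_toNNReal _ hB0]; exact hlip a b
  set z : C(Icc (0 : ℝ) T, ℝ) := ⟨fun τ => Z τ, hlip'.continuous.comp continuous_subtype_val⟩
    with hz
  have hev : ∀ τ ∈ Icc 0 T, ev z τ = Z τ := fun τ hτ => ev_of_mem z hτ
  refine ⟨z, ⟨Real.toNNReal B, fun a b => hlip' a b⟩, fun τ hτ => ⟨hx.1 τ hτ, ?_⟩, ?_⟩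
  · rw [hev τ ⟨hτ.1, hτ.2.trans p.1.ht.2⟩, hZ]
    refine intervalIntegral.integral_zero_ae ?_
    filter_upwards with ξ hξ
    rw [uIoc_of_ge hτ.2] at hξ
    rw [hg, indicator_of_notMem fun h => absurd h.1 (not_lt.2 hξ.2)]
  · rw [ae_restrict_iff' measurableSet_Icc]
    filter_upwards [hx.2, LocallyIntegrable.ae_hasDerivAt_integral hgi.locallyIntegrable,
      ae_mem_Ioo_of_mem_Icc p.1.t T] with t h1 h2 h3 ht
    refine ⟨h1 ht, ?_⟩
    have ht' := h3 ht
    have h4 : HasDerivAt Z (g t) t := h2 p.1.t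
    have h5 : HasDerivAt (ev z) (g t) t := by
      refine h4.congr_of_eventuallyEq ?_
      filter_upwards [Ioo_mem_nhds ht'.1 ht'.2] with r hr
      exact hev r ⟨p.1.ht.1.trans hr.1.le, hr.2.le⟩
    have hm : t ∈ Ioc p.1.t T := ⟨ht'.1, ht'.2.le⟩
    change deriv (ev z) t = zRate H s x t
    rw [h5.deriv, hg, indicator_of_mem hm]

/-! ### Histories -/

theorem gAlpha_ext {p q : GAlpha α T n} (ht : p.1.t = q.1.t)
    (h : ∀ τ ∈ Icc (0 : ℝ) p.1.t, ev p.1.w τ = ev q.1.w τ) : p = q := by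
  obtain ⟨⟨t, ht1, w⟩, hw⟩ := p
  obtain ⟨⟨t', ht2, w'⟩, hw'⟩ := q
  simp only at ht
  subst ht
  have : w = w' := ext_ev h
  subst this
  rfl

theorem ev_hist (x : AC α T n) {t : ℝ} (ht : t ∈ Icc (0 : ℝ) T) {τ : ℝ} (hτ : τ ∈ Icc 0 t) :
    ev (hist x t ht).1.w τ = ev x.1 τ := ev_restr ht x.1 hτ

theorem hist_eq_of_eqOn {p : GAlpha α T n} {x : AC α T n}
    (h : ∀ τ ∈ Icc (0 : ℝ) p.1.t, ev x.1 τ = ev p.1.w τ) : hist x p.1.t p.1.ht = p :=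
  gAlpha_ext rfl fun τ hτ => by rw [ev_hist x p.1.ht hτ, h τ hτ]

theorem hist_eq_terminal (hT : 0 < T) (x : AC α T n) (h : T ∈ Icc (0 : ℝ) T) :
    hist x T h = terminal hT x :=
  gAlpha_ext rfl fun τ hτ => by rw [ev_hist x h hτ]; rfl

/-- Concatenation of trajectories. -/
theorem Traj.concat {p : GAlpha α T n} {x y : AC α T n} (hx : x ∈ Traj cH p) {t : ℝ}
    (ht : t ∈ Icc (0 : ℝ) T) (hpt : p.1.t ≤ t) (hy : y ∈ Traj cH (hist x t ht)) :
    y ∈ Traj cH p ∧ ∀ τ ∈ Icc 0 t, ev y.1 τ = ev x.1 τ := by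
  have h1 : ∀ τ ∈ Icc 0 t, ev y.1 τ = ev x.1 τ := fun τ hτ => by
    rw [hy.1 τ hτ, ev_hist x ht hτ]
  refine ⟨⟨fun τ hτ => ?_, ?_⟩, h1⟩
  · rw [h1 τ ⟨hτ.1, hτ.2.trans hpt⟩, hx.1 τ hτ]
  · filter_upwards [hx.2, hy.2, ae_mem_Ioo_of_mem_Icc 0 t] with τ h2 h3 h4 hτ
    rcases le_or_gt τ t with hle | hlt
    · have h5 : τ ∈ Icc 0 t := ⟨p.1.ht.1.trans hτ.1, hle⟩
      rw [caputo_congr h1 (h4 h5), h1 τ h5]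
      exact h2 hτ
    · exact h3 ⟨hlt.le, hτ.2⟩

theorem zInt_congr {x y : AC α T n} {t a b : ℝ} (s : Vec n)
    (h : ∀ τ ∈ Icc 0 t, ev y.1 τ = ev x.1 τ) (ha : a ∈ Icc 0 t) (hb : b ∈ Icc 0 t) :
    zInt H s y a b = zInt H s x a b := by
  refine intervalIntegral.integral_congr_ae ?_
  filter_upwards [ae_mem_Ioo_of_mem_Icc 0 t] with τ h1 hτ
  have hm : τ ∈ Icc 0 t := uIcc_subset_Icc ha hb (uIoc_subset_uIcc hτ)
  rw [zRate, zRate, caputo_congr h (h1 hm), h τ hm]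

/-! ### A priori bounds -/

theorem Traj.prolongs {p : GAlpha α T n} {x : AC α T n} (hx : x ∈ Traj cH p) (hc : 0 ≤ cH) {R : ℝ}
    (hR : ∀ τ ∈ Icc 0 T, ‖ev x.1 τ‖ ≤ R) : Prolongs (cH * (1 + R)) p x := by
  refine ⟨hx.1, ?_⟩
  filter_upwards [hx.2] with τ h hτ
  refine (h hτ).trans ?_
  gcongr
  exact hR τ ⟨p.1.ht.1.trans hτ.1, hτ.2⟩

theorem norm_ev_le (x : C(Icc (0 : ℝ) T, Vec n)) {τ : ℝ} (hτ : τ ∈ Icc 0 T) : ‖ev x τ‖ ≤ ‖x‖ := by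
  rw [ev_of_mem x hτ]
  exact x.norm_coe_le_norm _

/-- `M` does not depend on `p`: the bound sees the history only through its free prolongation, and
so is uniform near a given point. -/
theorem exists_traj_bound (n : ℕ) (hα : α ∈ Ioo (0 : ℝ) 1) (hT : 0 ≤ T) (hc : 0 < cH) :
    ∃ M : ℝ, 1 ≤ M ∧ ∀ (p : GAlpha α T n) (A : ℝ), 0 ≤ A →
      (∀ τ ∈ Icc 0 T, ‖ev (free hα p).1 τ‖ ≤ A) → ∀ x ∈ Traj cH p, ∀ τ ∈ Icc 0 T,
        ‖ev x.1 τ‖ ≤ M * (1 + A) := by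
  obtain ⟨M, hM1, hM⟩ := exists_gronwall_bound (n := n) hα hT hc
  refine ⟨M, hM1, fun p A hA hfree x hx => ?_⟩
  have hp := Traj.prolongs hx hc.le (R := ‖x.1‖) fun τ hτ => norm_ev_le x.1 hτ
  refine hM A (ev (free hα p).1) (ev x.1) (cutCaputo (cH * (1 + ‖x.1‖)) p.1.t x) hA
    (continuousOn_ev x.1) hfree (fun t ht => hp.ev_eq hα ht) ?_
  filter_upwards [hx.2, hp.2] with τ h1 h2 hτ
  by_cases hm : τ ∈ Ioc p.1.t T
  · have hm' : τ ∈ Icc p.1.t T := ⟨hm.1.le, hm.2⟩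
    rw [cutCaputo_eq hm (h2 hm')]
    exact h1 hm'
  · rw [cutCaputo_eq_zero hm, norm_zero]
    positivity

/-! ### Existence of trajectories -/

/-- Banach's fixed point theorem for `v τ = e^{-Kτ} x τ` in the uniform norm. The field is Lipschitz
only on bounded sets, so linear growth must first provide an invariant set. -/
theorem exists_traj_of_field (hα : α ∈ Ioo (0 : ℝ) 1) {c : ℝ} (hc : 0 < c) (p : GAlpha α T n)
    {f : ℝ → Vec n → Vec n}
    (hf : ContinuousOn (fun q : ℝ × Vec n => f q.1 q.2) (Icc (0 : ℝ) T ×ˢ univ))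
    (hgrowth : ∀ t ∈ Icc 0 T, ∀ x, ‖f t x‖ ≤ c * (1 + ‖x‖))
    (hlip : ∀ R : ℝ, 0 ≤ R → ∃ L : ℝ, 0 < L ∧ ∀ t ∈ Icc 0 T, ∀ x x', ‖x‖ ≤ R → ‖x'‖ ≤ R →
      ‖f t x - f t x'‖ ≤ L * ‖x - x'‖) :
    ∃ x : AC α T n, (∀ τ ∈ Icc (0 : ℝ) p.1.t, ev x.1 τ = ev p.1.w τ) ∧
      ∀ᵐ τ, τ ∈ Icc p.1.t T → caputo α x.1 τ = f τ (ev x.1 τ) := by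
  have hT : 0 ≤ T := p.1.ht.1.trans p.1.ht.2
  set a := free hα p with ha
  set A := ‖a.1‖ with hA
  have hA0 : 0 ≤ A := norm_nonneg _
  -- `S` solves `A + (1 + S)/2 = S`, which makes the set `W` invariant. The rate `K₁` handles growth
  -- and defines `W`; `L` is the Lipschitz constant on the resulting ball; only then is `K` chosen
  -- to give contraction factor `1/2`.
  set S := 2 * A + 1 with hS
  obtain ⟨K₁, hK₁, hK₁c⟩ := exists_rpow_neg_le (β := α) hα.1 (η := 1 / (2 * c)) (by positivity)
  obtain ⟨L, hL, hlip⟩ := hlip (S * Real.exp (K₁ * T)) (by positivity)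
  obtain ⟨K, hK, hKL⟩ := exists_rpow_neg_le (β := α) hα.1 (η := 1 / (2 * L)) (by positivity)
  -- the right-hand side along a weighted function, extended by constants
  set g : C(Icc (0 : ℝ) T, Vec n) → ℝ → Vec n := fun v ξ =>
    f (projIcc 0 T hT ξ) (Real.exp (K * projIcc 0 T hT ξ) • v (projIcc 0 T hT ξ)) with hg
  have hgcont : ∀ v, Continuous (g v) := by
    intro v
    have h1 : Continuous fun ξ : ℝ => ((projIcc 0 T hT ξ : ℝ),
        Real.exp (K * projIcc 0 T hT ξ) • v (projIcc 0 T hT ξ)) := by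
      have : Continuous (projIcc 0 T hT) := continuous_projIcc
      fun_prop
    exact hf.comp_continuous h1 fun ξ => ⟨(projIcc 0 T hT ξ).2, mem_univ _⟩
  have hgeq : ∀ v, ∀ ξ ∈ Icc 0 T, g v ξ = f ξ (Real.exp (K * ξ) • ev v ξ) := by
    intro v ξ hξ
    simp only [hg, projIcc_of_mem hT hξ, ev_of_mem v hξ]
  have hgb : ∀ v, ∃ B, ∀ ξ, ‖g v ξ‖ ≤ B := by
    intro v
    refine ⟨c * (1 + Real.exp (K * T) * ‖v‖), fun ξ => ?_⟩
    refine (hgrowth _ (projIcc 0 T hT ξ).2 _).trans ?_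
    rw [norm_smul, Real.norm_of_nonneg (Real.exp_pos _).le]
    have h1 := v.norm_coe_le_norm (projIcc 0 T hT ξ)
    have h2 := (projIcc 0 T hT ξ).2.2
    gcongr
  choose B hB using hgb
  set F : C(Icc (0 : ℝ) T, Vec n) → ℝ → Vec n := fun v => (Ioi p.1.t).indicator (g v) with hF
  have hFc : ∀ v, IsControl (B v) (F v) := fun v =>
    IsControl.indicator ⟨(hgcont v).measurable, hB v⟩ measurableSet_Ioi
  have hΦc : ∀ v, Continuous fun τ : Icc (0 : ℝ) T =>
      Real.exp (-(K * τ)) • (a.1 τ + rlIntegral α (F v) τ) := by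
    intro v
    have h1 : Continuous fun τ : Icc (0 : ℝ) T => rlIntegral α (F v) τ :=
      (continuousOn_rlIntegral (hFc v) ⟨hα.1, hα.2.le⟩).comp_continuous continuous_subtype_val
        fun τ => τ.2.1
    fun_prop
  set Φ : C(Icc (0 : ℝ) T, Vec n) → C(Icc (0 : ℝ) T, Vec n) := fun v => ⟨_, hΦc v⟩ with hΦ
  set W : Set C(Icc (0 : ℝ) T, Vec n) :=
    {v | ∀ τ : Icc (0 : ℝ) T, Real.exp (K * τ) * ‖v τ‖ ≤ S * Real.exp (K₁ * τ)} with hW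
  have hWclosed : IsClosed W := by
    rw [hW, ofPred_forall]
    refine isClosed_iInter fun τ => isClosed_le ?_ continuous_const
    exact continuous_const.mul (continuous_eval_const τ).norm
  have hexp : ∀ t : ℝ, Real.exp (K * t) * Real.exp (-(K * t)) = 1 := fun t => by
    rw [← Real.exp_add]; simp
  have hmaps : MapsTo Φ W W := by
    intro v hv τ
    have h1 : Real.exp (K * τ) * ‖Φ v τ‖ = ‖a.1 τ + rlIntegral α (F v) τ‖ := by
      simp only [hΦ, ContinuousMap.coe_mk]
      rw [norm_smul, Real.norm_of_nonneg (Real.exp_pos _).le, ← mul_assoc, hexp, one_mul]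
    rw [h1]
    have h2 : ‖rlIntegral α (F v) τ‖ ≤ (c * (1 + S)) * K₁ ^ (-α) * Real.exp (K₁ * τ) := by
      refine norm_rlIntegral_le_exp hα.1 hK₁ (by positivity) τ.2.1 ?_
      filter_upwards with ξ hξ
      have hξT : ξ ∈ Icc 0 T := ⟨hξ.1.le, hξ.2.trans τ.2.2⟩
      have h3 : ‖F v ξ‖ ≤ ‖g v ξ‖ := norm_indicator_le_norm_self _ _
      refine h3.trans ?_
      rw [hgeq v ξ hξT]
      refine (hgrowth ξ hξT _).trans ?_
      rw [norm_smul, Real.norm_of_nonneg (Real.exp_pos _).le, mul_assoc]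
      have h4 := hv ⟨ξ, hξT⟩
      rw [ev_of_mem v hξT]
      have h5 : 1 ≤ Real.exp (K₁ * ξ) := Real.one_le_exp (mul_nonneg hK₁.le hξT.1)
      gcongr
      simp only at h4
      linarith
    have h6 : 1 ≤ Real.exp (K₁ * τ) := Real.one_le_exp (mul_nonneg hK₁.le τ.2.1)
    have h7 : c * (1 + S) * K₁ ^ (-α) ≤ (1 + S) / 2 := by
      calc _ ≤ c * (1 + S) * (1 / (2 * c)) := by gcongr
        _ = _ := by field_simp
    calc _ ≤ A + (c * (1 + S)) * K₁ ^ (-α) * Real.exp (K₁ * τ) :=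
          (norm_add_le _ _).trans (add_le_add (a.1.norm_coe_le_norm τ) h2)
      _ ≤ A * Real.exp (K₁ * τ) + (1 + S) / 2 * Real.exp (K₁ * τ) := by
          gcongr
          nlinarith
      _ = S * Real.exp (K₁ * τ) := by rw [hS]; ring
  have hcontr : ContractingWith (1 / 2) (hmaps.restrict Φ W W) := by
    refine ⟨by rw [← NNReal.coe_lt_coe]; norm_num, LipschitzWith.of_dist_le_mul ?_⟩
    rintro ⟨v, hv⟩ ⟨u, hu⟩
    have e : dist (hmaps.restrict Φ W W ⟨v, hv⟩) (hmaps.restrict Φ W W ⟨u, hu⟩) =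
        dist (Φ v) (Φ u) := rfl
    have e' : dist (⟨v, hv⟩ : W) ⟨u, hu⟩ = dist v u := rfl
    rw [e, e', ContinuousMap.dist_le (by positivity)]
    intro τ
    have h1 : Φ v τ - Φ u τ = Real.exp (-(K * τ)) • rlIntegral α (fun ξ => F v ξ - F u ξ) τ := by
      simp only [hΦ, ContinuousMap.coe_mk]
      rw [rlIntegral_sub (hFc v) (hFc u) hα.1, ← smul_sub]
      congr 1
      abel
    have h2 : ‖rlIntegral α (fun ξ => F v ξ - F u ξ) τ‖ ≤
        (L * dist v u) * K ^ (-α) * Real.exp (K * τ) := by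
      refine norm_rlIntegral_le_exp hα.1 hK (by positivity) τ.2.1 ?_
      filter_upwards with ξ hξ
      have hξT : ξ ∈ Icc 0 T := ⟨hξ.1.le, hξ.2.trans τ.2.2⟩
      have h3 : ‖F v ξ - F u ξ‖ ≤ ‖g v ξ - g u ξ‖ := by
        simp only [hF]
        by_cases hm : ξ ∈ Ioi p.1.t
        · rw [indicator_of_mem hm, indicator_of_mem hm]
        · rw [indicator_of_notMem hm, indicator_of_notMem hm, sub_zero, norm_zero]
          positivity
      have hbd : ∀ v ∈ W, ‖Real.exp (K * ξ) • ev v ξ‖ ≤ S * Real.exp (K₁ * T) := by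
        intro v hv
        have h4 := hv ⟨ξ, hξT⟩
        rw [norm_smul, Real.norm_of_nonneg (Real.exp_pos _).le, ev_of_mem v hξT]
        refine h4.trans ?_
        have := hξT.2
        gcongr
      refine h3.trans ?_
      rw [hgeq v ξ hξT, hgeq u ξ hξT]
      refine (hlip ξ hξT _ _ (hbd v hv) (hbd u hu)).trans ?_
      rw [← smul_sub, norm_smul, Real.norm_of_nonneg (Real.exp_pos _).le, ev_of_mem v hξT,
        ev_of_mem u hξT, ← dist_eq_norm, mul_assoc, mul_comm (dist v u)]
      gcongr
      exact ContinuousMap.dist_apply_le_dist _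
    rw [dist_eq_norm, h1, norm_smul, Real.norm_of_nonneg (Real.exp_pos _).le]
    calc _ ≤ Real.exp (-(K * τ)) * ((L * dist v u) * K ^ (-α) * Real.exp (K * τ)) := by gcongr
      _ = (L * dist v u) * K ^ (-α) * (Real.exp (K * τ) * Real.exp (-(K * τ))) := by ring
      _ ≤ (L * dist v u) * (1 / (2 * L)) := by rw [hexp, mul_one]; gcongr
      _ = _ := by push_cast; field_simp
  have h0W : (0 : C(Icc (0 : ℝ) T, Vec n)) ∈ W := by
    intro τ
    simp only [ContinuousMap.zero_apply, norm_zero, mul_zero]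
    positivity
  obtain ⟨v, -, hv, -⟩ := hcontr.exists_fixedPoint' hWclosed.isComplete hmaps h0W
    (edist_ne_top _ _)
  obtain ⟨x, hx1, hx2⟩ := exists_prolongation hα p (f := g v) ⟨(hgcont v).measurable, hB v⟩
  have hxv : ∀ τ ∈ Icc 0 T, ev x.1 τ = Real.exp (K * τ) • ev v τ := by
    intro τ hτ
    have h1 : v ⟨τ, hτ⟩ = Real.exp (-(K * τ)) • (a.1 ⟨τ, hτ⟩ + rlIntegral α (F v) τ) := by
      conv_lhs => rw [← hv.eq]
      rfl
    rw [ev_of_mem v hτ, h1, smul_smul, hexp, one_smul, ← ev_of_mem a.1 hτ]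
    refine ev_eq_add_rlIntegral hα hT p.1.ht.1
      (fun τ hτ _ => by rw [hx1 τ hτ, ha, free_eq hα p hτ]) ?_ ?_ hτ
    · filter_upwards with ξ _ hξ
      simp only [hF]
      rw [indicator_of_notMem (by simpa using hξ)]
    · filter_upwards [hx2, caputo_free hα p] with ξ h1 h2 hξ hξ'
      have : ξ ∈ Icc p.1.t T := ⟨hξ'.le, hξ.2⟩
      simp only [hF]
      rw [h1 this, ha, h2 this, sub_zero, indicator_of_mem (mem_Ioi.2 hξ')]
  refine ⟨x, hx1, ?_⟩
  filter_upwards [hx2] with τ h hτ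
  have hτT : τ ∈ Icc 0 T := ⟨p.1.ht.1.trans hτ.1, hτ.2⟩
  rw [h hτ, hgeq v τ hτT, hxv τ hτT]

/-- Two momenta have a common characteristic. -/
theorem exists_common_traj (hα : α ∈ Ioo (0 : ℝ) 1) (hH : IsHamiltonian T cH H)
    (p : GAlpha α T n) (s s' : Vec n) :
    ∃ x ∈ Traj cH p, ∀ a ∈ Icc p.1.t T, ∀ b ∈ Icc p.1.t T, zInt H s x a b = zInt H s' x a b := by
  -- The shortest vector with `⟨s - s', f⟩ = H(t, x, s) - H(t, x, s')`, so both momenta yield the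
  -- same rate of `z`. (H.2) is exactly the bound that makes it admissible. For `s = s'` division by
  -- zero gives `f = 0`, as needed.
  set f : ℝ → Vec n → Vec n := fun t x =>
    ((H t x s - H t x s') / ‖s - s'‖ ^ 2) • (s - s') with hf
  have hcont : ∀ s : Vec n,
      ContinuousOn (fun q : ℝ × Vec n => H q.1 q.2 s) (Icc (0 : ℝ) T ×ˢ univ) := fun s =>
    hH.cont.comp (f := fun q : ℝ × Vec n => (q.1, q.2, s)) (by fun_prop)
      fun q hq => ⟨hq.1, mem_univ _⟩
  have hnf : ∀ r : ℝ, ‖(r / ‖s - s'‖ ^ 2) • (s - s')‖ = |r| / ‖s - s'‖ := by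
    intro r
    rw [norm_smul, Real.norm_eq_abs, abs_div, abs_of_nonneg (sq_nonneg ‖s - s'‖)]
    rcases eq_or_ne ‖s - s'‖ 0 with h | h
    · simp [h]
    · field_simp
  have hgrowth : ∀ t ∈ Icc 0 T, ∀ x, ‖f t x‖ ≤ cH * (1 + ‖x‖) := by
    intro t ht x
    simp only [hf]
    rw [hnf]
    have hc := hH.pos
    exact div_le_of_le_mul₀ (norm_nonneg _) (by positivity) (hH.lip_momentum t ht x s s')
  obtain ⟨x, hx1, hx2⟩ := exists_traj_of_field hα hH.pos p (f := f) (by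
    exact (((hcont s).sub (hcont s')).div_const _).smul continuousOn_const) hgrowth (by
    intro R hR
    obtain ⟨lam, hlam, hl⟩ := hH.lip_state R hR
    -- The summand `1` only keeps the constant positive when `s = s'`.
    refine ⟨lam * (2 + ‖s‖ + ‖s'‖) / ‖s - s'‖ + 1, by positivity, fun t ht x x' hx hx' => ?_⟩
    have e : f t x - f t x' =
        (((H t x s - H t x' s) - (H t x s' - H t x' s')) / ‖s - s'‖ ^ 2) • (s - s') := by
      simp only [hf]
      rw [← sub_smul]
      congr 1
      ring
    rw [e, hnf]
    have h1 := hl t ht x x' s hx hx'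
    have h2 := hl t ht x x' s' hx hx'
    have h3 : |(H t x s - H t x' s) - (H t x s' - H t x' s')| ≤
        lam * (2 + ‖s‖ + ‖s'‖) * ‖x - x'‖ := by
      refine (abs_sub _ _).trans ((add_le_add h1 h2).trans (le_of_eq ?_))
      ring
    calc _ ≤ lam * (2 + ‖s‖ + ‖s'‖) * ‖x - x'‖ / ‖s - s'‖ := by gcongr
      _ = lam * (2 + ‖s‖ + ‖s'‖) / ‖s - s'‖ * ‖x - x'‖ := by ring
      _ ≤ _ := by
        gcongr
        linarith)
  refine ⟨x, ⟨hx1, ?_⟩, fun a ha b hb => ?_⟩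
  · filter_upwards [hx2] with τ h hτ
    rw [h hτ]
    exact hgrowth τ ⟨p.1.ht.1.trans hτ.1, hτ.2⟩ _
  · refine intervalIntegral.integral_congr_ae ?_
    filter_upwards [hx2] with τ h hτ
    have hm : τ ∈ Icc p.1.t T := uIcc_subset_Icc ha hb (uIoc_subset_uIcc hτ)
    rw [zRate, zRate, h hm]
    have : inner ℝ (s - s') (f τ (ev x.1 τ)) = H τ (ev x.1 τ) s - H τ (ev x.1 τ) s' := by
      simp only [hf]
      rw [real_inner_smul_right, real_inner_self_eq_norm_sq]
      rcases eq_or_ne s s' with rfl | hne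
      · simp
      · have : ‖s - s'‖ ≠ 0 := norm_ne_zero_iff.2 (sub_ne_zero.2 hne)
        field_simp
    rw [inner_sub_left] at this
    linarith

end FracHJ

end

/-! ### Comparison I: a pair of trajectories driven by a penalizing momentum. -/

noncomputable section

open Filter

namespace FracHJ

variable {n : ℕ} {α C T cH : ℝ} {H : ℝ → Vec n → Vec n → ℝ}

/-! ### Stability -/

/-- The stability property of upper solutions in terms of trajectories. -/
def UpStable (H : ℝ → Vec n → Vec n → ℝ) (cH : ℝ) (φ : GAlpha α T n → ℝ) : Prop :=
  ∀ p : GAlpha α T n, ∀ t (ht : t ∈ Icc (0 : ℝ) T), p.1.t < t → ∀ s : Vec n, ∀ ε > 0,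
    ∃ x ∈ Traj cH p, φ (hist x t ht) - zInt H s x p.1.t t ≤ φ p + ε

/-- The stability property of lower solutions in terms of trajectories. -/
def LowStable (H : ℝ → Vec n → Vec n → ℝ) (cH : ℝ) (φ : GAlpha α T n → ℝ) : Prop :=
  ∀ p : GAlpha α T n, ∀ t (ht : t ∈ Icc (0 : ℝ) T), p.1.t < t → ∀ s : Vec n, ∀ ε > 0,
    ∃ x ∈ Traj cH p, φ p - ε ≤ φ (hist x t ht) - zInt H s x p.1.t t

/-- Stability restarted at an intermediate history and concatenated with the past, so that all
trajectories issue from the same `p`. The degenerate case `t = t'` is allowed. -/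
theorem UpStable.step {φ : GAlpha α T n → ℝ} (hφ : UpStable H cH φ) {p : GAlpha α T n}
    {x : AC α T n} (hx : x ∈ Traj cH p) {t t' : ℝ} (ht : t ∈ Icc (0 : ℝ) T)
    (ht' : t' ∈ Icc (0 : ℝ) T) (hpt : p.1.t ≤ t) (htt' : t ≤ t') (s : Vec n) {ε : ℝ} (hε : 0 < ε) :
    ∃ y ∈ Traj cH p, (∀ τ ∈ Icc 0 t, ev y.1 τ = ev x.1 τ) ∧
      φ (hist y t' ht') ≤ φ (hist x t ht) + zInt H s y t t' + ε := by
  rcases htt'.eq_or_lt with rfl | hlt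
  · refine ⟨x, hx, fun _ _ => rfl, ?_⟩
    simp only [zInt, intervalIntegral.integral_same]
    linarith
  · obtain ⟨y, hy, h1⟩ := hφ (hist x t ht) t' ht' hlt s ε hε
    obtain ⟨h2, h3⟩ := Traj.concat hx ht hpt hy
    refine ⟨y, h2, h3, ?_⟩
    have h4 : zInt H s y (hist x t ht).1.t t' = zInt H s y t t' := rfl
    linarith

theorem LowStable.step {φ : GAlpha α T n → ℝ} (hφ : LowStable H cH φ) {p : GAlpha α T n}
    {x : AC α T n} (hx : x ∈ Traj cH p) {t t' : ℝ} (ht : t ∈ Icc (0 : ℝ) T)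
    (ht' : t' ∈ Icc (0 : ℝ) T) (hpt : p.1.t ≤ t) (htt' : t ≤ t') (s : Vec n) {ε : ℝ} (hε : 0 < ε) :
    ∃ y ∈ Traj cH p, (∀ τ ∈ Icc 0 t, ev y.1 τ = ev x.1 τ) ∧
      φ (hist x t ht) ≤ φ (hist y t' ht') - zInt H s y t t' + ε := by
  rcases htt'.eq_or_lt with rfl | hlt
  · refine ⟨x, hx, fun _ _ => rfl, ?_⟩
    simp only [zInt, intervalIntegral.integral_same]
    linarith
  · obtain ⟨y, hy, h1⟩ := hφ (hist x t ht) t' ht' hlt s ε hε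
    obtain ⟨h2, h3⟩ := Traj.concat hx ht hpt hy
    refine ⟨y, h2, h3, ?_⟩
    have h4 : zInt H s y (hist x t ht).1.t t' = zInt H s y t t' := rfl
    linarith

/-! ### Energy density along a pair of trajectories -/

/-- The integrand that the weighted positivity of the fractional integral makes negative in the
mean. -/
def energyDensity (α lam K : ℝ) (ψ : ℝ → Vec n) (τ : ℝ) : ℝ :=
  Real.exp (-(K * τ)) * (3 * lam * ‖rlIntegral α ψ τ‖ ^ 2 - 2 * inner ℝ (rlIntegral α ψ τ) (ψ τ))

theorem intervalIntegrable_weight_sq (hα : α ∈ Ioo (0 : ℝ) 1) {ψ : ℝ → Vec n} (h : IsControl C ψ)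
    (K : ℝ) {a b : ℝ} (ha : 0 ≤ a) (hb : 0 ≤ b) :
    IntervalIntegrable (fun τ => Real.exp (-(K * τ)) * ‖rlIntegral α ψ τ‖ ^ 2) volume a b := by
  refine ContinuousOn.intervalIntegrable ?_
  have h1 : ContinuousOn (rlIntegral α ψ) (uIcc a b) :=
    (continuousOn_rlIntegral h ⟨hα.1, hα.2.le⟩).mono fun τ hτ => (le_min ha hb).trans hτ.1
  fun_prop

theorem intervalIntegrable_weight_inner (hα : α ∈ Ioo (0 : ℝ) 1) {ψ : ℝ → Vec n}
    (h : IsControl C ψ) (K : ℝ) {a b : ℝ} (ha : 0 ≤ a) (hb : 0 ≤ b) :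
    IntervalIntegrable (fun τ => Real.exp (-(K * τ)) * inner ℝ (rlIntegral α ψ τ) (ψ τ))
      volume a b := by
  have h1 : ContinuousOn (rlIntegral α ψ) (uIcc a b) :=
    (continuousOn_rlIntegral h ⟨hα.1, hα.2.le⟩).mono fun τ hτ => (le_min ha hb).trans hτ.1
  have h2 : ContinuousOn (fun τ => Real.exp (-(K * τ)) * ‖rlIntegral α ψ τ‖) (uIcc a b) := by
    fun_prop
  refine (h2.intervalIntegrable.mul_const C).mono_fun ?_ ?_
  · refine AEStronglyMeasurable.mul (by fun_prop) ?_
    exact ((h1.mono uIoc_subset_uIcc).aestronglyMeasurable measurableSet_uIoc).inner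
      h.measurable.aestronglyMeasurable
  · filter_upwards with τ
    have hC := h.nonneg
    rw [norm_mul, Real.norm_of_nonneg (Real.exp_pos _).le, Real.norm_of_nonneg
      (by positivity : 0 ≤ Real.exp (-(K * τ)) * ‖rlIntegral α ψ τ‖ * C), mul_assoc]
    gcongr
    exact (norm_inner_le_norm _ _).trans (by gcongr; exact h.norm_le τ)

theorem energyDensity_eq (lam K : ℝ) (ψ : ℝ → Vec n) (τ : ℝ) :
    energyDensity α lam K ψ τ = 3 * lam * (Real.exp (-(K * τ)) * ‖rlIntegral α ψ τ‖ ^ 2) -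
      2 * (Real.exp (-(K * τ)) * inner ℝ (rlIntegral α ψ τ) (ψ τ)) := by
  rw [energyDensity]; ring

theorem intervalIntegrable_energyDensity (hα : α ∈ Ioo (0 : ℝ) 1) {ψ : ℝ → Vec n}
    (h : IsControl C ψ) (lam K : ℝ) {a b : ℝ} (ha : 0 ≤ a) (hb : 0 ≤ b) :
    IntervalIntegrable (energyDensity α lam K ψ) volume a b := by
  have := ((intervalIntegrable_weight_sq hα h K ha hb).const_mul (3 * lam)).sub
    ((intervalIntegrable_weight_inner hα h K ha hb).const_mul 2)
  refine this.congr fun τ _ => ?_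
  rw [energyDensity_eq]

theorem integral_energyDensity_congr {lam K : ℝ} {ψ ψ' : ℝ → Vec n} {a b : ℝ} (ha : 0 ≤ a)
    (hab : a ≤ b) (h : ∀ᵐ τ, τ ∈ Ioc 0 b → ψ τ = ψ' τ) :
    ∫ τ in a..b, energyDensity α lam K ψ τ = ∫ τ in a..b, energyDensity α lam K ψ' τ := by
  refine intervalIntegral.integral_congr_ae ?_
  filter_upwards [h] with τ hτ hτ'
  rw [uIoc_of_le hab] at hτ'
  have h0 : 0 < τ := lt_of_le_of_lt ha hτ'.1
  have e : rlIntegral α ψ τ = rlIntegral α ψ' τ := by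
    refine rlIntegral_congr_ae h0.le ?_
    filter_upwards [h] with ξ hξ hξ'
    exact hξ ⟨hξ'.1, hξ'.2.trans hτ'.2⟩
  have hψ := hτ ⟨h0, hτ'.2⟩
  rw [energyDensity, energyDensity, hψ, e]

/-- The difference of the controls of two trajectories. -/
def pairControl (C : ℝ) (p q : GAlpha α T n) (x y : AC α T n) (τ : ℝ) : Vec n :=
  cutCaputo C p.1.t x τ - cutCaputo C q.1.t y τ

theorem isControl_pairControl (hC : 0 ≤ C) (p q : GAlpha α T n) (x y : AC α T n) :
    IsControl (C + C) (pairControl C p q x y) :=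
  (isControl_cutCaputo hC _ _).sub (isControl_cutCaputo hC _ _)

theorem cutCaputo_congr {x x' : AC α T n} {b t : ℝ} (h : ∀ τ ∈ Icc 0 t, ev x'.1 τ = ev x.1 τ)
    {τ : ℝ} (hτ : τ ∈ Ioo 0 t) : cutCaputo C b x' τ = cutCaputo C b x τ := by
  have := caputo_congr (α := α) h hτ
  by_cases hm : τ ∈ Ioc b T
  · simp only [cutCaputo, indicator_of_mem hm, this]
  · rw [cutCaputo_eq_zero hm, cutCaputo_eq_zero hm]

theorem pairControl_congr {p q : GAlpha α T n} {x x' y y' : AC α T n} {t : ℝ}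
    (hx : ∀ τ ∈ Icc 0 t, ev x'.1 τ = ev x.1 τ) (hy : ∀ τ ∈ Icc 0 t, ev y'.1 τ = ev y.1 τ) :
    ∀ᵐ τ, τ ∈ Ioc 0 t → pairControl C p q x' y' τ = pairControl C p q x y τ := by
  filter_upwards [ae_mem_Ioo_of_mem_Icc 0 t] with τ h hτ
  have := h ⟨hτ.1.le, hτ.2⟩
  rw [pairControl, pairControl, cutCaputo_congr hx this, cutCaputo_congr hy this]

/-- Here `s` is within `ω` of the ideal momentum `-(2/ε) c r`. In (H.3) the factor `‖s‖` gives two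
units of `lam * c/ε * ‖r‖²`. The linear term `lam * ‖r‖` gives a third one by Young's inequality, at
the price `lam * ε * Q / 4`; hence the coefficient 3. -/
theorem rate_estimate {r f s X Y : Vec n} {c ε lam β B Q ω R D hX hY : ℝ} (hc : 0 < c)
    (hε : 0 < ε) (hlam : 0 < lam) (hβ : 0 ≤ β) (hc1 : c ≤ 1) (hQ : c⁻¹ ≤ Q) (hr : ‖r‖ ≤ B)
    (hf : ‖f‖ ≤ D) (hω : ‖s - (-(2 / ε * c)) • r‖ ≤ ω) (hXY : ‖X - Y‖ ≤ ‖r‖ + β)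
    (hR : ‖X - Y‖ ≤ R) (hH : |hX - hY| ≤ lam * (1 + ‖s‖) * ‖X - Y‖) :
    inner ℝ s f - (hX - hY) ≤ 1 / ε * (c * (3 * lam * ‖r‖ ^ 2 - 2 * inner ℝ r f)) +
      (lam * ε * Q / 4 + β * lam * (1 + 2 / ε * B) + ω * (D + lam * R)) := by
  have hω0 : 0 ≤ ω := (norm_nonneg _).trans hω
  have hB0 : 0 ≤ B := (norm_nonneg _).trans hr
  have h1 : inner ℝ s f = -(2 / ε * c) * inner ℝ r f + inner ℝ (s - (-(2 / ε * c)) • r) f := by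
    rw [inner_sub_left, real_inner_smul_left]; ring
  have h2 : inner ℝ (s - (-(2 / ε * c)) • r) f ≤ ω * D :=
    (real_inner_le_norm _ _).trans (mul_le_mul hω hf (norm_nonneg _) hω0)
  have h3 : ‖s‖ ≤ 2 / ε * c * ‖r‖ + ω := by
    calc ‖s‖ = ‖(s - (-(2 / ε * c)) • r) + (-(2 / ε * c)) • r‖ := by congr 1; abel
      _ ≤ ω + 2 / ε * c * ‖r‖ := by
        refine (norm_add_le _ _).trans (add_le_add hω ?_)
        rw [norm_smul, norm_neg, Real.norm_of_nonneg (by positivity)]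
      _ = _ := by ring
  have h4 : -(hX - hY) ≤ lam * (1 + ‖s‖) * ‖X - Y‖ := (neg_le_abs _).trans hH
  have h5 : lam * (1 + ‖s‖) * ‖X - Y‖ ≤ lam * (1 + 2 / ε * c * ‖r‖) * (‖r‖ + β) + lam * ω * R := by
    calc lam * (1 + ‖s‖) * ‖X - Y‖ ≤ lam * (1 + (2 / ε * c * ‖r‖ + ω)) * ‖X - Y‖ := by gcongr
      _ = lam * (1 + 2 / ε * c * ‖r‖) * ‖X - Y‖ + lam * ω * ‖X - Y‖ := by ring
      _ ≤ _ := by gcongr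
  have h6 : β * lam * (1 + 2 / ε * c * ‖r‖) ≤ β * lam * (1 + 2 / ε * B) := by
    have : c * ‖r‖ ≤ B := (mul_le_of_le_one_left (norm_nonneg _) hc1).trans hr
    rw [mul_assoc (2 / ε)]
    gcongr
  have h7 : ‖r‖ ≤ c / ε * ‖r‖ ^ 2 + ε * Q / 4 := by
    have h8 : ‖r‖ ≤ c / ε * ‖r‖ ^ 2 + ε * c⁻¹ / 4 := by
      have h9 : 0 ≤ c / ε * (‖r‖ - ε * c⁻¹ / 2) ^ 2 := by positivity
      have e : c / ε * (‖r‖ - ε * c⁻¹ / 2) ^ 2 = c / ε * ‖r‖ ^ 2 - ‖r‖ + ε * c⁻¹ / 4 := by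
        field_simp; ring
      linarith
    have : ε * c⁻¹ / 4 ≤ ε * Q / 4 := by gcongr
    linarith
  have h10 := mul_le_mul_of_nonneg_left h7 hlam.le
  have e1 : lam * (1 + 2 / ε * c * ‖r‖) * (‖r‖ + β) = lam * ‖r‖ + 2 * lam * (c / ε * ‖r‖ ^ 2) +
      β * lam * (1 + 2 / ε * c * ‖r‖) := by ring
  have e2 : 1 / ε * (c * (3 * lam * ‖r‖ ^ 2 - 2 * inner ℝ r f)) =
      3 * lam * (c / ε * ‖r‖ ^ 2) - 2 / ε * c * inner ℝ r f := by ring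
  rw [h1, e2]
  linarith

/-! ### The chain of characteristics -/

/-- One step of the construction of a pair of trajectories with controlled difference. -/
theorem chain_step (hα : α ∈ Ioo (0 : ℝ) 1) (hH : IsHamiltonian T cH H) {φp φm : GAlpha α T n → ℝ}
    (hφp : UpStable H cH φp) (hφm : LowStable H cH φm) {p q : GAlpha α T n} {ε lam K κ h T₀ : ℝ}
    (hC : 0 ≤ C) (hp : p.1.t ≤ T₀) (hq : q.1.t ≤ T₀)
    (hrate : ∀ x ∈ Traj cH p, ∀ y ∈ Traj cH q, ∀ t ∈ Icc T₀ T, ∀ᵐ τ, τ ∈ Icc t T → τ - t ≤ h →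
      zRate H (-(2 / ε * Real.exp (-(K * t))) • rlIntegral α (pairControl C p q x y) t) x τ -
        zRate H (-(2 / ε * Real.exp (-(K * t))) • rlIntegral α (pairControl C p q x y) t) y τ ≤
        1 / ε * energyDensity α lam K (pairControl C p q x y) τ + κ)
    {r r' e d : ℝ} (hr : r ∈ Icc T₀ T) (hr' : r' ∈ Icc r T) (hstep : r' - r ≤ h) (hd : 0 < d)
    (hP : ∃ hr : r ∈ Icc 0 T, ∃ x ∈ Traj cH p, ∃ y ∈ Traj cH q,
      φm q - φp p ≤ φm (hist y r hr) - φp (hist x r hr) +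
        1 / ε * (∫ τ in T₀..r, energyDensity α lam K (pairControl C p q x y) τ) +
        κ * (r - T₀) + e) :
    ∃ hr' : r' ∈ Icc 0 T, ∃ x ∈ Traj cH p, ∃ y ∈ Traj cH q,
      φm q - φp p ≤ φm (hist y r' hr') - φp (hist x r' hr') +
        1 / ε * (∫ τ in T₀..r', energyDensity α lam K (pairControl C p q x y) τ) +
        κ * (r' - T₀) + (e + d) := by
  obtain ⟨hr0, x, hx, y, hy, hle⟩ := hP
  have hr'0 : r' ∈ Icc 0 T := ⟨hr0.1.trans hr'.1, hr'.2⟩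
  have hT₀ : 0 ≤ T₀ := p.1.ht.1.trans hp
  -- The momentum depends only on the past of the pair, so it can be fixed before the next pieces of
  -- the trajectories are chosen; `hs'` records that these pieces do not alter it.
  set s := -(2 / ε * Real.exp (-(K * r))) • rlIntegral α (pairControl C p q x y) r with hs
  obtain ⟨x', hx', hxx', h1⟩ := hφp.step hx hr0 hr'0 (hp.trans hr.1) hr'.1 s (half_pos hd)
  obtain ⟨y', hy', hyy', h2⟩ := hφm.step hy hr0 hr'0 (hq.trans hr.1) hr'.1 s (half_pos hd)
  refine ⟨hr'0, x', hx', y', hy', ?_⟩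
  have hcong := pairControl_congr (C := C) (p := p) (q := q) hxx' hyy'
  have hs' : s = -(2 / ε * Real.exp (-(K * r))) • rlIntegral α (pairControl C p q x' y') r := by
    rw [hs, rlIntegral_congr_ae hr0.1 hcong]
  have hpc := isControl_pairControl hC p q x' y'
  have hi : ∀ a b, 0 ≤ a → 0 ≤ b →
      IntervalIntegrable (energyDensity α lam K (pairControl C p q x' y')) volume a b :=
    fun a b ha hb => intervalIntegrable_energyDensity hα hpc lam K ha hb
  have h3 : zInt H s x' r r' - zInt H s y' r r' ≤
      1 / ε * (∫ τ in r..r', energyDensity α lam K (pairControl C p q x' y') τ) +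
        κ * (r' - r) := by
    rw [zInt, zInt, ← intervalIntegral.integral_sub
      (intervalIntegrable_zRate hα hH s x' hr0 hr'0)
      (intervalIntegrable_zRate hα hH s y' hr0 hr'0)]
    have h4 : ∫ τ in r..r', (1 / ε * energyDensity α lam K (pairControl C p q x' y') τ + κ) =
        1 / ε * (∫ τ in r..r', energyDensity α lam K (pairControl C p q x' y') τ) +
        κ * (r' - r) := by
      rw [intervalIntegral.integral_add ((hi r r' hr0.1 hr'0.1).const_mul _)
        intervalIntegrable_const, intervalIntegral.integral_const_mul,
        intervalIntegral.integral_const, smul_eq_mul, mul_comm κ]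
    rw [← h4]
    refine intervalIntegral.integral_mono_ae_restrict hr'.1
      ((intervalIntegrable_zRate hα hH s x' hr0 hr'0).sub
        (intervalIntegrable_zRate hα hH s y' hr0 hr'0))
      (((hi r r' hr0.1 hr'0.1).const_mul _).add intervalIntegrable_const) ?_
    rw [EventuallyLE, ae_restrict_iff' measurableSet_Icc]
    filter_upwards [hrate x' hx' y' hy' r hr] with τ h5 hτ
    rw [← hs'] at h5
    exact h5 ⟨hτ.1, hτ.2.trans hr'.2⟩ (by linarith [hτ.2])
  have h6 : ∫ τ in T₀..r, energyDensity α lam K (pairControl C p q x y) τ =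
      ∫ τ in T₀..r, energyDensity α lam K (pairControl C p q x' y') τ :=
    (integral_energyDensity_congr hT₀ hr.1 hcong).symm
  have h7 := intervalIntegral.integral_add_adjacent_intervals (hi T₀ r hT₀ hr0.1)
    (hi r r' hr0.1 hr'0.1)
  rw [h6] at hle
  rw [← h7, mul_add]
  have h8 : κ * (r' - T₀) = κ * (r - T₀) + κ * (r' - r) := by ring
  linarith

/-- The construction of a pair of trajectories on the whole time interval. -/
theorem chain (hα : α ∈ Ioo (0 : ℝ) 1) (hH : IsHamiltonian T cH H) {φp φm : GAlpha α T n → ℝ}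
    (hφp : UpStable H cH φp) (hφm : LowStable H cH φm) {p q : GAlpha α T n} {ε lam K κ h T₀ : ℝ}
    (hC : 0 ≤ C) (hp : p.1.t ≤ T₀) (hq : q.1.t ≤ T₀) (hT₀ : T₀ ≤ T) (hh : 0 < h)
    (hrate : ∀ x ∈ Traj cH p, ∀ y ∈ Traj cH q, ∀ t ∈ Icc T₀ T, ∀ᵐ τ, τ ∈ Icc t T → τ - t ≤ h →
      zRate H (-(2 / ε * Real.exp (-(K * t))) • rlIntegral α (pairControl C p q x y) t) x τ -
        zRate H (-(2 / ε * Real.exp (-(K * t))) • rlIntegral α (pairControl C p q x y) t) y τ ≤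
        1 / ε * energyDensity α lam K (pairControl C p q x y) τ + κ)
    {e d : ℝ} (hd : 0 < d)
    (hP : ∃ hr : T₀ ∈ Icc 0 T, ∃ x ∈ Traj cH p, ∃ y ∈ Traj cH q,
      φm q - φp p ≤ φm (hist y T₀ hr) - φp (hist x T₀ hr) + e) :
    ∃ hr' : T ∈ Icc 0 T, ∃ x ∈ Traj cH p, ∃ y ∈ Traj cH q,
      φm q - φp p ≤ φm (hist y T hr') - φp (hist x T hr') +
        1 / ε * (∫ τ in T₀..T, energyDensity α lam K (pairControl C p q x y) τ) +
        κ * (T - T₀) + (e + d) := by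
  -- `N` equal steps of length at most `h`, each allowed the error `d / N`.
  obtain ⟨N, hN⟩ := exists_nat_gt ((T - T₀) / h)
  have hN0 : 0 < (N : ℝ) := lt_of_le_of_lt (div_nonneg (by linarith) hh.le) hN
  have hstep : (T - T₀) / N ≤ h := by
    rw [div_le_iff₀ hN0]
    rw [div_lt_iff₀ hh] at hN
    linarith
  have hstep0 : 0 ≤ (T - T₀) / N := div_nonneg (by linarith) hN0.le
  have key : ∀ k : ℕ, k ≤ N → ∃ hr : T₀ + k * ((T - T₀) / N) ∈ Icc 0 T, ∃ x ∈ Traj cH p,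
      ∃ y ∈ Traj cH q, φm q - φp p ≤ φm (hist y _ hr) - φp (hist x _ hr) +
        1 / ε * (∫ τ in T₀..T₀ + k * ((T - T₀) / N),
          energyDensity α lam K (pairControl C p q x y) τ) +
        κ * (T₀ + k * ((T - T₀) / N) - T₀) + (e + k * (d / N)) := by
    intro k
    induction k with
    | zero =>
      intro _
      obtain ⟨hr, x, hx, y, hy, hle⟩ := hP
      have e0 : T₀ + ((0 : ℕ) : ℝ) * ((T - T₀) / N) = T₀ := by simp
      rw [e0]
      refine ⟨hr, x, hx, y, hy, ?_⟩
      simpa using hle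
    | succ k ih =>
      intro hk
      have hk' : ((k : ℝ) + 1) ≤ N := by exact_mod_cast hk
      have e1 : T₀ + N * ((T - T₀) / N) = T := by field_simp; ring
      have h1 := mul_le_mul_of_nonneg_right hk' hstep0
      have hr1 : T₀ + (k : ℝ) * ((T - T₀) / N) ∈ Icc T₀ T :=
        ⟨by linarith [mul_nonneg (Nat.cast_nonneg (α := ℝ) k) hstep0], by linarith⟩
      have := chain_step hα hH hφp hφm hC hp hq hrate hr1
        (r' := T₀ + (k + 1 : ℕ) * ((T - T₀) / N)) (d := d / N)
        ⟨by push_cast; linarith, by push_cast; linarith⟩ (by push_cast; linarith)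
        (by positivity) (ih (by omega))
      have e2 : e + (k : ℝ) * (d / N) + d / N = e + ((k + 1 : ℕ) : ℝ) * (d / N) := by
        push_cast; ring
      rwa [e2] at this
  have e1 : T₀ + N * ((T - T₀) / N) = T := by field_simp; ring
  have e3 : (N : ℝ) * (d / N) = d := by field_simp
  have := key N le_rfl
  rwa [e1, e3] at this

/-- A uniform Hölder modulus upgrades smallness in mean square to uniform smallness: a value above
`θ` persists above `θ / 2` on an interval of fixed length `d`. -/
theorem exists_small_of_integral_sq {L θ : ℝ} (hα : 0 < α) (hL : 0 ≤ L)
    (hθ : 0 < θ) : ∃ m > 0, ∀ ρ : ℝ → Vec n, ContinuousOn ρ (Icc 0 T) → ρ 0 = 0 →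
      (∀ t ∈ Icc 0 T, ∀ s ∈ Icc 0 T, ‖ρ t - ρ s‖ ≤ L * |t - s| ^ α) →
      ∫ t in (0 : ℝ)..T, ‖ρ t‖ ^ 2 ≤ m → ∀ t ∈ Icc 0 T, ‖ρ t‖ ≤ θ := by
  have hlim : Tendsto (fun d : ℝ => L * d ^ α) (nhds 0) (nhds 0) := by
    have : Continuous fun d : ℝ => L * d ^ α :=
      continuous_const.mul (continuous_id.rpow_const fun _ => Or.inr hα.le)
    simpa [Real.zero_rpow hα.ne'] using this.tendsto 0
  obtain ⟨d, hd1, hd0⟩ := (((hlim.eventually (gt_mem_nhds (half_pos hθ))).filter_mono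
    nhdsWithin_le_nhds).and (self_mem_nhdsWithin (a := (0 : ℝ)) (s := Ioi 0))).exists
  have hd0' : 0 < d := hd0
  refine ⟨d * (θ / 2) ^ 2 / 2, by positivity, fun ρ hc h0 hρ hintegral t ht => ?_⟩
  by_contra hcon
  rw [not_le] at hcon
  have hsm : ∀ s ∈ Icc 0 T, |t - s| ≤ d → θ / 2 ≤ ‖ρ s‖ := by
    intro s hs hts
    have h1 := hρ t ht s hs
    have h2 : L * |t - s| ^ α ≤ L * d ^ α := by gcongr
    have h3 := norm_sub_norm_le (ρ t) (ρ s)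
    linarith
  -- Since `ρ 0 = 0`, a large value cannot occur before time `d`, so the interval `[t - d, t]` lies
  -- inside `[0, T]`.
  have htd : d ≤ t := by
    by_contra hlt
    have := hsm 0 ⟨le_rfl, ht.1.trans ht.2⟩ (by rw [sub_zero, abs_of_nonneg ht.1]; linarith)
    rw [h0, norm_zero] at this
    linarith
  have hintegrable : IntervalIntegrable (fun t => ‖ρ t‖ ^ 2) volume 0 T := by
    refine ContinuousOn.intervalIntegrable ?_
    rw [uIcc_of_le (ht.1.trans ht.2)]
    exact hc.norm.pow 2
  have h1 : ∫ s in (t - d)..t, ‖ρ s‖ ^ 2 ≤ ∫ s in (0 : ℝ)..T, ‖ρ s‖ ^ 2 := by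
    refine intervalIntegral.integral_mono_interval (by linarith) (by linarith) ht.2 ?_ hintegrable
    exact Eventually.of_forall fun s => by positivity
  have h2 : ∫ s in (t - d)..t, (θ / 2) ^ 2 ≤ ∫ s in (t - d)..t, ‖ρ s‖ ^ 2 := by
    refine intervalIntegral.integral_mono_on (by linarith) intervalIntegrable_const
      (hintegrable.mono_set ?_) fun s hs => ?_
    · rw [uIcc_of_le (by linarith), uIcc_of_le (ht.1.trans ht.2)]
      exact Icc_subset_Icc (by linarith) ht.2
    · have := hsm s ⟨by linarith [hs.1], hs.2.trans ht.2⟩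
        (by rw [abs_of_nonneg (by linarith [hs.2])]; linarith [hs.1])
      gcongr
  rw [intervalIntegral.integral_const, smul_eq_mul] at h2
  have : 0 < d * (θ / 2) ^ 2 := by positivity
  have e : (t - (t - d)) * (θ / 2) ^ 2 = d * (θ / 2) ^ 2 := by ring
  linarith

end FracHJ

end

/-! ### Comparison II: estimates near a given history. -/

noncomputable section

open Filter

namespace FracHJ

variable {n : ℕ} {α C T cH : ℝ} {H : ℝ → Vec n → Vec n → ℝ}

/-! ### Comparison -/

theorem exists_pos_forall_le {f : ℝ → ℝ} (hf : Continuous f) (h0 : f 0 = 0) {δ : ℝ} (hδ : 0 < δ) :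
    ∃ a > 0, ∀ d ∈ Icc 0 a, f d ≤ δ := by
  have h1 : ∀ᶠ d in nhds (0 : ℝ), f d < δ := by
    have := hf.tendsto 0
    rw [h0] at this
    exact this.eventually (gt_mem_nhds hδ)
  obtain ⟨a, ha, h2⟩ := Metric.eventually_nhds_iff.1 h1
  refine ⟨a / 2, half_pos ha, fun d hd => (h2 ?_).le⟩
  rw [Real.dist_eq, sub_zero, abs_of_nonneg hd.1]
  linarith [hd.2]

theorem continuous_const_mul_rpow (hα : 0 < α) (L : ℝ) : Continuous fun d : ℝ => L * d ^ α :=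
  continuous_const.mul (continuous_id.rpow_const fun _ => Or.inr hα.le)

theorem dist_le_of_ev {x y : AC α T n} {d : ℝ} (hd : 0 ≤ d)
    (h : ∀ τ ∈ Icc 0 T, ‖ev x.1 τ - ev y.1 τ‖ ≤ d) : dist x y ≤ d := by
  rw [Subtype.dist_eq, ContinuousMap.dist_le hd]
  intro τ
  have := h τ.1 τ.2
  rwa [ev_of_mem _ τ.2, ev_of_mem _ τ.2, ← dist_eq_norm] at this

/-- The control of `x` is reused from `p₀`. The controls then differ only between the two initial
times, and the free parts are close by assumption. This transfers compactness at `p₀` to all nearby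
histories. -/
theorem exists_prolongs_near (hα : α ∈ Ioo (0 : ℝ) 1) (hC : 0 ≤ C) {p p₀ : GAlpha α T n}
    {x : AC α T n} (hx : Prolongs C p x) {η : ℝ} (ht : |p.1.t - p₀.1.t| ≤ η)
    (hfree : ∀ τ ∈ Icc 0 T, ‖ev (free hα p).1 τ - ev (free hα p₀).1 τ‖ ≤ η) :
    ∃ x₀, Prolongs C p₀ x₀ ∧
      dist x₀ x ≤ η + (C + C) / Real.Gamma (α + 1) * η ^ α := by
  have hη : 0 ≤ η := (abs_nonneg _).trans ht
  have hΓ := Real.Gamma_pos_of_pos (by linarith [hα.1] : 0 < α + 1)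
  have hcx := isControl_cutCaputo hC p.1.t x
  obtain ⟨x₀, h1, h2⟩ := exists_prolongation hα p₀ hcx
  have hx₀ : Prolongs C p₀ x₀ := by
    refine ⟨h1, ?_⟩
    filter_upwards [h2] with τ h hτ
    rw [h hτ]
    exact hcx.norm_le τ
  refine ⟨x₀, hx₀, dist_le_of_ev (by positivity) fun τ hτ => ?_⟩
  have hc0 := isControl_cutCaputo hC p₀.1.t x₀
  have hsup : ∀ᵐ ξ, ξ ∈ Ioc 0 τ → ξ ∉ Ioc (min p.1.t p₀.1.t) (max p.1.t p₀.1.t) →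
      cutCaputo C p.1.t x ξ - cutCaputo C p₀.1.t x₀ ξ = 0 := by
    filter_upwards [h2] with ξ h3 hξ hξ'
    have hξT : ξ ≤ T := hξ.2.trans hτ.2
    rcases le_or_gt ξ (min p.1.t p₀.1.t) with hle | hlt
    · rw [cutCaputo_eq_zero fun h => absurd h.1 (not_lt.2 (hle.trans (min_le_left _ _))),
        cutCaputo_eq_zero fun h => absurd h.1 (not_lt.2 (hle.trans (min_le_right _ _))), sub_zero]
    · have hgt : max p.1.t p₀.1.t < ξ := not_le.1 fun h => hξ' ⟨hlt, h⟩
      have hp₀ : p₀.1.t < ξ := (le_max_right _ _).trans_lt hgt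
      have h4 := h3 ⟨hp₀.le, hξT⟩
      rw [cutCaputo_eq (b := p₀.1.t) ⟨hp₀, hξT⟩ (by rw [h4]; exact hcx.norm_le ξ), h4, sub_self]
  have h5 := norm_rlIntegral_le_of_support (hcx.sub hc0) ⟨hα.1, hα.2.le⟩ hτ.1
    (le_min p.1.ht.1 p₀.1.ht.1) min_le_max hsup
  rw [max_sub_min_eq_abs', rlIntegral_sub hcx hc0 hα.1] at h5
  rw [hx₀.ev_eq hα hτ, hx.ev_eq hα hτ, norm_sub_rev]
  calc _ = ‖(ev (free hα p).1 τ - ev (free hα p₀).1 τ) +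
        (rlIntegral α (cutCaputo C p.1.t x) τ - rlIntegral α (cutCaputo C p₀.1.t x₀) τ)‖ := by
        congr 1; abel
    _ ≤ η + (C + C) * |p.1.t - p₀.1.t| ^ α / Real.Gamma (α + 1) :=
        (norm_add_le _ _).trans (add_le_add (hfree τ hτ) h5)
    _ ≤ η + (C + C) * η ^ α / Real.Gamma (α + 1) := by
        have := hα.1.le
        gcongr
    _ = _ := by ring

/-- Uniform continuity and boundedness of the boundary functional near the prolongations of a given
history. -/
theorem exists_uniform_boundary (hα : α ∈ Ioo (0 : ℝ) 1) (hT : 0 < T) (hC : 0 ≤ C)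
    (p₀ : GAlpha α T n) {σ : AC α T n → ℝ} (hσ : Continuous σ) {κ : ℝ} (hκ : 0 < κ) :
    ∃ δ > 0, ∃ M, 0 ≤ M ∧ ∀ p : GAlpha α T n, |p.1.t - p₀.1.t| ≤ δ →
      (∀ τ ∈ Icc 0 T, ‖ev (free hα p).1 τ - ev (free hα p₀).1 τ‖ ≤ δ) →
      ∀ x, Prolongs C p x → |σ x| ≤ M ∧
        ∀ y : AC α T n, (∀ τ ∈ Icc 0 T, ‖ev x.1 τ - ev y.1 τ‖ ≤ δ) → |σ y - σ x| ≤ κ := by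
  have hcomp := isCompact_prolongs hα hC hT p₀
  -- Only the first point has to lie in the compact set. This matters because `x` and `y` need not
  -- prolong `p₀`.
  have huc := hcomp.uniformContinuousAt_of_continuousAt σ (fun a _ => hσ.continuousAt)
    (Metric.dist_mem_uniformity (half_pos hκ))
  obtain ⟨d, hd, hdσ⟩ := Metric.mem_uniformity_dist.1 huc
  obtain ⟨M, hM⟩ := hcomp.exists_bound_of_continuousOn hσ.continuousOn
  obtain ⟨δ, hδ, hδd⟩ := exists_pos_forall_le
    (f := fun η => η + (C + C) / Real.Gamma (α + 1) * η ^ α)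
    (continuous_id.add (continuous_const_mul_rpow hα.1 _)) (by simp [Real.zero_rpow hα.1.ne'])
    (half_pos (half_pos hd))
  refine ⟨min δ (d / 4), by positivity, |M| + κ, by positivity, fun p ht hfree x hx => ?_⟩
  obtain ⟨x₀, hx₀, hxx₀⟩ := exists_prolongs_near hα hC hx ht hfree
  have h1 : dist x₀ x ≤ d / 4 :=
    hxx₀.trans ((hδd _ ⟨by positivity, min_le_left _ _⟩).trans (by linarith))
  have h2 : |σ x₀ - σ x| < κ / 2 := hdσ (a := x₀) (b := x) (by linarith) hx₀
  have h3 : |σ x₀| ≤ |M| := (hM x₀ hx₀).trans (le_abs_self M)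
  constructor
  · have : |σ x| ≤ |σ x₀| + |σ x₀ - σ x| := by
      rw [abs_sub_comm]
      calc |σ x| = |σ x₀ + (σ x - σ x₀)| := by congr 1; ring
        _ ≤ _ := abs_add_le _ _
    linarith
  · intro y hy
    have h4 : dist x y ≤ d / 4 := dist_le_of_ev (by positivity) fun τ hτ =>
      (hy τ hτ).trans (min_le_right _ _)
    have h5 : |σ x₀ - σ y| < κ / 2 :=
      hdσ (a := x₀) (b := y) (by linarith [dist_triangle x₀ x y]) hx₀
    rw [abs_lt] at h2 h5
    rw [abs_le]
    constructor <;> linarith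

/-- The positivity is nonlocal and available only on the whole interval `[0, T]`. To pass to `[T₀,
T]`, the part on `[0, m]` is dropped because `ψ` vanishes there and the density is nonnegative. The
part on `[m, T₀]`, where just one of the two trajectories may be running, is short. -/
theorem integral_energyDensity_le (hα : α ∈ Ioo (0 : ℝ) 1) {ψ : ℝ → Vec n} {D B lam K m T₀ : ℝ}
    (hψ : IsControl D ψ) (hlam : 0 ≤ lam) (hK : 0 ≤ K)
    (hen : 4 * lam * ∫ t in (0 : ℝ)..T, Real.exp (-(K * t)) * ‖rlIntegral α ψ t‖ ^ 2 ≤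
      2 * ∫ t in (0 : ℝ)..T, Real.exp (-(K * t)) * inner ℝ (rlIntegral α ψ t) (ψ t))
    (hm : 0 ≤ m) (hmT₀ : m ≤ T₀) (hT₀ : T₀ ≤ T) (hzero : ∀ τ ≤ m, ψ τ = 0)
    (hB : ∀ τ ∈ Icc 0 T, ‖rlIntegral α ψ τ‖ ≤ B) :
    ∫ τ in T₀..T, energyDensity α lam K ψ τ ≤
      -lam * (∫ t in (0 : ℝ)..T, Real.exp (-(K * t)) * ‖rlIntegral α ψ t‖ ^ 2) +
        2 * B * D * (T₀ - m) := by
  have hT0 : 0 ≤ T₀ := hm.trans hmT₀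
  have hT : 0 ≤ T := hT0.trans hT₀
  have hD := hψ.nonneg
  have hi := fun a b (ha : 0 ≤ a) (hb : 0 ≤ b) =>
    intervalIntegrable_energyDensity hα hψ lam K (a := a) (b := b) ha hb
  have h1 : ∫ τ in (0 : ℝ)..T, energyDensity α lam K ψ τ ≤
      -lam * (∫ t in (0 : ℝ)..T, Real.exp (-(K * t)) * ‖rlIntegral α ψ t‖ ^ 2) := by
    simp only [energyDensity_eq]
    rw [intervalIntegral.integral_sub
      ((intervalIntegrable_weight_sq hα hψ K le_rfl hT).const_mul _)
      ((intervalIntegrable_weight_inner hα hψ K le_rfl hT).const_mul _),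
      intervalIntegral.integral_const_mul, intervalIntegral.integral_const_mul]
    linarith
  have h2 : 0 ≤ ∫ τ in (0 : ℝ)..m, energyDensity α lam K ψ τ := by
    refine intervalIntegral.integral_nonneg hm fun τ hτ => ?_
    rw [energyDensity, hzero τ hτ.2, inner_zero_right]
    simp only [mul_zero, sub_zero]
    positivity
  have h3 : ∫ _τ in m..T₀, -(2 * B * D) ≤ ∫ τ in m..T₀, energyDensity α lam K ψ τ := by
    refine intervalIntegral.integral_mono_on hmT₀ intervalIntegrable_const (hi _ _ hm hT0)
      fun τ hτ => ?_
    have hτ0 : 0 ≤ τ := hm.trans hτ.1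
    have hBτ := hB τ ⟨hτ0, hτ.2.trans hT₀⟩
    have h4 : inner ℝ (rlIntegral α ψ τ) (ψ τ) ≤ B * D :=
      (real_inner_le_norm _ _).trans (mul_le_mul hBτ (hψ.norm_le τ) (norm_nonneg _)
        ((norm_nonneg _).trans hBτ))
    have hBD : 0 ≤ B * D := mul_nonneg ((norm_nonneg _).trans hBτ) hD
    have h5 : Real.exp (-(K * τ)) ≤ 1 := by
      rw [Real.exp_le_one_iff]
      have := mul_nonneg hK hτ0
      linarith
    rw [energyDensity_eq]
    have h6 : Real.exp (-(K * τ)) * inner ℝ (rlIntegral α ψ τ) (ψ τ) ≤ B * D :=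
      (mul_le_mul_of_nonneg_left h4 (Real.exp_pos _).le).trans (mul_le_of_le_one_left hBD h5)
    have h7 : 0 ≤ 3 * lam * (Real.exp (-(K * τ)) * ‖rlIntegral α ψ τ‖ ^ 2) := by positivity
    linarith
  rw [intervalIntegral.integral_const, smul_eq_mul] at h3
  have h8 := intervalIntegral.integral_add_adjacent_intervals (hi 0 m le_rfl hm) (hi m T₀ hm hT0)
  have h9 := intervalIntegral.integral_add_adjacent_intervals (hi 0 T₀ le_rfl hT0) (hi T₀ T hT0 hT)
  nlinarith

theorem zInt_zero_le {x : AC α T n} {R B a b : ℝ} (ha : 0 ≤ a) (hab : a ≤ b) (hb : b ≤ T)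
    (hx : ∀ τ ∈ Icc 0 T, ‖ev x.1 τ‖ ≤ R)
    (hB : ∀ τ ∈ Icc 0 T, ∀ v : Vec n, ‖v‖ ≤ R → |H τ v 0| ≤ B) :
    |zInt H 0 x a b| ≤ B * (b - a) := by
  have := intervalIntegral.norm_integral_le_of_norm_le_const (a := a) (b := b) (C := B)
    (f := zRate H 0 x) fun τ hτ => by
      rw [uIoc_of_le hab] at hτ
      have hm : τ ∈ Icc 0 T := ⟨ha.trans hτ.1.le, hτ.2.trans hb⟩
      rw [zRate, inner_zero_left, zero_sub, norm_neg]
      exact hB τ hm _ (hx τ hm)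
  rwa [abs_of_nonneg (by linarith : 0 ≤ b - a)] at this

theorem free_mem_traj (hα : α ∈ Ioo (0 : ℝ) 1) (hc : 0 ≤ cH) (p : GAlpha α T n) :
    free hα p ∈ Traj cH p := by
  refine ⟨fun τ hτ => free_eq hα p hτ, ?_⟩
  filter_upwards [caputo_free hα p] with τ h hτ
  rw [h hτ, norm_zero]
  positivity

theorem hist_free (hα : α ∈ Ioo (0 : ℝ) 1) (p : GAlpha α T n) :
    hist (free hα p) p.1.t p.1.ht = p := hist_eq_of_eqOn fun _ hτ => free_eq hα p hτ

theorem abs_exp_neg_sub_le {K s t : ℝ} (hK : 0 ≤ K) (hs : 0 ≤ s) (hst : s ≤ t) :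
    |Real.exp (-(K * s)) - Real.exp (-(K * t))| ≤ K * (t - s) := by
  have h1 : Real.exp (-(K * t)) = Real.exp (-(K * s)) * Real.exp (-(K * (t - s))) := by
    rw [← Real.exp_add]; ring_nf
  have h2 := Real.add_one_le_exp (-(K * (t - s)))
  have h0 : 0 ≤ K * (t - s) := mul_nonneg hK (by linarith)
  have h3 : Real.exp (-(K * (t - s))) ≤ 1 := by rw [Real.exp_le_one_iff]; linarith
  have h4 : Real.exp (-(K * s)) ≤ 1 := by
    rw [Real.exp_le_one_iff]; linarith [mul_nonneg hK hs]
  have h5 := Real.exp_pos (-(K * s))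
  rw [h1, abs_of_nonneg (by nlinarith)]
  nlinarith

/-- The rate of change of the difference of the `z`-components, for the momentum frozen at the
beginning of a short time interval. -/
theorem zRate_sub_le (hα : α ∈ Ioo (0 : ℝ) 1) (hH : IsHamiltonian T cH H)
    {p q : GAlpha α T n} {R lam K ε β ω h B L : ℝ} (hR0 : 0 ≤ R) (hlam : 0 < lam) (hK : 0 ≤ K)
    (hε : 0 < ε) (hβ : 0 ≤ β)
    (hlip : ∀ t ∈ Icc (0 : ℝ) T, ∀ x x' s : Vec n, ‖x‖ ≤ R → ‖x'‖ ≤ R →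
      |H t x s - H t x' s| ≤ lam * (1 + ‖s‖) * ‖x - x'‖)
    (hpR : ∀ x ∈ Traj cH p, ∀ τ ∈ Icc 0 T, ‖ev x.1 τ‖ ≤ R)
    (hqR : ∀ x ∈ Traj cH q, ∀ τ ∈ Icc 0 T, ‖ev x.1 τ‖ ≤ R)
    (hfree : ∀ τ ∈ Icc 0 T, ‖ev (free hα p).1 τ - ev (free hα q).1 τ‖ ≤ β)
    (hC : C = cH * (1 + R))
    (hB : ∀ ψ : ℝ → Vec n, IsControl (C + C) ψ → ∀ τ ∈ Icc 0 T, ‖rlIntegral α ψ τ‖ ≤ B)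
    (hL : ∀ ψ : ℝ → Vec n, IsControl (C + C) ψ → ∀ τ ∈ Icc 0 T, ∀ t ∈ Icc 0 T,
      ‖rlIntegral α ψ τ - rlIntegral α ψ t‖ ≤ L * |τ - t| ^ α)
    (hω : ∀ d ∈ Icc 0 h, 2 / ε * (L * d ^ α + K * d * B) ≤ ω)
    {x y : AC α T n} (hx : x ∈ Traj cH p) (hy : y ∈ Traj cH q) {t : ℝ} (hpt : p.1.t ≤ t)
    (hqt : q.1.t ≤ t) :
    ∀ᵐ τ, τ ∈ Icc t T → τ - t ≤ h →
      zRate H (-(2 / ε * Real.exp (-(K * t))) • rlIntegral α (pairControl C p q x y) t) x τ -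
        zRate H (-(2 / ε * Real.exp (-(K * t))) • rlIntegral α (pairControl C p q x y) t) y τ ≤
        1 / ε * energyDensity α lam K (pairControl C p q x y) τ +
          (lam * ε * Real.exp (K * T) / 4 + β * lam * (1 + 2 / ε * B) +
            ω * (C + C + lam * (R + R))) := by
  have hc := hH.pos
  have hC0 : 0 ≤ C := by rw [hC]; positivity
  have hxp : Prolongs C p x := hC ▸ Traj.prolongs hx hc.le (hpR x hx)
  have hyq : Prolongs C q y := hC ▸ Traj.prolongs hy hc.le (hqR y hy)
  have hpc := isControl_pairControl hC0 p q x y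
  have ht0 : 0 ≤ t := p.1.ht.1.trans hpt
  filter_upwards [hxp.2, hyq.2, ae_mem_Ioo_of_mem_Icc t T] with τ h1 h2 h3 hτ hd
  have htτ := h3 hτ
  have hτT : τ ∈ Icc 0 T := ⟨ht0.trans hτ.1, hτ.2⟩
  have htT : t ∈ Icc 0 T := ⟨ht0, hτ.1.trans hτ.2⟩
  have hf : pairControl C p q x y τ = caputo α x.1 τ - caputo α y.1 τ := by
    rw [pairControl, cutCaputo_eq ⟨hpt.trans_lt htτ.1, hτ.2⟩ (h1 ⟨hpt.trans hτ.1, hτ.2⟩),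
      cutCaputo_eq ⟨hqt.trans_lt htτ.1, hτ.2⟩ (h2 ⟨hqt.trans hτ.1, hτ.2⟩)]
  have hxy : ev x.1 τ - ev y.1 τ = (ev (free hα p).1 τ - ev (free hα q).1 τ) +
      rlIntegral α (pairControl C p q x y) τ := by
    have e : rlIntegral α (pairControl C p q x y) τ = rlIntegral α (cutCaputo C p.1.t x) τ -
        rlIntegral α (cutCaputo C q.1.t y) τ :=
      rlIntegral_sub (isControl_cutCaputo hC0 _ _) (isControl_cutCaputo hC0 _ _) hα.1 _
    rw [hxp.ev_eq hα hτT, hyq.ev_eq hα hτT, e]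
    abel
  have hexp : Real.exp (-(K * t)) ≤ 1 := by
    rw [Real.exp_le_one_iff]; linarith [mul_nonneg hK ht0]
  have hs : ‖-(2 / ε * Real.exp (-(K * t))) • rlIntegral α (pairControl C p q x y) t -
      (-(2 / ε * Real.exp (-(K * τ)))) • rlIntegral α (pairControl C p q x y) τ‖ ≤ ω := by
    have e : -(2 / ε * Real.exp (-(K * t))) • rlIntegral α (pairControl C p q x y) t -
      (-(2 / ε * Real.exp (-(K * τ)))) • rlIntegral α (pairControl C p q x y) τ = (2 / ε) •
        (Real.exp (-(K * t)) • (rlIntegral α (pairControl C p q x y) τ -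
            rlIntegral α (pairControl C p q x y) t) -
          (Real.exp (-(K * t)) - Real.exp (-(K * τ))) •
            rlIntegral α (pairControl C p q x y) τ) := by
      module
    rw [e, norm_smul, Real.norm_of_nonneg (by positivity)]
    refine le_trans ?_ (hω (τ - t) ⟨by linarith [hτ.1], hd⟩)
    gcongr
    refine (norm_sub_le _ _).trans (add_le_add ?_ ?_)
    · rw [norm_smul, Real.norm_of_nonneg (Real.exp_pos _).le]
      have := hL _ hpc τ hτT t htT
      rw [abs_of_nonneg (by linarith [hτ.1] : 0 ≤ τ - t)] at this
      exact (mul_le_of_le_one_left (norm_nonneg _) hexp).trans this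
    · rw [norm_smul, Real.norm_eq_abs]
      have := abs_exp_neg_sub_le hK ht0 hτ.1
      have h0 : 0 ≤ K * (τ - t) := (abs_nonneg _).trans this
      exact mul_le_mul this (hB _ hpc τ hτT) (norm_nonneg _) h0
  have key := rate_estimate (r := rlIntegral α (pairControl C p q x y) τ)
    (f := pairControl C p q x y τ) (c := Real.exp (-(K * τ))) (B := B)
    (Q := Real.exp (K * T)) (R := R + R) (D := C + C) (X := ev x.1 τ) (Y := ev y.1 τ)
    (Real.exp_pos _) hε hlam hβ
    (by rw [Real.exp_le_one_iff]; linarith [mul_nonneg hK hτT.1])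
    (by rw [← Real.exp_neg, neg_neg]; gcongr; exact hτ.2)
    (hB _ hpc τ hτT) (hpc.norm_le τ) hs
    (by rw [hxy, add_comm ‖_‖]; exact (norm_add_le _ _).trans (by gcongr; exact hfree τ hτT))
    ((norm_sub_le _ _).trans (add_le_add (hpR x hx τ hτT) (hqR y hy τ hτT)))
    (hlip τ hτT _ _ _ (hpR x hx τ hτT) (hqR y hy τ hτT))
  rw [hf, inner_sub_right] at key
  rw [energyDensity, zRate, zRate, hf]
  linarith

theorem exists_hamiltonian_bound (hH : IsHamiltonian T cH H) (R : ℝ) :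
    ∃ B, 0 ≤ B ∧ ∀ τ ∈ Icc 0 T, ∀ v : Vec n, ‖v‖ ≤ R → |H τ v 0| ≤ B := by
  have hcont : ContinuousOn (fun q : ℝ × Vec n => H q.1 q.2 0)
      (Icc (0 : ℝ) T ×ˢ Metric.closedBall 0 R) :=
    hH.cont.comp (f := fun q : ℝ × Vec n => (q.1, q.2, (0 : Vec n))) (by fun_prop)
      fun q hq => ⟨hq.1, mem_univ _⟩
  obtain ⟨B, hB⟩ := (isCompact_Icc.prod (isCompact_closedBall (0 : Vec n)
    R)).exists_bound_of_continuousOn hcont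
  refine ⟨|B|, abs_nonneg B, fun τ hτ v hv => (hB (τ, v) ⟨hτ, ?_⟩).trans (le_abs_self B)⟩
  simpa using hv

/-- Comparison of upper and lower stable functionals at nearby points. -/
theorem comparison (hα : α ∈ Ioo (0 : ℝ) 1) (hT : 0 < T) (hH : IsHamiltonian T cH H)
    {σ : AC α T n → ℝ} (hσ : Continuous σ) {φp φm : GAlpha α T n → ℝ}
    (hφp : UpStable H cH φp) (hφm : LowStable H cH φm)
    (hbp : ∀ w, σ w ≤ φp (terminal hT w)) (hbm : ∀ w, φm (terminal hT w) ≤ σ w)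
    (p₀ : GAlpha α T n) {κ : ℝ} (hκ : 0 < κ) :
    ∃ δ > 0, ∀ p q : GAlpha α T n, dist p p₀ < δ → dist q p₀ < δ → φm q ≤ φp p + κ := by
  have hc := hH.pos
  have hΓ := Real.Gamma_pos_of_pos (by linarith [hα.1] : 0 < α + 1)
  obtain ⟨M, hM1, hM⟩ := exists_traj_bound (cH := cH) n hα hT.le hc
  set A : ℝ := ‖(free hα p₀).1‖ + 1 with hA
  have hA0 : 0 ≤ A := by positivity
  set R : ℝ := M * (1 + A) with hR
  have hR0 : 0 ≤ R := by positivity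
  obtain ⟨C, hC⟩ : ∃ C, C = cH * (1 + R) := ⟨_, rfl⟩
  have hC0 : 0 ≤ C := by rw [hC]; positivity
  obtain ⟨lam, hlam, hlip⟩ := hH.lip_state R hR0
  -- One unit more than the 3 in `energyDensity`, so that `-lam` times the weighted square integral
  -- survives.
  obtain ⟨K, hK, henergy⟩ := exists_weight_energy n hα (Λ := 4 * lam) (by positivity)
  obtain ⟨B, hB0, hB⟩ : ∃ B, 0 ≤ B ∧ ∀ ψ : ℝ → Vec n, IsControl (C + C) ψ → ∀ τ ∈ Icc 0 T,
      ‖rlIntegral α ψ τ‖ ≤ B := by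
    refine ⟨(C + C) * T ^ α / Real.Gamma (α + 1), by positivity, fun ψ hψ τ hτ => ?_⟩
    refine (norm_rlIntegral_le hψ ⟨hα.1, hα.2.le⟩ hτ.1).trans ?_
    have h1 := hα.1.le
    have h2 := hτ.1
    have h3 := hτ.2
    gcongr
  obtain ⟨L, hL0, hL⟩ : ∃ L, 0 ≤ L ∧ ∀ ψ : ℝ → Vec n, IsControl (C + C) ψ → ∀ τ ∈ Icc 0 T,
      ∀ t ∈ Icc 0 T, ‖rlIntegral α ψ τ - rlIntegral α ψ t‖ ≤ L * |τ - t| ^ α :=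
    ⟨2 * (C + C) / Real.Gamma (α + 1), by positivity, fun ψ hψ τ hτ t ht =>
      norm_rlIntegral_sub_le hψ ⟨hα.1, hα.2.le⟩ ht.1 hτ.1⟩
  obtain ⟨S, hS0, hS⟩ := exists_hamiltonian_bound hH R
  obtain ⟨δ, hδ, N, hN0, hbd⟩ := exists_uniform_boundary hα hT hC0 p₀ hσ
    (by positivity : 0 < κ / 4)
  obtain ⟨m, hm, hsmall⟩ := exists_small_of_integral_sq (n := n) (T := T) hα.1 hL0 (half_pos hδ)
  obtain ⟨ε₁, hε₁, hε₁'⟩ := exists_pos_forall_le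
    (f := fun ε => T * (lam * ε * Real.exp (K * T) / 4)) (by fun_prop) (by simp)
    (by positivity : 0 < κ / 8)
  obtain ⟨ε₂, hε₂, hε₂'⟩ := exists_pos_forall_le
    (f := fun ε => Real.exp (K * T) * (2 * N * ε / lam)) (by fun_prop) (by simp) hm
  -- Order of the choices: `δ`, `N`, `m` come from `σ` and the Hölder constant; `ε` depends on them;
  -- the time step `h` and the distance `η` of the initial data come last because their errors carry
  -- the factor `1 / ε`. The errors add up to less than `κ`.
  obtain ⟨ε, hε, h1ε, h2ε⟩ : ∃ ε > 0, T * (lam * ε * Real.exp (K * T) / 4) ≤ κ / 8 ∧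
      Real.exp (K * T) * (2 * N * ε / lam) ≤ m :=
    ⟨min ε₁ ε₂, by positivity, hε₁' _ ⟨by positivity, min_le_left _ _⟩,
      hε₂' _ ⟨by positivity, min_le_right _ _⟩⟩
  obtain ⟨ω, hω, hω'⟩ := exists_pos_forall_le
    (f := fun ω => T * (ω * (C + C + lam * (R + R)))) (by fun_prop) (by simp)
    (by positivity : 0 < κ / 8)
  replace hω' := hω' ω ⟨hω.le, le_rfl⟩
  obtain ⟨h, hh, hh'⟩ := exists_pos_forall_le
    (f := fun d => 2 / ε * (L * d ^ α + K * d * B))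
    (continuous_const.mul ((continuous_const_mul_rpow hα.1 L).add (by fun_prop)))
    (by simp [Real.zero_rpow hα.1.ne']) hω
  obtain ⟨η₁, hη₁, hη₁'⟩ := exists_pos_forall_le
    (f := fun η => T * ((η + η) * lam * (1 + 2 / ε * B)) + S * (4 * η) +
      1 / ε * (2 * B * (C + C) * (2 * η))) (by fun_prop) (by simp) (by positivity : 0 < κ / 8)
  obtain ⟨η, hη, h1η, hηδ, hη1⟩ : ∃ η > 0, T * ((η + η) * lam * (1 + 2 / ε * B)) + S * (4 * η) +
      1 / ε * (2 * B * (C + C) * (2 * η)) ≤ κ / 8 ∧ η ≤ δ / 4 ∧ η ≤ 1 :=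
    ⟨min η₁ (min (δ / 4) 1), by positivity, hη₁' _ ⟨by positivity, min_le_left _ _⟩,
      (min_le_right _ _).trans (min_le_left _ _), (min_le_right _ _).trans (min_le_right _ _)⟩
  obtain ⟨d, hd, hd'⟩ := exists_delta_free hα p₀ hη
  refine ⟨d, hd, fun p q hp hq => ?_⟩
  obtain ⟨hpt, hpf⟩ := hd' p hp
  obtain ⟨hqt, hqf⟩ := hd' q hq
  have hbound : ∀ p : GAlpha α T n,
      (∀ τ ∈ Icc 0 T, ‖ev (free hα p).1 τ - ev (free hα p₀).1 τ‖ ≤ η) →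
      ∀ x ∈ Traj cH p, ∀ τ ∈ Icc 0 T, ‖ev x.1 τ‖ ≤ R := by
    intro p hf
    refine hM p A hA0 fun τ hτ => ?_
    have h1 := norm_sub_norm_le (ev (free hα p).1 τ) (ev (free hα p₀).1 τ)
    have h2 := hf τ hτ
    have h3 := norm_ev_le (free hα p₀).1 hτ
    rw [hA]
    linarith
  have hpR := hbound p hpf
  have hqR := hbound q hqf
  set T₀ := max p.1.t q.1.t with hT₀
  have hT₀T : T₀ ∈ Icc 0 T :=
    ⟨p.1.ht.1.trans (le_max_left _ _), max_le p.1.ht.2 q.1.ht.2⟩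
  rw [abs_lt] at hpt hqt
  have hTp : T₀ - p.1.t ≤ 2 * η := by
    rcases max_cases p.1.t q.1.t with h | h <;> rw [hT₀, h.1] <;> linarith
  have hTq : T₀ - q.1.t ≤ 2 * η := by
    rcases max_cases p.1.t q.1.t with h | h <;> rw [hT₀, h.1] <;> linarith
  have hTm : T₀ - min p.1.t q.1.t ≤ 2 * η := by
    rcases min_cases p.1.t q.1.t with h | h <;> rw [h.1] <;> linarith
  -- The two histories may end at different times. Both are first carried to the later one, `T₀`,
  -- with zero momentum, which costs `O(η)`.
  obtain ⟨x₁, hx₁, -, hx₁'⟩ := hφp.step (free_mem_traj hα hc.le p) p.1.ht hT₀T le_rfl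
    (le_max_left _ _) 0 (by positivity : 0 < κ / 24)
  obtain ⟨y₁, hy₁, -, hy₁'⟩ := hφm.step (free_mem_traj hα hc.le q) q.1.ht hT₀T le_rfl
    (le_max_right _ _) 0 (by positivity : 0 < κ / 24)
  rw [hist_free] at hx₁' hy₁'
  have hzx := zInt_zero_le (H := H) p.1.ht.1 (le_max_left p.1.t q.1.t) hT₀T.2 (hpR x₁ hx₁) hS
  have hzy := zInt_zero_le (H := H) q.1.ht.1 (le_max_right p.1.t q.1.t) hT₀T.2 (hqR y₁ hy₁) hS
  rw [← hT₀] at hzx hzy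
  have hstart : φm q - φp p ≤ φm (hist y₁ T₀ hT₀T) - φp (hist x₁ T₀ hT₀T) +
      (S * (4 * η) + κ / 12) := by
    rw [abs_le] at hzx hzy
    have := mul_le_mul_of_nonneg_left hTp hS0
    have := mul_le_mul_of_nonneg_left hTq hS0
    linarith
  have hpqf : ∀ τ ∈ Icc 0 T, ‖ev (free hα p).1 τ - ev (free hα q).1 τ‖ ≤ η + η := by
    intro τ hτ
    have h1 := hqf τ hτ
    rw [norm_sub_rev] at h1
    exact (norm_sub_le_norm_sub_add_norm_sub _ (ev (free hα p₀).1 τ) _).trans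
      (add_le_add (hpf τ hτ) h1)
  obtain ⟨hTT, x, hx, y, hy, hend⟩ := chain hα hH hφp hφm hC0 (le_max_left p.1.t q.1.t)
    (le_max_right p.1.t q.1.t) hT₀T.2 hh
    (fun x hx y hy t ht => zRate_sub_le hα hH hR0 hlam hK hε (by positivity) hlip hpR hqR hpqf hC
      hB hL hh' hx hy ((le_max_left _ _).trans ht.1) ((le_max_right _ _).trans ht.1))
    (by positivity : 0 < κ / 24) ⟨hT₀T, x₁, hx₁, y₁, hy₁, hstart⟩
  rw [hist_eq_terminal hT, hist_eq_terminal hT] at hend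
  have hxp : Prolongs C p x := hC ▸ Traj.prolongs hx hc.le (hpR x hx)
  have hyq : Prolongs C q y := hC ▸ Traj.prolongs hy hc.le (hqR y hy)
  have hpc := isControl_pairControl hC0 p q x y
  set ρ := rlIntegral α (pairControl C p q x y) with hρ
  set J := ∫ t in (0 : ℝ)..T, Real.exp (-(K * t)) * ‖ρ t‖ ^ 2 with hJ
  have hE := integral_energyDensity_le hα hpc hlam.le hK (henergy T hT.le _ _ hpc)
    (le_min p.1.ht.1 q.1.ht.1) min_le_max hT₀T.2 (fun τ hτ => by
      rw [pairControl, cutCaputo_eq_zero fun h => absurd h.1 (not_lt.2 (hτ.trans (min_le_left _ _))),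
        cutCaputo_eq_zero fun h => absurd h.1 (not_lt.2 (hτ.trans (min_le_right _ _))), sub_zero])
    (hB _ hpc)
  rw [← hT₀, ← hρ, ← hJ] at hE
  have hE' : 1 / ε * (∫ τ in T₀..T, energyDensity α lam K (pairControl C p q x y) τ) ≤
      -(lam / ε * J) + 1 / ε * (2 * B * (C + C) * (2 * η)) := by
    calc _ ≤ 1 / ε * (-lam * J + 2 * B * (C + C) * (2 * η)) := by
          gcongr
          exact hE.trans (by gcongr)
      _ = _ := by ring
  have hκ1 : (lam * ε * Real.exp (K * T) / 4 + (η + η) * lam * (1 + 2 / ε * B) +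
      ω * (C + C + lam * (R + R))) * (T - T₀) ≤ T * (lam * ε * Real.exp (K * T) / 4) +
        T * ((η + η) * lam * (1 + 2 / ε * B)) + T * (ω * (C + C + lam * (R + R))) := by
    have h1 : 0 ≤ lam * ε * Real.exp (K * T) / 4 + (η + η) * lam * (1 + 2 / ε * B) +
      ω * (C + C + lam * (R + R)) := by positivity
    refine (mul_le_mul_of_nonneg_left (by linarith [hT₀T.1] : T - T₀ ≤ T) h1).trans_eq ?_
    ring
  obtain ⟨hσx, hσxy⟩ := hbd p (abs_le.2 ⟨by linarith, by linarith⟩)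
    (fun τ hτ => (hpf τ hτ).trans (by linarith)) x hxp
  obtain ⟨hσy, -⟩ := hbd q (abs_le.2 ⟨by linarith, by linarith⟩)
    (fun τ hτ => (hqf τ hτ).trans (by linarith)) y hyq
  -- Dichotomy on the penalty: either it exceeds `2 * N`, the largest possible oscillation of `σ`,
  -- or `J` is of order `ε`; then `ρ` is uniformly small and `σ y` is close to `σ x`.
  have hfinal : σ y - σ x - lam / ε * J ≤ κ / 4 := by
    have hJ0 : 0 ≤ J := intervalIntegral.integral_nonneg hT.le fun τ _ => by positivity
    rcases le_or_gt (2 * N) (lam / ε * J) with hcase | hcase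
    · rw [abs_le] at hσx hσy
      linarith
    · have hJ1 : J ≤ 2 * N * ε / lam := by
        rw [le_div_iff₀ hlam]
        rw [div_mul_eq_mul_div, div_lt_iff₀ hε] at hcase
        linarith
      have hcont : ContinuousOn ρ (Icc 0 T) :=
        (continuousOn_rlIntegral hpc ⟨hα.1, hα.2.le⟩).mono Icc_subset_Ici_self
      have hintegral : ∫ t in (0 : ℝ)..T, ‖ρ t‖ ^ 2 ≤ m := by
        refine le_trans ?_ ((mul_le_mul_of_nonneg_left hJ1 (Real.exp_pos (K * T)).le).trans h2ε)
        rw [hJ, ← intervalIntegral.integral_const_mul]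
        refine intervalIntegral.integral_mono_on hT.le ?_
          ((intervalIntegrable_weight_sq hα hpc K le_rfl hT.le).const_mul _) fun τ hτ => ?_
        · refine ContinuousOn.intervalIntegrable ?_
          rw [uIcc_of_le hT.le]
          exact hcont.norm.pow 2
        · rw [← mul_assoc, ← Real.exp_add]
          refine le_mul_of_one_le_left (by positivity) (Real.one_le_exp ?_)
          have := mul_le_mul_of_nonneg_left hτ.2 hK
          linarith
      have hρθ := hsmall ρ hcont rlIntegral_zero_right (fun t ht s hs => hL _ hpc t ht s hs)
        hintegral
      have h3 := hσxy y fun τ hτ => by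
        have e : ρ τ = rlIntegral α (cutCaputo C p.1.t x) τ - rlIntegral α (cutCaputo C q.1.t y) τ :=
          rlIntegral_sub (isControl_cutCaputo hC0 _ _) (isControl_cutCaputo hC0 _ _) hα.1 _
        have e' : ev x.1 τ - ev y.1 τ = (ev (free hα p).1 τ - ev (free hα q).1 τ) + ρ τ := by
          rw [hxp.ev_eq hα hτ, hyq.ev_eq hα hτ, e]
          abel
        rw [e']
        have h4 := hρθ τ hτ
        have h5 := hpqf τ hτ
        exact (norm_add_le _ _).trans (by linarith)
      have h6 : 0 ≤ lam / ε * J := by positivity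
      have h7 := (abs_le.1 h3).2
      linarith
  have h8 := hbp x
  have h9 := hbm y
  linarith

end FracHJ

end

/-! ### Existence by Perron's method, and uniqueness. -/

noncomputable section

open Filter

namespace FracHJ

variable {n : ℕ} {α C T cH : ℝ} {H : ℝ → Vec n → Vec n → ℝ}

/-! ### Value functionals -/

theorem exists_traj_norm_bound (hα : α ∈ Ioo (0 : ℝ) 1) (hc : 0 < cH) (p : GAlpha α T n) :
    ∃ R, 0 ≤ R ∧ ∀ x ∈ Traj cH p, ∀ τ ∈ Icc 0 T, ‖ev x.1 τ‖ ≤ R := by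
  obtain ⟨M, hM1, hM⟩ := exists_traj_bound (cH := cH) n hα (p.1.ht.1.trans p.1.ht.2) hc
  exact ⟨M * (1 + ‖(free hα p).1‖), by positivity,
    hM p _ (norm_nonneg _) fun τ hτ => norm_ev_le _ hτ⟩

theorem exists_zInt_bound (hα : α ∈ Ioo (0 : ℝ) 1) (hH : IsHamiltonian T cH H)
    (p : GAlpha α T n) (s : Vec n) :
    ∃ Z, ∀ x ∈ Traj cH p, ∀ b ∈ Icc p.1.t T, |zInt H s x p.1.t b| ≤ Z := by
  obtain ⟨R, hR0, hR⟩ := exists_traj_norm_bound hα hH.pos p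
  obtain ⟨S, hS0, hS⟩ := exists_hamiltonian_bound hH R
  have hc := hH.pos
  set N := ‖s‖ * (cH * (1 + R)) + (S + cH * (1 + R) * ‖s‖) with hN
  refine ⟨N * T, fun x hx b hb => ?_⟩
  have h1 : ∀ᵐ τ, τ ∈ uIoc p.1.t b → ‖zRate H s x τ‖ ≤ N := by
    filter_upwards [hx.2] with τ h hτ
    rw [uIoc_of_le hb.1] at hτ
    have hτT : τ ∈ Icc 0 T := ⟨p.1.ht.1.trans hτ.1.le, hτ.2.trans hb.2⟩
    have hxR := hR x hx τ hτT
    refine (norm_sub_le _ _).trans (add_le_add ?_ ?_)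
    · refine (norm_inner_le_norm _ _).trans ?_
      gcongr
      exact (h ⟨hτ.1.le, hτT.2⟩).trans (by gcongr)
    · have h2 := hH.lip_momentum τ hτT (ev x.1 τ) s 0
      rw [sub_zero] at h2
      have h3 := hS τ hτT _ hxR
      have h4 : cH * (1 + ‖ev x.1 τ‖) * ‖s‖ ≤ cH * (1 + R) * ‖s‖ := by gcongr
      have h5 := abs_sub_abs_le_abs_sub (H τ (ev x.1 τ) s) (H τ (ev x.1 τ) 0)
      rw [Real.norm_eq_abs]
      linarith
  refine (intervalIntegral.norm_integral_le_of_norm_le_const_ae h1).trans ?_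
  rw [abs_of_nonneg (by linarith [hb.1])]
  gcongr
  linarith [hb.2, p.1.ht.1]

theorem exists_boundary_bound (hα : α ∈ Ioo (0 : ℝ) 1) (hT : 0 < T) (hc : 0 < cH)
    {σ : AC α T n → ℝ} (hσ : Continuous σ) (p : GAlpha α T n) :
    ∃ N, ∀ x ∈ Traj cH p, |σ x| ≤ N := by
  obtain ⟨R, hR0, hR⟩ := exists_traj_norm_bound hα hc p
  obtain ⟨N, hN⟩ := (isCompact_prolongs hα (by positivity : 0 ≤ cH * (1 + R)) hT
    p).exists_bound_of_continuousOn hσ.continuousOn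
  exact ⟨N, fun x hx => hN x (Traj.prolongs hx hc.le (hR x hx))⟩

/-- The largest value of `g` minus the increment of the `z`-component until the time `b`. -/
def value (H : ℝ → Vec n → Vec n → ℝ) (cH : ℝ) (s : Vec n) (g : AC α T n → ℝ) (b : ℝ)
    (p : GAlpha α T n) : ℝ :=
  sSup ((fun x => g x - zInt H s x p.1.t b) '' Traj cH p)

theorem value_le (hα : α ∈ Ioo (0 : ℝ) 1) (hc : 0 ≤ cH) {s : Vec n} {g : AC α T n → ℝ} {b V : ℝ}
    {p : GAlpha α T n} (h : ∀ x ∈ Traj cH p, g x - zInt H s x p.1.t b ≤ V) :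
    value H cH s g b p ≤ V :=
  csSup_le ⟨_, mem_image_of_mem _ (free_mem_traj hα hc p)⟩ (by rintro _ ⟨x, hx, rfl⟩; exact h x hx)

theorem le_value {s : Vec n} {g : AC α T n → ℝ} {b : ℝ} {p : GAlpha α T n}
    (hbdd : BddAbove ((fun x => g x - zInt H s x p.1.t b) '' Traj cH p)) {x : AC α T n}
    (hx : x ∈ Traj cH p) : g x - zInt H s x p.1.t b ≤ value H cH s g b p :=
  le_csSup hbdd (mem_image_of_mem _ hx)

/-- Value functionals do not increase along trajectories. -/
theorem value_hist_le (hα : α ∈ Ioo (0 : ℝ) 1) (hH : IsHamiltonian T cH H) {s : Vec n}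
    {g : AC α T n → ℝ} {b : ℝ} {p : GAlpha α T n}
    (hbdd : BddAbove ((fun x => g x - zInt H s x p.1.t b) '' Traj cH p)) (hb : b ∈ Icc 0 T)
    {x : AC α T n} (hx : x ∈ Traj cH p) {t : ℝ} (ht : t ∈ Icc 0 T) (hpt : p.1.t ≤ t) :
    value H cH s g b (hist x t ht) ≤ value H cH s g b p + zInt H s x p.1.t t := by
  refine value_le hα hH.pos.le fun y hy => ?_
  obtain ⟨hyp, hyx⟩ := Traj.concat hx ht hpt hy
  have h1 := le_value hbdd hyp
  have h2 := zInt_add hα hH s y p.1.ht ht hb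
  have h3 : zInt H s y p.1.t t = zInt H s x p.1.t t :=
    zInt_congr s hyx ⟨p.1.ht.1, hpt⟩ ⟨ht.1, le_rfl⟩
  have h4 : zInt H s y (hist x t ht).1.t b = zInt H s y t b := rfl
  linarith

theorem bddAbove_boundary (hα : α ∈ Ioo (0 : ℝ) 1) (hT : 0 < T) (hH : IsHamiltonian T cH H)
    {σ : AC α T n → ℝ} (hσ : Continuous σ) (p : GAlpha α T n) :
    BddAbove ((fun x => σ x - zInt H 0 x p.1.t T) '' Traj cH p) := by
  obtain ⟨N, hN⟩ := exists_boundary_bound hα hT hH.pos hσ p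
  obtain ⟨Z, hZ⟩ := exists_zInt_bound hα hH p 0
  refine ⟨N + Z, ?_⟩
  rintro _ ⟨x, hx, rfl⟩
  have h1 := abs_le.1 (hN x hx)
  have h2 := abs_le.1 (hZ x hx T ⟨p.1.ht.2, le_rfl⟩)
  simp only
  linarith

/-! ### The smallest upper stable functional -/

/-- Upper stable functionals with the exact boundary values. -/
structure IsUpper (hT : 0 < T) (H : ℝ → Vec n → Vec n → ℝ) (cH : ℝ) (σ : AC α T n → ℝ)
    (φ : GAlpha α T n → ℝ) : Prop where
  stable : UpStable H cH φ
  boundary : ∀ w, φ (terminal hT w) = σ w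

/-- The supremum for momentum `0` does not increase along any trajectory, after subtraction of the
`z`-increment. For another momentum `s` one follows a trajectory on which the increments for `s` and
`0` coincide. -/
theorem isUpper_value (hα : α ∈ Ioo (0 : ℝ) 1) (hT : 0 < T) (hH : IsHamiltonian T cH H)
    {σ : AC α T n → ℝ} (hσ : Continuous σ) : IsUpper hT H cH σ (value H cH 0 σ T) := by
  have hTT : T ∈ Icc 0 T := ⟨hT.le, le_rfl⟩
  refine ⟨fun p t ht hpt s ε hε => ?_, fun w => ?_⟩
  · obtain ⟨x, hx, hxz⟩ := exists_common_traj hα hH p s 0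
    refine ⟨x, hx, ?_⟩
    have h1 := value_hist_le hα hH (bddAbove_boundary hα hT hH hσ p) hTT hx ht hpt.le
    rw [hxz p.1.t ⟨le_rfl, p.1.ht.2⟩ t ⟨hpt.le, ht.2⟩]
    linarith
  · have hz : ∀ x : AC α T n, zInt H 0 x (terminal hT w).1.t T = 0 := fun x =>
      intervalIntegral.integral_same
    have hw : w ∈ Traj cH (terminal hT w) := by
      refine ⟨fun τ _ => rfl, ?_⟩
      filter_upwards [ae_mem_Ioo_of_mem_Icc T T] with τ h hτ
      exact absurd (h hτ) (by simp)
    refine le_antisymm (value_le hα hH.pos.le fun x hx => ?_) ?_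
    · have : x = w := Subtype.ext (ext_ev fun τ hτ => hx.1 τ hτ)
      rw [this, hz, sub_zero]
    · have := le_value (bddAbove_boundary hα hT hH hσ (terminal hT w)) hw
      rwa [hz, sub_zero] at this

/-- Upper stability with momentum `0` up to time `T` compares `φ p` with a boundary value, and these
are bounded on the trajectories from `p`. -/
theorem exists_lower_bound (hα : α ∈ Ioo (0 : ℝ) 1) (hT : 0 < T) (hH : IsHamiltonian T cH H)
    {σ : AC α T n → ℝ} (hσ : Continuous σ) (p : GAlpha α T n) :
    ∃ N, ∀ φ, IsUpper hT H cH σ φ → N ≤ φ p := by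
  obtain ⟨N, hN⟩ := exists_boundary_bound hα hT hH.pos hσ p
  obtain ⟨Z, hZ⟩ := exists_zInt_bound hα hH p 0
  refine ⟨-N - Z - 1, fun φ hφ => ?_⟩
  obtain ⟨y, hy, -, h1⟩ := hφ.stable.step (free_mem_traj hα hH.pos.le p) p.1.ht (right_mem_Icc.2 hT.le)
    le_rfl p.1.ht.2 0 one_pos
  rw [hist_free, hist_eq_terminal hT, hφ.boundary] at h1
  have h2 := abs_le.1 (hN y hy)
  have h3 := abs_le.1 (hZ y hy T ⟨p.1.ht.2, le_rfl⟩)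
  linarith

/-- The pointwise infimum of the upper stable functionals with the given boundary values. -/
def lowerEnvelope (hT : 0 < T) (H : ℝ → Vec n → Vec n → ℝ) (cH : ℝ) (σ : AC α T n → ℝ)
    (p : GAlpha α T n) : ℝ :=
  sInf ((fun φ : GAlpha α T n → ℝ => φ p) '' {φ | IsUpper hT H cH σ φ})

theorem lowerEnvelope_le (hα : α ∈ Ioo (0 : ℝ) 1) {hT : 0 < T} (hH : IsHamiltonian T cH H)
    {σ : AC α T n → ℝ} (hσ : Continuous σ) {φ : GAlpha α T n → ℝ} (hφ : IsUpper hT H cH σ φ)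
    (p : GAlpha α T n) : lowerEnvelope hT H cH σ p ≤ φ p := by
  obtain ⟨N, hN⟩ := exists_lower_bound hα hT hH hσ p
  refine csInf_le ⟨N, ?_⟩ ⟨φ, hφ, rfl⟩
  rintro _ ⟨φ, hφ, rfl⟩
  exact hN φ hφ

/-- The class `IsUpper` requires no semicontinuity, so the infimum stays in it: the trajectory of a
nearly optimal `φ` at `p` serves the infimum too. -/
theorem isUpper_lowerEnvelope (hα : α ∈ Ioo (0 : ℝ) 1) (hT : 0 < T) (hH : IsHamiltonian T cH H)
    {σ : AC α T n → ℝ} (hσ : Continuous σ) : IsUpper hT H cH σ (lowerEnvelope hT H cH σ) := by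
  have hne := isUpper_value hα hT hH hσ
  refine ⟨fun p t ht hpt s ε hε => ?_, fun w => ?_⟩
  · obtain ⟨_, ⟨φ, hφ, rfl⟩, h1⟩ := exists_lt_of_csInf_lt (⟨_, ⟨_, hne, rfl⟩⟩ :
      ((fun φ : GAlpha α T n → ℝ => φ p) '' {φ | IsUpper hT H cH σ φ}).Nonempty)
      (lt_add_of_pos_right (lowerEnvelope hT H cH σ p) (half_pos hε))
    obtain ⟨x, hx, h2⟩ := hφ.stable p t ht hpt s (ε / 2) (half_pos hε)
    refine ⟨x, hx, ?_⟩
    have h3 := lowerEnvelope_le hα hH hσ hφ (hist x t ht)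
    simp only at h1
    linarith
  · refine le_antisymm ?_ (le_csInf ⟨_, ⟨_, hne, rfl⟩⟩ ?_)
    · rw [← hne.boundary w]
      exact lowerEnvelope_le hα hH hσ hne _
    · rintro _ ⟨φ, hφ, rfl⟩
      exact (hφ.boundary w).ge

theorem bddAbove_lowerEnvelope (hα : α ∈ Ioo (0 : ℝ) 1) (hT : 0 < T) (hH : IsHamiltonian T cH H)
    {σ : AC α T n → ℝ} (hσ : Continuous σ) (s : Vec n) {t : ℝ} (ht : t ∈ Icc 0 T)
    {p : GAlpha α T n} (hpt : p.1.t ≤ t) :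
    BddAbove ((fun x => lowerEnvelope hT H cH σ (hist x t ht) - zInt H s x p.1.t t) ''
      Traj cH p) := by
  obtain ⟨Z, hZ⟩ := exists_zInt_bound hα hH p 0
  obtain ⟨Z', hZ'⟩ := exists_zInt_bound hα hH p s
  refine ⟨value H cH 0 σ T p + Z + Z', ?_⟩
  rintro _ ⟨x, hx, rfl⟩
  have h1 := lowerEnvelope_le hα hH hσ (isUpper_value hα hT hH hσ) (hist x t ht)
  have h2 := value_hist_le hα hH (bddAbove_boundary hα hT hH hσ p) ⟨hT.le, le_rfl⟩ hx ht hpt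
  have h3 := abs_le.1 (hZ x hx t ⟨hpt, ht.2⟩)
  have h4 := abs_le.1 (hZ' x hx t ⟨hpt, ht.2⟩)
  simp only
  linarith

-- Perron's bump argument. If lower stability fails at `p` for the data `t`, `s`, `ε`, then the
-- largest value `ψ` attainable from the envelope at time `t` with momentum `s` lies below the
-- envelope at `p`. The minimum of both before time `t` is again in the class `IsUpper`, which
-- contradicts minimality.
open Classical in
theorem lowStable_lowerEnvelope (hα : α ∈ Ioo (0 : ℝ) 1) (hT : 0 < T) (hH : IsHamiltonian T cH H)
    {σ : AC α T n → ℝ} (hσ : Continuous σ) : LowStable H cH (lowerEnvelope hT H cH σ) := by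
  intro p t ht hpt s ε hε
  by_contra hcon
  push Not at hcon
  set φ₀ := lowerEnvelope hT H cH σ with hφ₀
  have hU := isUpper_lowerEnvelope hα hT hH hσ
  rw [← hφ₀] at hU
  set ψ := value H cH s (fun x => φ₀ (hist x t ht)) t with hψ
  have hbdd := fun (q : GAlpha α T n) (hq : q.1.t ≤ t) =>
    bddAbove_lowerEnvelope hα hT hH hσ s ht hq
  rw [← hφ₀] at hbdd
  set φ₁ : GAlpha α T n → ℝ := fun q => if q.1.t < t then min (φ₀ q) (ψ q) else φ₀ q with hφ₁
  have hle0 : ∀ q, φ₁ q ≤ φ₀ q := by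
    intro q
    simp only [hφ₁]
    split_ifs
    exacts [min_le_left _ _, le_rfl]
  have hleψ : ∀ q, q.1.t < t → φ₁ q ≤ ψ q := by
    intro q hq
    simp only [hφ₁, if_pos hq]
    exact min_le_right _ _
  have hφ₁U : IsUpper hT H cH σ φ₁ := by
    refine ⟨fun q r hr hqr s' e he => ?_, fun w => ?_⟩
    · by_cases hcase : q.1.t < t ∧ ψ q < φ₀ q
      · obtain ⟨hqt, hlt⟩ := hcase
        have e1 : φ₁ q = ψ q := by simp only [hφ₁, if_pos hqt, min_eq_right hlt.le]
        obtain ⟨x, hx, hxz⟩ := exists_common_traj hα hH q s s'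
        have hq0 : q.1.t ∈ Icc q.1.t T := ⟨le_rfl, q.1.ht.2⟩
        -- On the common trajectory of `s` and `s'`, `ψ` does not increase until `t`. If the target
        -- time is later, the envelope's own stability with `s'` takes over at `t`, where `ψ`
        -- dominates the envelope by definition.
        rcases lt_or_ge r t with hrt | hrt
        · refine ⟨x, hx, ?_⟩
          have h1 := value_hist_le hα hH (hbdd q hqt.le) ht hx hr hqr.le
          have h2 := hleψ (hist x r hr) hrt
          rw [← hxz q.1.t hq0 r ⟨hqr.le, hr.2⟩, e1]
          linarith
        · obtain ⟨y, hy, hyx, h3⟩ := hU.stable.step hx ht hr hqt.le hrt s' he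
          refine ⟨y, hy, ?_⟩
          have h4 := le_value (hbdd q hqt.le) hx
          have h5 := zInt_add hα hH s' y q.1.ht ht hr
          have h6 : zInt H s' y q.1.t t = zInt H s' x q.1.t t :=
            zInt_congr s' hyx ⟨q.1.ht.1, hqt.le⟩ ⟨ht.1, le_rfl⟩
          have h7 := hxz q.1.t hq0 t ⟨hqt.le, ht.2⟩
          have h8 := hle0 (hist y r hr)
          rw [e1]
          simp only [← hψ] at h4
          linarith
      · have e1 : φ₁ q = φ₀ q := by
          simp only [hφ₁]
          split_ifs with h
          · exact min_eq_left (not_lt.1 fun h' => hcase ⟨h, h'⟩)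
          · rfl
        obtain ⟨x, hx, h1⟩ := hU.stable q r hr hqr s' e he
        have h2 := hle0 (hist x r hr)
        exact ⟨x, hx, by rw [e1]; linarith⟩
    · have : ¬ (terminal hT w : GAlpha α T n).1.t < t := not_lt.2 ht.2
      simp only [hφ₁, if_neg this, hU.boundary]
  have h1 : φ₀ p ≤ φ₁ p := lowerEnvelope_le hα hH hσ hφ₁U p
  have h2 : ψ p ≤ φ₀ p - ε := value_le hα hH.pos.le fun x hx => (hcon x hx).le
  linarith [hleψ p hpt]

/-! ### Minimax solutions -/

theorem IsUpperSolution.upStable {hT : 0 < T} {σ : AC α T n → ℝ} {φ : GAlpha α T n → ℝ}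
    (h : IsUpperSolution hT H cH σ φ) : UpStable H cH φ := by
  intro p t ht hpt s ε hε
  obtain ⟨xz, hxz, h1⟩ := h.stable p (hpt.trans_le ht.2) t ht hpt s ε hε
  obtain ⟨h2, h3⟩ := CH_spec hxz
  exact ⟨xz.1, h2, by rwa [h3 t ⟨hpt.le, ht.2⟩] at h1⟩

theorem IsLowerSolution.lowStable {hT : 0 < T} {σ : AC α T n → ℝ} {φ : GAlpha α T n → ℝ}
    (h : IsLowerSolution hT H cH σ φ) : LowStable H cH φ := by
  intro p t ht hpt s ε hε
  obtain ⟨xz, hxz, h1⟩ := h.stable p (hpt.trans_le ht.2) t ht hpt s ε hε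
  obtain ⟨h2, h3⟩ := CH_spec hxz
  exact ⟨xz.1, h2, by rwa [h3 t ⟨hpt.le, ht.2⟩] at h1⟩

/-- Continuity comes for free: the envelope plays both roles in `comparison`, and the pairs `(p,
p₀)` and `(p₀, p)` give the two one-sided estimates. -/
theorem isMinimaxSolution_lowerEnvelope (hα : α ∈ Ioo (0 : ℝ) 1) (hT : 0 < T)
    (hH : IsHamiltonian T cH H) {σ : AC α T n → ℝ} (hσ : Continuous σ) :
    IsMinimaxSolution hT H cH σ (lowerEnvelope hT H cH σ) := by
  have hU := isUpper_lowerEnvelope hα hT hH hσ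
  have hL := lowStable_lowerEnvelope hα hT hH hσ
  have hcont : Continuous (lowerEnvelope hT H cH σ) := by
    rw [Metric.continuous_iff]
    intro p₀ κ hκ
    obtain ⟨δ, hδ, h⟩ := comparison hα hT hH hσ hU.stable hL (fun w => (hU.boundary w).ge)
      (fun w => (hU.boundary w).le) p₀ (half_pos hκ)
    refine ⟨δ, hδ, fun p hp => ?_⟩
    have h0 : dist p₀ p₀ < δ := by rwa [dist_self]
    have h1 := h p p₀ hp h0
    have h2 := h p₀ p h0 hp
    rw [Real.dist_eq, abs_lt]
    constructor <;> linarith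
  refine ⟨⟨hcont.lowerSemicontinuous, fun w => (hU.boundary w).ge, ?_⟩,
    ⟨hcont.upperSemicontinuous, fun w => (hU.boundary w).le, ?_⟩⟩
  · intro p _ t ht hpt s ε hε
    obtain ⟨x, hx, h1⟩ := hU.stable p t ht hpt s ε hε
    obtain ⟨z, hz⟩ := exists_mem_CH hα hH s hx
    exact ⟨(x, z), hz, by rwa [(CH_spec hz).2 t ⟨hpt.le, ht.2⟩]⟩
  · intro p _ t ht hpt s ε hε
    obtain ⟨x, hx, h1⟩ := hL p t ht hpt s ε hε
    obtain ⟨z, hz⟩ := exists_mem_CH hα hH s hx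
    exact ⟨(x, z), hz, by rwa [(CH_spec hz).2 t ⟨hpt.le, ht.2⟩]⟩

theorem IsLowerSolution.le (hα : α ∈ Ioo (0 : ℝ) 1) {hT : 0 < T} (hH : IsHamiltonian T cH H)
    {σ : AC α T n → ℝ} (hσ : Continuous σ) {φm φp : GAlpha α T n → ℝ}
    (hm : IsLowerSolution hT H cH σ φm) (hp : IsUpperSolution hT H cH σ φp) (p : GAlpha α T n) :
    φm p ≤ φp p := by
  refine le_of_forall_pos_le_add fun κ hκ => ?_
  obtain ⟨δ, hδ, h⟩ := comparison hα hT hH hσ hp.upStable hm.lowStable hp.boundary hm.boundary p hκ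
  exact h p p (by rwa [dist_self]) (by rwa [dist_self])

end FracHJ

end

theorem mainTheorem1 (n : ℕ) (α T : ℝ) (hα : α ∈ Set.Ioo (0 : ℝ) 1) (hT : 0 < T)
    (H : ℝ → FracHJ.Vec n → FracHJ.Vec n → ℝ) (σ : FracHJ.AC α T n → ℝ) (cH : ℝ)
    (H1 : ContinuousOn (fun q : ℝ × FracHJ.Vec n × FracHJ.Vec n => H q.1 q.2.1 q.2.2)
      (Set.Icc (0 : ℝ) T ×ˢ Set.univ))
    (hcH : 0 < cH)
    (H2 : ∀ t ∈ Set.Icc (0 : ℝ) T, ∀ x s s' : FracHJ.Vec n,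
      |H t x s - H t x s'| ≤ cH * (1 + ‖x‖) * ‖s - s'‖)
    (H3 : ∀ R : ℝ, 0 ≤ R → ∃ lam : ℝ, 0 < lam ∧
      ∀ t ∈ Set.Icc (0 : ℝ) T, ∀ x x' s : FracHJ.Vec n, ‖x‖ ≤ R → ‖x'‖ ≤ R →
        |H t x s - H t x' s| ≤ lam * (1 + ‖s‖) * ‖x - x'‖)
    (hσ : Continuous σ) :
    ∃! φ : FracHJ.GAlpha α T n → ℝ, FracHJ.IsMinimaxSolution hT H cH σ φ := by
  have hH : FracHJ.IsHamiltonian T cH H := ⟨H1, hcH, H2, H3⟩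
  have hsol := FracHJ.isMinimaxSolution_lowerEnvelope hα hT hH hσ
  refine ⟨_, hsol, fun φ hφ => funext fun p => le_antisymm ?_ ?_⟩
  · exact hφ.2.le hα hH hσ hsol.1 p
  · exact hsol.2.le hα hH hσ hφ.1 p
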